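/- For a positive integer $n$, a Dirichlet character $\chi$ modulo $n$ and an integer $m$, put $$K_\chi(m)=n^{-1/2}\sum_{\substack{u \bmod n\\ (u,n)=1}}\chi(1+u)\,\overline{\chi(u)}\,e^{2\pi i mu/n}.$$ For coprime positive integers $q_1,Q_1$, a Dirichlet character $\psi_1$ modulo $Q_1$ and a sign $\pm$, let $$\mathcal S_2^{\pm}(\psi_1)=\sum_{\substack{\chi_1 \bmod q_1\ \mathrm{primitive}\\ \chi_1\psi_1(-1)=\pm1}}|L(1/2,\chi_1\psi_1)|^2,$$ where $\chi_1\psi_1$ is regarded as a character modulo $q_1Q_1$. **Proposition.** For all real $\varepsilon,\delta,A>0$ there is a constant $C>0$, depending only on $\varepsilon,\delta,A$, such that the following holds. Let $q=q_1Q_1$ be squarefree with $q_1\le A\,q^{1/2-\delta}$, and fix a sign $\pm$. Then there are complex numbers $\alpha_m^{\pm}$ ($m\in\mathbb Z$, $0<|m|\le Cq^{1+\varepsilon}/q_1^2$), not depending on $\psi_1$, with $$\sum_{0<|m|\le Cq^{1+\varepsilon}/q_1^2}|\alpha_m^{\pm}|^2\le C\,\frac{q^{1+\varepsilon}}{q_1^2},$$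 such that for every primitive Dirichlet character $\psi_1$ modulo $Q_1$, $$\mathcal S_2^{\pm}(\psi_1)\le C\,q^{\varepsilon}q_1\left\{1+\frac1{Q_1^{1/2}}\left|\sum_{0<|m|\le Cq^{1+\varepsilon}/q_1^2}\alpha_m^{\pm}K_{\psi_1}(mq_1)\right|\right\}.$$ -/

import Mathlib

open scoped ComplexConjugate

noncomputable section

/-- The normalized exponential sum
`K_χ(k, ℓ) = q^{-1/2} ∑_{u mod q, (u, q) = 1} χ(ℓ + u) conj(χ(u)) e(k u / q)`. -/
def charSum {q : ℕ} [NeZero q] (χ : DirichletCharacter ℂ q) (k l : ZMod q) : ℂ :=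
  ((Real.sqrt q)⁻¹ : ℝ) *
    ∑ u : (ZMod q)ˣ, χ (l + (u : ZMod q)) * conj (χ (u : ZMod q)) *
      ZMod.stdAddChar (k * (u : ZMod q))

/-- `K_χ(m) = K_χ(m, 1)`. -/
def charSumOne {q : ℕ} [NeZero q] (χ : DirichletCharacter ℂ q) (m : ZMod q) : ℂ :=
  charSum χ m 1

/-- The Dirichlet character `n ↦ χ₁(n) ψ₁(n)` of modulus `q₁ * Q₁`. -/
def prodChar {q₁ Q₁ : ℕ} (χ₁ : DirichletCharacter ℂ q₁) (ψ₁ : DirichletCharacter ℂ Q₁) :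
    DirichletCharacter ℂ (q₁ * Q₁) :=
  DirichletCharacter.changeLevel (Nat.dvd_mul_right q₁ Q₁) χ₁ *
    DirichletCharacter.changeLevel (Nat.dvd_mul_left Q₁ q₁) ψ₁

open Classical in
/-- The short second moment: the sum of `|L(1/2, χ₁ψ₁)|²` over the primitive characters `χ₁`
modulo `q₁` for which `χ₁ψ₁(-1)` is the given sign. -/
def shortSecondMoment (q₁ : ℕ) {Q₁ : ℕ} [NeZero q₁] [NeZero Q₁] (sign : ℤˣ)
    (ψ₁ : DirichletCharacter ℂ Q₁) : ℝ :=
  ∑ χ₁ : DirichletCharacter ℂ q₁ with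
      χ₁.IsPrimitive ∧ prodChar χ₁ ψ₁ (-1) = ((sign : ℤ) : ℂ),
    ‖DirichletCharacter.LFunction (prodChar χ₁ ψ₁) (1 / 2)‖ ^ 2

/-- The finite set of integers `m` with `0 < |m| ≤ X`. -/
def punctured (X : ℝ) : Finset ℤ :=
  (Finset.Icc (-⌊X⌋) ⌊X⌋).erase 0

theorem mem_punctured (X : ℝ) (m : ℤ) : m ∈ punctured X ↔ 0 < |m| ∧ ((|m| : ℤ) : ℝ) ≤ X := by
  rw [punctured, Finset.mem_erase, Finset.mem_Icc, ← abs_le, Int.le_floor, abs_pos]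

end

/-! The central value is reached through theta functions instead of an approximate functional
equation. For a primitive character mod `q = q₁Q₁`, `Q₁ ≠ 1`, the completed `L`-function at `1/2` is
a Mellin transform of a theta series whose absolute value is, suitably normalised, invariant under
`t ↦ 1/t`. Folding the integral at `t = 1` gives `|L(1/2)| ≪ ∫_1^∞ θ(t) dt/t`
(`norm_LFunction_half_le`). Only absolute values occur, so the root number plays no role.
Cauchy–Schwarz with weight `t^(-1-η)` reduces the second moment to `∑_χ θ_χ(t)²`, and positivity
allows the sum to run over all `χ` mod `q₁`.

Orthogonality then leaves pairs `n`, `n + q₁l`. The diagonal `l = 0` has size `q^(2η)`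
(`exists_diagonal_le`). For `l ≠ 0`, Poisson summation modulo `Q₁` produces frequencies `h` with the
complete sums `charSum ψ h (q₁l)` (`tsum_correlation_eq`). The terms with `h = 0` are small because
the complete sum at frequency `0` is at most `|l| Q₁^(-1/2)`. The terms with `|lh| > q^(1+η)/q₁²`
are negligible by Gaussian decay.

In the remaining terms, the Chinese remainder theorem gives `K_ψ(h, q₁l) = gcdFactor · K_ψ(q₁lh)`
(`charSum_eq_gcdFactor_mul`). Grouping by `m = lh` and integrating over `t` gives the coefficients
`α_m`, which contain no `ψ`. If a divisor `d` of `Q₁` contributes to `gcdFactor`, then `d² ∣ m`;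
with the divisor bound this controls their mean square (`exists_sum_sq_gcdFactor_le`).

The case `Q₁ = 1` is separate: there the size condition on `q₁` bounds the modulus, and `α = 0`
suffices. -/

/-! ### The product character. -/

/-- Dividing `χψ` by `ψ` recovers `χ`, so `q₁` divides `lcm(cond(χψ), Q₁)` and, by coprimality,
`cond(χψ)`. The same holds with the roles exchanged. -/
theorem isPrimitive_prodChar {q₁ Q₁ : ℕ} [NeZero q₁] [NeZero Q₁] (hc : Nat.Coprime q₁ Q₁)
    {χ : DirichletCharacter ℂ q₁} {ψ : DirichletCharacter ℂ Q₁} (hχ : χ.IsPrimitive)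
    (hψ : ψ.IsPrimitive) : (prodChar χ ψ).IsPrimitive := by
  have h1 := DirichletCharacter.conductor_mul_dvd_lcm_conductor (prodChar χ ψ)
    (DirichletCharacter.changeLevel (Nat.dvd_mul_left Q₁ q₁) ψ)⁻¹
  have h2 := DirichletCharacter.conductor_mul_dvd_lcm_conductor (prodChar χ ψ)
    (DirichletCharacter.changeLevel (Nat.dvd_mul_right q₁ Q₁) χ)⁻¹
  rw [DirichletCharacter.conductor_inv, DirichletCharacter.conductor_changeLevel, prodChar,
    mul_inv_cancel_right, DirichletCharacter.conductor_changeLevel, hχ, hψ] at h1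
  rw [DirichletCharacter.conductor_inv, DirichletCharacter.conductor_changeLevel, prodChar,
    mul_inv_cancel_comm, DirichletCharacter.conductor_changeLevel, hχ, hψ] at h2
  exact Nat.dvd_antisymm (DirichletCharacter.conductor_dvd_level _)
    (hc.mul_dvd_of_dvd_of_dvd
      (hc.dvd_of_dvd_mul_right (h1.trans (Nat.lcm_dvd_mul _ _)))
      (hc.symm.dvd_of_dvd_mul_right (h2.trans (Nat.lcm_dvd_mul _ _))))

theorem prodChar_apply {q₁ Q₁ : ℕ} [NeZero q₁] [NeZero Q₁]
    (χ : DirichletCharacter ℂ q₁) (ψ : DirichletCharacter ℂ Q₁) (n : ℤ) :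
    prodChar χ ψ (n : ZMod (q₁ * Q₁)) = χ (n : ZMod q₁) * ψ (n : ZMod Q₁) := by
  by_cases h : IsCoprime n ((q₁ * Q₁ : ℕ) : ℤ)
  · rw [prodChar, MulChar.mul_apply, DirichletCharacter.changeLevel_eq_cast_of_dvd' _ _ h,
      DirichletCharacter.changeLevel_eq_cast_of_dvd' _ _ h]
  · rw [(DirichletCharacter.apply_eq_zero_iff _ n).2 h]
    have : ¬ IsCoprime n (q₁ : ℤ) ∨ ¬ IsCoprime n (Q₁ : ℤ) := by
      by_contra! h'
      exact h (by push_cast; exact h'.1.mul_right h'.2)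
    rcases this with h' | h'
    · rw [(DirichletCharacter.apply_eq_zero_iff χ n).2 h', zero_mul]
    · rw [(DirichletCharacter.apply_eq_zero_iff ψ n).2 h', mul_zero]

/-! ### Complete exponential sums to a squarefree modulus. -/

/-- The complete sum `∑ u, χ(l + u) conj(χ(u)) φ(k u)` over a finite ring. -/
noncomputable def twistedCorrelation {R : Type*} [CommRing R] [Fintype R] (χ : R → ℂ) (φ : R → ℂ)
    (k l : R) : ℂ := ∑ u, χ (l + u) * conj (χ u) * φ (k * u)

theorem MulChar.conj_mul_self_of_isUnit {R : Type*} [CommRing R] [Finite Rˣ] (χ : MulChar R ℂ)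
    {u : R} (hu : IsUnit u) : χ u * conj (χ u) = 1 := by
  rw [← RCLike.star_def, MulChar.star_apply', ← MulChar.mul_apply, mul_inv_cancel,
    MulChar.one_apply hu]

/-- For `u ≠ 0` the summand is `χ(1 + u⁻¹)`. With the convention `0⁻¹ = 0`, the map `u ↦ 1 + u⁻¹`
permutes the field, so the full sum of `χ` vanishes and only the surplus term at `u = 0`, equal to
`1`, has to be removed. -/
theorem twistedCorrelation_zero_one {F : Type*} [Field F] [Fintype F] {χ : MulChar F ℂ}
    (hχ : χ ≠ 1) (φ : AddChar F ℂ) : twistedCorrelation χ φ 0 1 = -1 := by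
  classical
  have h1 : ∀ u : F, χ (1 + u) * conj (χ u) * φ (0 * u) = χ (1 + u⁻¹) - if u = 0 then 1 else 0 := by
    intro u
    rw [zero_mul, AddChar.map_zero_eq_one, mul_one]
    by_cases hu : u = 0
    · simp [hu, χ.map_zero]
    · rw [if_neg hu, sub_zero, show 1 + u = (1 + u⁻¹) * u by field_simp; ring, map_mul, mul_assoc,
        χ.conj_mul_self_of_isUnit (IsUnit.mk0 u hu), mul_one]
  rw [twistedCorrelation, Finset.sum_congr rfl fun u _ => h1 u, Finset.sum_sub_distrib]
  have h2 : ∑ u : F, χ (1 + u⁻¹) = ∑ u : F, χ u :=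
    Fintype.sum_equiv ((Equiv.inv F).trans (Equiv.addLeft 1)) _ _ fun u => by simp
  rw [h2, MulChar.sum_eq_zero_of_ne_one hχ]
  simp

/-- For `l ≠ 0` substitute `u ↦ lu`. For `l = 0` both sides are explicit: the left one is a sum of
`φ(ku)` over `u ≠ 0`, which equals `-1` unless `k = 0` too. -/
theorem twistedCorrelation_field {F : Type*} [Field F] [Fintype F] [DecidableEq F] {χ : MulChar F ℂ}
    (hχ : χ ≠ 1) {φ : AddChar F ℂ} (hφ : φ ≠ 1) (k l : F) :
    twistedCorrelation χ φ k l =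
      (if k = 0 ∧ l = 0 then 1 - (Fintype.card F : ℂ) else 1) * twistedCorrelation χ φ (k * l) 1 := by
  by_cases hl : l = 0
  · subst hl
    rw [mul_zero, twistedCorrelation_zero_one hχ]
    have h1 : ∀ u : F, χ (0 + u) * conj (χ u) * φ (k * u) = φ (u * k) - if u = 0 then 1 else 0 := by
      intro u
      by_cases hu : u = 0
      · simp [hu, χ.map_zero]
      · rw [if_neg hu, sub_zero, zero_add, χ.conj_mul_self_of_isUnit (IsUnit.mk0 u hu), one_mul,
          mul_comm]
    rw [twistedCorrelation, Finset.sum_congr rfl fun u _ => h1 u, Finset.sum_sub_distrib,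
      AddChar.sum_mulShift k (AddChar.IsPrimitive.of_ne_one hφ)]
    by_cases hk : k = 0 <;> simp [hk]
  · rw [if_neg (fun h => hl h.2), one_mul, twistedCorrelation, twistedCorrelation]
    refine (Fintype.sum_equiv (Equiv.mulLeft₀ l hl) _ _ fun u => ?_).symm
    simp only [Equiv.mulLeft₀_apply]
    rw [show l + l * u = l * (1 + u) by ring, map_mul χ, map_mul χ, map_mul (starRingEnd ℂ),
      mul_mul_mul_comm, χ.conj_mul_self_of_isUnit (IsUnit.mk0 l hl), one_mul, mul_assoc k]

section components

variable {R ι : Type*} [CommRing R] [Fintype ι] [DecidableEq ι] {F : ι → Type*}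
  [∀ i, CommRing (F i)] (e : R ≃+* Π i, F i)

/-- The `i`-th component of a multiplicative character of a product of rings. -/
noncomputable def mulComponent (χ : MulChar R ℂ) (i : ι) : MulChar (F i) ℂ where
  toFun x := χ (e.symm (Pi.mulSingle i x))
  map_one' := by simp
  map_mul' x y := by rw [Pi.mulSingle_mul, map_mul, map_mul]
  map_nonunit' x hx := by
    refine χ.map_nonunit fun h => hx ?_
    have := (h.map e).map (Pi.evalRingHom F i)
    simpa using this

theorem prod_mulComponent (χ : MulChar R ℂ) (x : R) : χ x = ∏ i, mulComponent e χ i (e x i) := by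
  conv_lhs => rw [← e.symm_apply_apply x, ← Finset.univ_prod_mulSingle (e x)]
  rw [map_prod, map_prod]
  rfl

/-- The `i`-th component of an additive character of a product of rings. -/
noncomputable def addComponent (φ : AddChar R ℂ) (i : ι) : AddChar (F i) ℂ where
  toFun x := φ (e.symm (Pi.single i x))
  map_zero_eq_one' := by simp
  map_add_eq_mul' x y := by rw [Pi.single_add, map_add, AddChar.map_add_eq_mul]

theorem prod_addComponent (φ : AddChar R ℂ) (x : R) : φ x = ∏ i, addComponent e φ i (e x i) := by
  conv_lhs => rw [← e.symm_apply_apply x, ← Finset.univ_sum_single (e x)]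
  rw [map_sum]
  have h : ∀ (s : Finset ι) (f : ι → R), φ (∑ i ∈ s, f i) = ∏ i ∈ s, φ (f i) := by
    intro s f
    induction s using Finset.induction_on with
    | empty => simp
    | insert a s ha ih =>
      rw [Finset.sum_insert ha, Finset.prod_insert ha, AddChar.map_add_eq_mul, ih]
  rw [h]
  rfl

theorem twistedCorrelation_eq_prod [Fintype R] [∀ i, Fintype (F i)] (χ : MulChar R ℂ)
    (φ : AddChar R ℂ) (k l : R) :
    twistedCorrelation χ φ k l =
      ∏ i, twistedCorrelation (mulComponent e χ i) (addComponent e φ i) (e k i) (e l i) := by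
  simp only [twistedCorrelation]
  rw [Finset.prod_univ_sum, Fintype.piFinset_univ]
  refine Fintype.sum_equiv e.toEquiv _ _ fun u => ?_
  rw [prod_mulComponent e χ (l + u), prod_mulComponent e χ u, prod_addComponent e φ, map_prod,
    ← Finset.prod_mul_distrib, ← Finset.prod_mul_distrib]
  simp

end components

/-- The factor by which `K_χ(k, l)` and `K_χ(k l, 1)` differ. -/
noncomputable def gcdFactor (Q : ℕ) (k l : ℤ) : ℝ :=
  ∏ p ∈ Q.primeFactors, if (p : ℤ) ∣ k ∧ (p : ℤ) ∣ l then 1 - (p : ℝ) else 1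

/-- The Chinese remainder isomorphism for a squarefree modulus. -/
noncomputable def squarefreeEquiv {Q : ℕ} (hQ : Squarefree Q) :
    ZMod Q ≃+* Π p : Q.primeFactors, ZMod p :=
  (ZMod.ringEquivCongr (by
    rw [Finset.prod_coe_sort Q.primeFactors fun p => p,
      Nat.prod_primeFactors_of_squarefree hQ])).trans
    (ZMod.prodEquivPi (fun p : Q.primeFactors => (p : ℕ)) fun p p' hp =>
      (Nat.coprime_primes (Nat.prime_of_mem_primeFactors p.2)
        (Nat.prime_of_mem_primeFactors p'.2)).2 fun h => hp (Subtype.ext h))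

theorem squarefreeEquiv_intCast {Q : ℕ} (hQ : Squarefree Q) (n : ℤ) (p : Q.primeFactors) :
    squarefreeEquiv hQ (n : ZMod Q) p = (n : ZMod p) := by
  rw [map_intCast]; rfl

theorem charSum_eq_twistedCorrelation {Q : ℕ} [NeZero Q] (ψ : DirichletCharacter ℂ Q)
    (k l : ZMod Q) :
    charSum ψ k l = ((Real.sqrt Q)⁻¹ : ℝ) * twistedCorrelation ψ ZMod.stdAddChar k l := by
  rw [charSum, twistedCorrelation]
  congr 1
  classical
  refine Finset.sum_of_injOn (fun u : (ZMod Q)ˣ => (u : ZMod Q)) (fun a _ b _ h => Units.ext h)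
    (by simp) (fun x _ hx => ?_) (fun _ _ => rfl)
  rw [ψ.map_nonunit (a := x) fun h => hx ⟨h.unit, by simp⟩]
  simp

/-- If the component at `p` were trivial, `ψ` would factor through `Q / p`, against primitivity. -/
theorem mulComponent_ne_one {Q : ℕ} [NeZero Q] (hQ : Squarefree Q) {ψ : DirichletCharacter ℂ Q}
    (hψ : ψ.IsPrimitive) (p : Q.primeFactors) : mulComponent (squarefreeEquiv hQ) ψ p ≠ 1 := by
  intro h
  have hp := Nat.prime_of_mem_primeFactors p.2
  have hpd := Nat.dvd_of_mem_primeFactors p.2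
  obtain ⟨d, hd⟩ := hpd
  have hdQ : d ∣ Q := ⟨p, by rw [mul_comm]; exact hd⟩
  have hf : ψ.FactorsThrough d := by
    rw [DirichletCharacter.factorsThrough_iff_ker_unitsMap hdQ]
    intro u hu
    rw [MonoidHom.mem_ker] at hu ⊢
    rw [Units.ext_iff, MulChar.coe_toUnitHom, Units.val_one,
      prod_mulComponent (squarefreeEquiv hQ) ψ]
    refine Finset.prod_eq_one fun i _ => ?_
    by_cases hi : i = p
    · subst hi
      rw [h, MulChar.one_apply]
      exact (u.isUnit.map (squarefreeEquiv hQ)).map (Pi.evalRingHom _ i)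
    -- Every prime `i ≠ p` of `Q` divides `d = Q / p`, so `u ≡ 1` mod `d` makes the component of `u`
    -- at `i` equal to `1`.
    · have hid : (i : ℕ) ∣ d := by
        have h1 : (i : ℕ) ∣ p * d := (Nat.dvd_of_mem_primeFactors i.2).trans hd.dvd
        refine Nat.Coprime.dvd_of_dvd_mul_left ?_ h1
        exact (Nat.coprime_primes (Nat.prime_of_mem_primeFactors i.2) hp).2
          fun h => hi (Subtype.ext h)
      have h2 : squarefreeEquiv hQ (u : ZMod Q) i = 1 := by
        have h3 : ((u : ZMod Q).val : ZMod d) = 1 := by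
          have := congrArg (fun v : (ZMod d)ˣ => (v : ZMod d)) hu
          simpa [ZMod.unitsMap_val] using this
        have h4 : ((u : ZMod Q).val : ZMod i) = 1 := by
          rw [← map_natCast (ZMod.castHom hid (ZMod i)), h3, map_one]
        rw [← h4]
        conv_lhs => rw [← ZMod.natCast_zmod_val (u : ZMod Q)]
        rw [map_natCast]; rfl
      rw [h2, map_one]
  have h1 : ψ.conductor ≤ d := Nat.sInf_le hf
  rw [hψ] at h1
  have := NeZero.pos Q
  have := hp.two_le
  nlinarith

theorem addComponent_ne_one {Q : ℕ} [NeZero Q] (hQ : Squarefree Q) (p : Q.primeFactors) :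
    addComponent (squarefreeEquiv hQ) ZMod.stdAddChar p ≠ 1 := by
  intro h
  have : Fact (Nat.Prime p) := ⟨Nat.prime_of_mem_primeFactors p.2⟩
  have h1 := DFunLike.congr_fun h (1 : ZMod p)
  have h2 : ZMod.stdAddChar ((squarefreeEquiv hQ).symm (Pi.single p 1)) =
    ZMod.stdAddChar (0 : ZMod Q) := by
    rw [AddChar.map_zero_eq_one]; exact h1
  have h3 := ZMod.injective_stdAddChar h2
  rw [EmbeddingLike.map_eq_zero_iff, Pi.single_eq_zero_iff] at h3
  exact one_ne_zero h3

/-- The product over `p ∣ Q` of the identity over each prime field. It merges shift and frequency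
into the single variable `kl`. -/
theorem charSum_eq_gcdFactor_mul {Q : ℕ} [NeZero Q] (hQ : Squarefree Q)
    {ψ : DirichletCharacter ℂ Q} (hψ : ψ.IsPrimitive) (k l : ℤ) :
    charSum ψ (k : ZMod Q) (l : ZMod Q) =
      (gcdFactor Q k l : ℂ) * charSumOne ψ ((k * l : ℤ) : ZMod Q) := by
  have hF : ∀ p : Q.primeFactors, Fact (Nat.Prime p) :=
    fun p => ⟨Nat.prime_of_mem_primeFactors p.2⟩
  rw [charSumOne, charSum_eq_twistedCorrelation, charSum_eq_twistedCorrelation, mul_left_comm]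
  congr 1
  rw [twistedCorrelation_eq_prod (squarefreeEquiv hQ),
    twistedCorrelation_eq_prod (squarefreeEquiv hQ), gcdFactor,
    ← Finset.prod_coe_sort Q.primeFactors, Complex.ofReal_prod, ← Finset.prod_mul_distrib]
  refine Finset.prod_congr rfl fun p _ => ?_
  rw [twistedCorrelation_field (mulComponent_ne_one hQ hψ p) (addComponent_ne_one hQ p),
    squarefreeEquiv_intCast, squarefreeEquiv_intCast, squarefreeEquiv_intCast, Int.cast_mul,
    map_one, Pi.one_apply, ZMod.card]
  simp only [ZMod.intCast_zmod_eq_zero_iff_dvd]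
  congr 1
  split_ifs <;> simp

theorem norm_charSumOne_zero {Q : ℕ} [NeZero Q] (hQ : Squarefree Q)
    {ψ : DirichletCharacter ℂ Q} (hψ : ψ.IsPrimitive) :
    ‖charSumOne ψ 0‖ = (Real.sqrt Q)⁻¹ := by
  have hF : ∀ p : Q.primeFactors, Fact (Nat.Prime p) :=
    fun p => ⟨Nat.prime_of_mem_primeFactors p.2⟩
  rw [charSumOne, charSum_eq_twistedCorrelation, twistedCorrelation_eq_prod (squarefreeEquiv hQ),
    norm_mul, norm_prod, Finset.prod_eq_one, mul_one, Complex.norm_real, Real.norm_eq_abs,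
    abs_of_nonneg (by positivity)]
  intro p _
  rw [map_zero, map_one, Pi.zero_apply, Pi.one_apply,
    twistedCorrelation_zero_one (mulComponent_ne_one hQ hψ p), norm_neg, norm_one]

/-- The trivial bound is enough: it serves only where Gaussian factors already provide the decay. -/
theorem norm_charSum_le {Q : ℕ} [NeZero Q] (ψ : DirichletCharacter ℂ Q) (k l : ZMod Q) :
    ‖charSum ψ k l‖ ≤ Real.sqrt Q := by
  rw [charSum_eq_twistedCorrelation, norm_mul, Complex.norm_real, Real.norm_eq_abs,
    abs_of_nonneg (by positivity)]
  have h : ‖twistedCorrelation ψ ZMod.stdAddChar k l‖ ≤ Q := by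
    refine (norm_sum_le _ _).trans ?_
    refine (Finset.sum_le_card_nsmul _ _ 1 fun u _ => ?_).trans (by simp)
    rw [norm_mul, norm_mul, RCLike.norm_conj, AddChar.norm_apply, mul_one]
    exact mul_le_one₀ (ψ.norm_le_one _) (norm_nonneg _) (ψ.norm_le_one _)
  have hQ : (0 : ℝ) < Q := by exact_mod_cast NeZero.pos Q
  rw [inv_mul_le_iff₀ (by positivity), Real.mul_self_sqrt hQ.le]
  exact h

theorem abs_gcdFactor_le (Q : ℕ) (k l : ℤ) :
    |gcdFactor Q k l| ≤ ∏ p ∈ Q.primeFactors with ((p : ℕ) : ℤ) ∣ k ∧ (p : ℤ) ∣ l, (p : ℝ) := by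
  rw [gcdFactor, Finset.abs_prod, Finset.prod_filter]
  refine Finset.prod_le_prod (fun _ _ => abs_nonneg _) fun p hp => ?_
  have := (Nat.prime_of_mem_primeFactors hp).one_le
  have : (1 : ℝ) ≤ p := by exact_mod_cast this
  split_ifs
  · rw [abs_of_nonpos (by linarith)]; linarith
  · simp

/-- Take for `d` the product of the primes of `Q` dividing both `k` and `l`; each factor `p - 1` is
at most `p`. That `d` divides both entries is what later gives `d² ∣ m`. -/
theorem exists_dvd_abs_gcdFactor_le {Q : ℕ} (k l : ℤ) :
    ∃ d : ℕ, d ∣ Q ∧ (d : ℤ) ∣ k ∧ (d : ℤ) ∣ l ∧ |gcdFactor Q k l| ≤ d := by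
  refine ⟨∏ p ∈ Q.primeFactors with ((p : ℕ) : ℤ) ∣ k ∧ (p : ℤ) ∣ l, p, ?_, ?_, ?_, ?_⟩
  · exact (Finset.prod_dvd_prod_of_subset _ _ _ (Finset.filter_subset _ _)).trans
      (Nat.prod_primeFactors_dvd Q)
  · rw [Int.natCast_dvd]
    refine Finset.prod_primes_dvd _ (fun p hp => ?_) fun p hp => ?_
    · exact (Nat.prime_of_mem_primeFactors (Finset.mem_filter.1 hp).1).prime
    · exact Int.natCast_dvd.1 (Finset.mem_filter.1 hp).2.1
  · rw [Int.natCast_dvd]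
    refine Finset.prod_primes_dvd _ (fun p hp => ?_) fun p hp => ?_
    · exact (Nat.prime_of_mem_primeFactors (Finset.mem_filter.1 hp).1).prime
    · exact Int.natCast_dvd.1 (Finset.mem_filter.1 hp).2.2
  · rw [Nat.cast_prod]; exact abs_gcdFactor_le Q k l

/-- At frequency `0` every local sum has absolute value `1` up to `gcdFactor`, and the latter is at
most a common divisor of `l` and `Q`, hence at most `|l|`. -/
theorem norm_charSum_zero_le {Q : ℕ} [NeZero Q] (hQ : Squarefree Q)
    {ψ : DirichletCharacter ℂ Q} (hψ : ψ.IsPrimitive) {q l : ℤ} (hl : l ≠ 0)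
    (hq : IsCoprime q Q) :
    ‖charSum ψ 0 ((q * l : ℤ) : ZMod Q)‖ ≤ |l| * (Real.sqrt Q)⁻¹ := by
  have h := charSum_eq_gcdFactor_mul hQ hψ 0 (q * l)
  rw [zero_mul, Int.cast_zero] at h
  rw [h, norm_mul, norm_charSumOne_zero hQ hψ]
  refine mul_le_mul_of_nonneg_right ?_ (by positivity)
  obtain ⟨d, hd, -, hdl, hle⟩ := exists_dvd_abs_gcdFactor_le (Q := Q) 0 (q * l)
  rw [Complex.norm_real, Real.norm_eq_abs]
  refine hle.trans ?_
  have h1 : (d : ℤ) ∣ l := by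
    refine IsCoprime.dvd_of_dvd_mul_left ?_ hdl
    exact (hq.symm.of_isCoprime_of_dvd_left (Int.natCast_dvd_natCast.2 hd))
  have h2 : (d : ℤ) ≤ |l| := Int.le_of_dvd (abs_pos.2 hl) ((dvd_abs _ _).2 h1)
  exact_mod_cast h2

/-! ### Gaussian weights and theta series. -/

/-- This is `y ≤ e^y` at `y = u / s`, raised to the power `s`. The free exponent `s` is chosen anew
at each use. -/
theorem exp_neg_le_rpow {s u : ℝ} (hs : 0 < s) (hu : 0 < u) :
    Real.exp (-u) ≤ s ^ s * u ^ (-s) := by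
  have h1 : u / s ≤ Real.exp (u / s) := by linarith [Real.add_one_le_exp (u / s)]
  have h2 : (u / s) ^ s ≤ Real.exp u := by
    calc (u / s) ^ s ≤ Real.exp (u / s) ^ s := Real.rpow_le_rpow (by positivity) h1 hs.le
      _ = Real.exp u := by rw [← Real.exp_mul, div_mul_cancel₀ _ hs.ne']
  rw [Real.exp_neg, Real.rpow_neg hu.le, ← div_eq_mul_inv, inv_le_comm₀ (Real.exp_pos _)
    (by positivity), inv_div, ← Real.div_rpow hu.le hs.le]
  exact h2

/-- The weight `n^κ exp(-π a n²)`. -/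
noncomputable def gaussTerm (κ : ℕ) (a x : ℝ) : ℝ := x ^ κ * Real.exp (-(Real.pi * a * x ^ 2))

theorem abs_gaussTerm_le (κ : ℕ) {a s x : ℝ} (ha : 0 < a) (hs : 0 < s) (hx : x ≠ 0) :
    |gaussTerm κ a x| ≤ s ^ s * a ^ (-s) * |x| ^ (κ - 2 * s) := by
  have hx' : 0 < |x| := abs_pos.2 hx
  have h1 : Real.exp (-(Real.pi * a * x ^ 2)) ≤ Real.exp (-(a * x ^ 2)) := by
    apply Real.exp_le_exp.2
    have := Real.pi_gt_three
    have : 0 ≤ a * x ^ 2 := by positivity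
    nlinarith
  have h2 := exp_neg_le_rpow hs (u := a * x ^ 2) (by positivity)
  rw [gaussTerm, abs_mul, Real.abs_exp, abs_pow]
  calc |x| ^ κ * _ ≤ |x| ^ κ * (s ^ s * (a * x ^ 2) ^ (-s)) := by gcongr; exact h1.trans h2
    _ = _ := by
      rw [Real.mul_rpow ha.le (by positivity), ← sq_abs x, ← Real.rpow_natCast |x| 2,
        ← Real.rpow_mul hx'.le, ← Real.rpow_natCast |x| κ, sub_eq_add_neg, Real.rpow_add hx']
      push_cast
      ring_nf

theorem summable_gaussTerm (κ : ℕ) {a : ℝ} (ha : 0 < a) :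
    Summable fun n : ℤ => |gaussTerm κ a n| := by
  -- The choice `s = (κ + 2) / 2` makes the exponent `κ - 2s` equal to `-2`.
  have h := (Real.summable_abs_int_rpow (b := 2) (by norm_num)).mul_left
    (((κ + 2) / 2 : ℝ) ^ ((κ + 2) / 2 : ℝ) * a ^ (-((κ + 2) / 2 : ℝ)))
  refine h.of_norm_bounded_eventually ?_
  filter_upwards [(Set.finite_singleton (0 : ℤ)).compl_mem_cofinite] with n hn
  have hn : (n : ℝ) ≠ 0 := by exact_mod_cast hn
  rw [Real.norm_eq_abs, abs_abs]
  convert abs_gaussTerm_le κ ha (s := (κ + 2) / 2) (by positivity) hn using 2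
  ring_nf

/-- The theta series `∑ n, b(n) n^κ exp(-π a n²)`. -/
noncomputable def thetaSum (κ : ℕ) (b : ℤ → ℂ) (a : ℝ) : ℂ := ∑' n : ℤ, b n * (gaussTerm κ a n : ℂ)

theorem summable_thetaSum (κ : ℕ) {b : ℤ → ℂ} (hb : ∀ n, ‖b n‖ ≤ 1) {a : ℝ} (ha : 0 < a) :
    Summable fun n : ℤ => ‖b n * (gaussTerm κ a n : ℂ)‖ := by
  refine (summable_gaussTerm κ ha).of_nonneg_of_le (fun _ => norm_nonneg _) fun n => ?_
  rw [norm_mul, Complex.norm_real, Real.norm_eq_abs]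
  exact mul_le_of_le_one_left (abs_nonneg _) (hb n)

/-- Integers are pairs of a residue class and a quotient. -/
def intResidueEquiv (N : ℕ) [NeZero N] : ZMod N × ℤ ≃ ℤ where
  toFun p := (p.1.val : ℤ) + N * p.2
  invFun n := ((n : ZMod N), n / N)
  left_inv p := by
    have hN : (0 : ℤ) < N := by exact_mod_cast NeZero.pos N
    ext1
    · simp
    · simp only
      rw [Int.add_mul_ediv_left _ _ hN.ne', Int.ediv_eq_zero_of_lt (by positivity), zero_add]
      exact_mod_cast p.1.val_lt
  right_inv n := by
    simp only
    rw [ZMod.val_intCast, Int.emod_add_mul_ediv]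

theorem tsum_int_eq_sum_zmod {f : ℤ → ℂ} (hf : Summable f) (N : ℕ) [NeZero N] :
    ∑' n, f n = ∑ j : ZMod N, ∑' m : ℤ, f (j.val + N * m) := by
  rw [← (intResidueEquiv N).tsum_eq f, Summable.tsum_prod, tsum_fintype]
  · rfl
  · exact hf.comp_injective (intResidueEquiv N).injective

/-! ### Gauss sums and the functional equation of the theta series. -/

/-- Applying the discrete Fourier transform twice to `χ` and evaluating at `1` gives `τ(χ⁻¹) τ(χ) =
N χ(-1)`, while conjugation shows `|τ(χ⁻¹)| = |τ(χ)|`. -/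
theorem norm_gaussSum_of_isPrimitive {N : ℕ} [NeZero N] {χ : DirichletCharacter ℂ N}
    (hχ : χ.IsPrimitive) : ‖gaussSum χ ZMod.stdAddChar‖ = Real.sqrt N := by
  have h1 := congrFun (ZMod.dft_dft (χ : ZMod N → ℂ)) 1
  have h2 : ZMod.dft (ZMod.dft (χ : ZMod N → ℂ)) 1
      = gaussSum χ⁻¹ ZMod.stdAddChar * gaussSum χ ZMod.stdAddChar := by
    have : ZMod.dft (χ : ZMod N → ℂ) = fun k => χ⁻¹ (-k) * gaussSum χ ZMod.stdAddChar := by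
      ext k; exact hχ.fourierTransform_eq_inv_mul_gaussSum k
    rw [this, ZMod.dft_apply]
    simp only [smul_eq_mul, mul_one, ← mul_assoc, ← Finset.sum_mul]
    congr 1
    refine Fintype.sum_equiv (Equiv.neg _) _ _ fun j => ?_
    simp only [Equiv.neg_apply]
    ring
  have h3 : ‖gaussSum χ⁻¹ ZMod.stdAddChar‖ = ‖gaussSum χ ZMod.stdAddChar‖ := by
    have h : (ZMod.stdAddChar (N := N))⁻¹ = ZMod.stdAddChar.mulShift (-1 : (ZMod N)ˣ) := by
      ext x; simp [AddChar.inv_apply, AddChar.mulShift_apply]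
    rw [← norm_star (gaussSum χ ZMod.stdAddChar), star_gaussSum_eq, h, gaussSum_mulShift_eq,
      norm_mul, DirichletCharacter.unit_norm_eq_one, one_mul]
  rw [h2] at h1
  have h4 := congrArg norm h1
  rw [norm_mul, h3] at h4
  have h5 : ‖χ (-1)‖ = 1 := by
    have := χ.unit_norm_eq_one (-1)
    simpa using this
  rw [smul_eq_mul, norm_mul, h5, mul_one, Complex.norm_natCast] at h4
  rw [← h4, Real.sqrt_mul_self (norm_nonneg _)]

theorem norm_thetaSum_inv {N : ℕ} (κ : ℕ) (χ : DirichletCharacter ℂ N) (a : ℝ) :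
    ‖thetaSum κ (fun n => χ⁻¹ n) a‖ = ‖thetaSum κ (fun n => χ n) a‖ := by
  rw [← RCLike.norm_conj, thetaSum, Complex.conj_tsum, thetaSum]
  congr 2
  ext n
  rw [map_mul, Complex.conj_ofReal, ← RCLike.star_def, MulChar.star_apply', inv_inv]

section kernels

variable {N : ℕ} [NeZero N]

/-- The kernel at `j/N` sums over `m + j/N`; the integers `j + Nm` reassemble into all of `ℤ`, which
rescales `x` by `N²`. -/
theorem sum_mul_evenKernel (Φ : ZMod N → ℂ) (hΦ : ∀ j, ‖Φ j‖ ≤ 1) {x : ℝ} (hx : 0 < x) :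
    ∑ j, Φ j * HurwitzZeta.evenKernel (ZMod.toAddCircle j) x =
      thetaSum 0 (fun n => Φ n) (x / N ^ 2) := by
  have hN : (N : ℝ) ≠ 0 := by exact_mod_cast NeZero.ne N
  rw [thetaSum, tsum_int_eq_sum_zmod (summable_thetaSum 0 (fun n => hΦ _) (by positivity)).of_norm N]
  refine Finset.sum_congr rfl fun j _ => ?_
  rw [ZMod.toAddCircle_apply, ← (HurwitzZeta.hasSum_int_evenKernel _ hx).tsum_eq,
    Complex.ofReal_tsum, ← tsum_mul_left]
  refine tsum_congr fun m => ?_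
  rw [gaussTerm]
  congr 2
  · simp
  · rw [pow_zero, one_mul]
    congr 1
    push_cast
    field_simp
    ring

theorem sum_mul_oddKernel (Φ : ZMod N → ℂ) (hΦ : ∀ j, ‖Φ j‖ ≤ 1) {x : ℝ} (hx : 0 < x) :
    ∑ j, Φ j * HurwitzZeta.oddKernel (ZMod.toAddCircle j) x =
      (N : ℂ)⁻¹ * thetaSum 1 (fun n => Φ n) (x / N ^ 2) := by
  have hN : (N : ℝ) ≠ 0 := by exact_mod_cast NeZero.ne N
  have hN' : (N : ℂ) ≠ 0 := by exact_mod_cast NeZero.ne N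
  rw [thetaSum, tsum_int_eq_sum_zmod (summable_thetaSum 1 (fun n => hΦ _) (by positivity)).of_norm N,
    Finset.mul_sum]
  refine Finset.sum_congr rfl fun j _ => ?_
  rw [ZMod.toAddCircle_apply, ← (HurwitzZeta.hasSum_int_oddKernel _ hx).tsum_eq,
    Complex.ofReal_tsum, ← tsum_mul_left, ← tsum_mul_left]
  refine tsum_congr fun m => ?_
  rw [gaussTerm]
  have h1 : (((j.val : ℤ) + (N : ℤ) * m : ℤ) : ZMod N) = j := by simp
  rw [h1]
  have h2 : -Real.pi * (m + (j.val : ℝ) / N) ^ 2 * x =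
      -(Real.pi * (x / N ^ 2) * (((j.val : ℤ) + (N : ℤ) * m : ℤ) : ℝ) ^ 2) := by
    push_cast; field_simp; ring
  rw [h2]
  push_cast
  field_simp
  ring

theorem sum_mul_exp_of_isPrimitive {χ : DirichletCharacter ℂ N} (hχ : χ.IsPrimitive) (n : ℤ) :
    ∑ j : ZMod N, χ j * Complex.exp (2 * Real.pi * Complex.I * ((j.val / N : ℝ) : ℂ) * n) =
      gaussSum χ ZMod.stdAddChar * χ⁻¹ n := by
  rw [mul_comm (gaussSum _ _), ← gaussSum_mulShift_of_isPrimitive _ hχ, gaussSum]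
  refine Finset.sum_congr rfl fun j _ => ?_
  have h := ZMod.stdAddChar_coe (N := N) (n * (j.val : ℤ))
  rw [AddChar.mulShift_apply]
  have h1 : ((n * (j.val : ℤ) : ℤ) : ZMod N) = n * j := by simp
  rw [← h1, h]
  congr 2
  push_cast
  ring

/-- On the dual side the sum over `j` is a twisted Gauss sum `τ(χ) χ⁻¹(n)`, so in absolute value
only `√N` and the theta series of `χ` remain. -/
theorem norm_sum_mul_cosKernel {χ : DirichletCharacter ℂ N} (hχ : χ.IsPrimitive) {x : ℝ}
    (hx : 0 < x) : ‖∑ j : ZMod N, χ j * HurwitzZeta.cosKernel (ZMod.toAddCircle j) x‖ =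
      Real.sqrt N * ‖thetaSum 0 (fun n => χ n) x‖ := by
  have h := hasSum_sum (s := Finset.univ) fun (j : ZMod N) _ =>
    (HurwitzZeta.hasSum_int_cosKernel (j.val / N : ℝ) hx).mul_left (χ j)
  simp only [← ZMod.toAddCircle_apply] at h
  rw [← h.tsum_eq, ← norm_gaussSum_of_isPrimitive hχ, ← norm_thetaSum_inv, ← norm_mul, thetaSum,
    ← tsum_mul_left]
  congr 2
  ext n
  rw [← mul_assoc, ← sum_mul_exp_of_isPrimitive hχ, Finset.sum_mul]
  refine Finset.sum_congr rfl fun j _ => ?_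
  have : Real.exp (-Real.pi * n ^ 2 * x) = Real.exp (-(Real.pi * x * n ^ 2)) := by
    congr 1; ring
  rw [mul_assoc (χ j), gaussTerm, pow_zero, one_mul, this]

theorem norm_sum_mul_sinKernel {χ : DirichletCharacter ℂ N} (hχ : χ.IsPrimitive) {x : ℝ}
    (hx : 0 < x) : ‖∑ j : ZMod N, χ j * HurwitzZeta.sinKernel (ZMod.toAddCircle j) x‖ =
      Real.sqrt N * ‖thetaSum 1 (fun n => χ n) x‖ := by
  have h := hasSum_sum (s := Finset.univ) fun (j : ZMod N) _ =>
    (HurwitzZeta.hasSum_int_sinKernel (j.val / N : ℝ) hx).mul_left (χ j)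
  simp only [← ZMod.toAddCircle_apply] at h
  have hI : ‖thetaSum 1 (fun n => χ n) x‖ = ‖-Complex.I * thetaSum 1 (fun n => χ⁻¹ n) x‖ := by
    rw [norm_mul, norm_neg, Complex.norm_I, one_mul, norm_thetaSum_inv]
  rw [← h.tsum_eq, ← norm_gaussSum_of_isPrimitive hχ, hI, ← norm_mul, thetaSum,
    ← tsum_mul_left, ← tsum_mul_left]
  congr 2
  ext n
  rw [mul_left_comm, ← mul_assoc (gaussSum _ _), ← sum_mul_exp_of_isPrimitive hχ, Finset.sum_mul,
    Finset.mul_sum]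
  refine Finset.sum_congr rfl fun j _ => ?_
  have : Real.exp (-Real.pi * n ^ 2 * x) = Real.exp (-(Real.pi * x * n ^ 2)) := by
    congr 1; ring
  rw [gaussTerm, this]
  push_cast
  ring

/-- The functional equation of the theta series, in absolute value. -/
theorem norm_thetaSum_functional_equation {κ : ℕ} (hκ : κ = 0 ∨ κ = 1)
    {χ : DirichletCharacter ℂ N} (hχ : χ.IsPrimitive) {x : ℝ} (hx : 0 < x) :
    ‖thetaSum κ (fun n => χ n) (1 / (N ^ 2 * x))‖ =
      (N : ℝ) ^ (κ + 1 / 2 : ℝ) * x ^ (κ + 1 / 2 : ℝ) * ‖thetaSum κ (fun n => χ n) x‖ := by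
  have hN : (0 : ℝ) < N := by exact_mod_cast NeZero.pos N
  have hx1 : 0 < 1 / x := by positivity
  have e : 1 / ((N : ℝ) ^ 2 * x) = 1 / x / N ^ 2 := by field_simp
  have hxx : 1 / (1 / x) = x := by simp
  rcases hκ with rfl | rfl
  · have h := sum_mul_evenKernel (fun j => χ j) (fun j => χ.norm_le_one j) hx1
    rw [e, ← h]
    simp only [HurwitzZeta.evenKernel_functional_equation _ (1 / x), hxx]
    have := norm_sum_mul_cosKernel hχ hx
    push_cast
    simp only [mul_left_comm (χ _), ← Finset.mul_sum]
    rw [norm_mul, this, ← mul_assoc, zero_add, Real.sqrt_eq_rpow, mul_comm ((N : ℝ) ^ _)]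
    congr 2
    rw [← Complex.ofReal_one, ← Complex.ofReal_div, Complex.norm_real, Real.norm_eq_abs,
      abs_of_nonneg (by positivity), Real.div_rpow zero_le_one hx.le, Real.one_rpow, one_div_one_div]
  · have h := sum_mul_oddKernel (fun j => χ j) (fun j => χ.norm_le_one j) hx1
    have h' : thetaSum 1 (fun n => χ n) (1 / x / N ^ 2) = N *
        ∑ j : ZMod N, χ j * HurwitzZeta.oddKernel (ZMod.toAddCircle j) (1 / x) := by
      rw [h, mul_inv_cancel_left₀ (by exact_mod_cast hN.ne')]
    rw [e, h']
    simp only [HurwitzZeta.oddKernel_functional_equation _ (1 / x), hxx]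
    have := norm_sum_mul_sinKernel hχ hx
    push_cast
    simp only [mul_left_comm (χ _), ← Finset.mul_sum]
    rw [norm_mul, norm_mul, this, Real.rpow_add hN, Real.rpow_one, Real.sqrt_eq_rpow,
      Complex.norm_natCast]
    have : ‖(1 : ℂ) / (((1 / x) ^ (3 / 2 : ℝ) : ℝ) : ℂ)‖ = x ^ (1 + 1 / 2 : ℝ) := by
      rw [← Complex.ofReal_one, ← Complex.ofReal_div, Complex.norm_real, Real.norm_eq_abs,
        abs_of_nonneg (by positivity), Real.div_rpow zero_le_one hx.le, Real.one_rpow,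
        one_div_one_div]
      norm_num
    rw [this]
    ring

end kernels

/-! ### Mellin transforms and the bound for the central value. -/

-- The measure `dt/t` is invariant under `t ↦ 1/t`, which exchanges `(0, 1)` and `(1, ∞)`.
open MeasureTheory Set in
theorem integral_Ioi_eq_two_mul_of_inv_invariant {H : ℝ → ℝ} (hH : ∀ t > 0, H (1 / t) = H t)
    (hint : IntegrableOn (fun t => H t / t) (Ioi 0)) :
    ∫ t in Ioi 0, H t / t = 2 * ∫ t in Ioi 1, H t / t := by
  have h1 : ∫ t in Ioi (0 : ℝ), H t / t =
      (∫ t in Ioc 0 1, H t / t) + ∫ t in Ioi 1, H t / t := by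
    rw [← Ioc_union_Ioi_eq_Ioi zero_le_one, setIntegral_union (Ioc_disjoint_Ioi le_rfl)
      measurableSet_Ioi (hint.mono_set Ioc_subset_Ioi_self)
      (hint.mono_set (Ioi_subset_Ioi zero_le_one))]
  have h2 : ∫ t in Ioc (0 : ℝ) 1, H t / t = ∫ t in Ioi 1, H t / t := by
    have h3 := integral_comp_rpow_Ioi ((Ioi (1 : ℝ)).indicator fun t => H t / t)
      (p := -1) (by norm_num)
    rw [setIntegral_indicator measurableSet_Ioi, Ioi_inter_Ioi, max_eq_right zero_le_one] at h3
    rw [← h3, integral_Ioc_eq_integral_Ioo, ← Ioi_inter_Iio,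
      ← setIntegral_indicator measurableSet_Iio]
    refine setIntegral_congr_fun measurableSet_Ioi fun t (ht : 0 < t) => ?_
    simp only [Real.rpow_neg_one, abs_neg, abs_one, one_mul, smul_eq_mul]
    by_cases h : t < 1
    · rw [indicator_of_mem (mem_Iio.2 h), indicator_of_mem (mem_Ioi.2 ((one_lt_inv₀ ht).2 h)),
        ← one_div, hH t ht, show (-1 - 1 : ℝ) = -2 by norm_num, Real.rpow_neg ht.le]
      norm_cast
      field_simp
    · rw [indicator_of_notMem (by simpa using h), indicator_of_notMem, mul_zero]
      simpa using inv_le_one_of_one_le₀ (not_lt.1 h)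
  rw [h1, h2]; ring

open MeasureTheory Set in
theorem mellin_finset_sum {ι : Type*} (s : Finset ι) (c : ι → ℂ) (f : ι → ℝ → ℂ) {z : ℂ}
    (hf : ∀ i, MellinConvergent (f i) z) :
    HasMellin (fun t => ∑ i ∈ s, c i * f i t) z (∑ i ∈ s, c i * mellin (f i) z) := by
  have h : (fun t : ℝ => (t : ℂ) ^ (z - 1) • ∑ i ∈ s, c i * f i t) =
      fun t : ℝ => ∑ i ∈ s, c i * ((t : ℂ) ^ (z - 1) • f i t) := by
    ext t
    rw [Finset.smul_sum]
    exact Finset.sum_congr rfl fun i _ => by simp only [smul_eq_mul]; ring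
  constructor
  · rw [MellinConvergent, h]
    exact integrable_finsetSum _ fun i _ => (hf i).const_mul _
  · rw [mellin, h, integral_finsetSum _ fun i _ => (hf i).const_mul _]
    exact Finset.sum_congr rfl fun i _ => integral_const_mul _ _

section

variable {N : ℕ} [NeZero N]

-- A single even kernel has nonzero limit terms at `∞` or `0`, which the functional equation pair
-- subtracts. After weighting by `χ` they cancel: the one at `∞` occurs only for `j = 0`, where `χ`
-- vanishes, and the one at `0` is the same for all `j`, while `∑ χ = 0`.
open MeasureTheory Set in
theorem hasMellin_evenKernel {χ : DirichletCharacter ℂ N} (hN : N ≠ 1) (hχ : χ ≠ 1) (s : ℂ) :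
    HasMellin (fun t => ∑ j : ZMod N, χ j * HurwitzZeta.evenKernel (ZMod.toAddCircle j) t) s
      (∑ j : ZMod N, χ j * (HurwitzZeta.hurwitzEvenFEPair (ZMod.toAddCircle j)).Λ s) := by
  set P := fun j : ZMod N => HurwitzZeta.hurwitzEvenFEPair (ZMod.toAddCircle j) with hP
  have hsum : ∑ j : ZMod N, χ j = 0 := χ.sum_eq_zero_of_ne_one hχ
  have hf₀ : ∀ j, χ j * (P j).f₀ = 0 := by
    intro j
    by_cases hj : j = 0
    · rw [hj, χ.map_zero' hN, zero_mul]
    · have : (P j).f₀ = 0 := if_neg (by rwa [ZMod.toAddCircle_eq_zero])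
      rw [this, mul_zero]
  have h := mellin_finset_sum Finset.univ χ (fun j => (P j).f_modif) (z := s)
    fun j => ((P j).isStrongFEPair_toStrongFEPair.hasMellin s).1
  -- The point `t = 1` lies in neither of the two pieces defining `f_modif`; it is a null set.
  have hae : ∀ t ∈ Ioi (0 : ℝ), t ≠ 1 → ∑ j : ZMod N, χ j * (P j).f_modif t =
      ∑ j : ZMod N, χ j * HurwitzZeta.evenKernel (ZMod.toAddCircle j) t := by
    intro t ht ht1
    rcases lt_or_gt_of_ne ht1 with h1 | h1
    · have : ∀ j, χ j * (P j).f_modif t = χ j * HurwitzZeta.evenKernel (ZMod.toAddCircle j) t -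
          χ j * ((t ^ (-(1 / 2) : ℝ) : ℝ) : ℂ) := by
        intro j
        rw [WeakFEPair.f_modif, Pi.add_apply, indicator_of_notMem (by simpa using h1.le),
          indicator_of_mem (show t ∈ Ioo 0 1 from ⟨ht, h1⟩), zero_add, mul_sub]
        congr 2
        simp [hP, HurwitzZeta.hurwitzEvenFEPair]
      rw [Finset.sum_congr rfl fun j _ => this j, Finset.sum_sub_distrib, ← Finset.sum_mul, hsum,
        zero_mul, sub_zero]
    · refine Finset.sum_congr rfl fun j _ => ?_
      rw [WeakFEPair.f_modif, Pi.add_apply, indicator_of_mem (mem_Ioi.2 h1),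
        indicator_of_notMem (fun h => h.2.not_gt h1), add_zero, mul_sub, hf₀, sub_zero]
      rfl
  have hae' : (fun t : ℝ => (t : ℂ) ^ (s - 1) • ∑ j : ZMod N, χ j * (P j).f_modif t)
      =ᵐ[volume.restrict (Ioi 0)] fun t : ℝ => (t : ℂ) ^ (s - 1) •
        ∑ j : ZMod N, χ j * (HurwitzZeta.evenKernel (ZMod.toAddCircle j) t : ℂ) := by
    have h1 : ∀ᵐ t ∂(volume.restrict (Ioi (0 : ℝ))), t ≠ 1 := by
      refine ae_restrict_of_ae ?_
      simp [ae_iff]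
    filter_upwards [h1, ae_restrict_mem measurableSet_Ioi] with t ht1 ht
    rw [hae t ht ht1]
  refine ⟨h.1.congr hae', ?_⟩
  rw [mellin, ← integral_congr_ae hae']
  refine h.2.trans ?_
  have hΛ : ∀ j, χ j * (P j).Λ s = χ j * mellin (P j).f_modif s - χ j * (1 / (1 / 2 - s)) := by
    intro j
    rw [WeakFEPair.Λ, WeakFEPair.Λ₀, mul_sub, mul_sub, smul_eq_mul, smul_eq_mul, mul_left_comm,
      hf₀ j, mul_zero, sub_zero]
    congr 2
    simp [hP, HurwitzZeta.hurwitzEvenFEPair]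
  rw [Finset.sum_congr rfl fun j _ => hΛ j, Finset.sum_sub_distrib, ← Finset.sum_mul, hsum,
    zero_mul, sub_zero]

theorem hasMellin_oddKernel {χ : DirichletCharacter ℂ N} (s : ℂ) :
    HasMellin (fun t => ∑ j : ZMod N, χ j * HurwitzZeta.oddKernel (ZMod.toAddCircle j) t) s
      (∑ j : ZMod N, χ j * (HurwitzZeta.hurwitzOddFEPair (ZMod.toAddCircle j)).Λ s) := by
  have h0 := fun j : ZMod N =>
    (HurwitzZeta.isStrong_hurwitzOddFEPair (ZMod.toAddCircle j)).hasMellin s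
  have h := mellin_finset_sum Finset.univ χ
    (fun j => (HurwitzZeta.hurwitzOddFEPair (ZMod.toAddCircle j)).f) (z := s) fun j => (h0 j).1
  simp only [(h0 _).2] at h
  exact h

/-- The parity `κ ∈ {0, 1}` of a Dirichlet character. -/
def HasParity (χ : DirichletCharacter ℂ N) (κ : ℕ) : Prop := χ (-1) = (-1) ^ κ

open MeasureTheory Set in
theorem norm_completedLFunction_half {κ : ℕ} (hκ : κ = 0 ∨ κ = 1) {χ : DirichletCharacter ℂ N}
    (hN : N ≠ 1) (hχ : χ ≠ 1) (hp : HasParity χ κ) :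
    MellinConvergent (fun t => thetaSum κ (fun n => χ n) (t / N ^ 2)) ((1 / 4 + κ / 2 : ℝ) : ℂ) ∧
      ‖DirichletCharacter.completedLFunction χ (1 / 2)‖ = (N : ℝ) ^ (-(κ + 1 / 2) : ℝ) *
        (‖mellin (fun t => thetaSum κ (fun n => χ n) (t / N ^ 2)) ((1 / 4 + κ / 2 : ℝ) : ℂ)‖ / 2) := by
  have hN0 : (0 : ℝ) < N := by exact_mod_cast NeZero.pos N
  have hNn : ‖(N : ℂ) ^ (-(1 / 2) : ℂ)‖ = (N : ℝ) ^ (-(1 / 2) : ℝ) := by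
    rw [← Complex.ofReal_natCast, Complex.norm_cpow_eq_rpow_re_of_pos hN0]
    norm_num
  rcases hκ with rfl | rfl
  · have he : χ.Even := by simpa [HasParity, DirichletCharacter.Even] using hp
    have e : ((1 / 4 + (0 : ℕ) / 2 : ℝ) : ℂ) = 1 / 2 / 2 := by push_cast; norm_num
    rw [e]
    have h := hasMellin_evenKernel (χ := χ) hN hχ (1 / 2 / 2)
    have hc : EqOn (fun t : ℝ => (t : ℂ) ^ ((1 / 2 / 2 : ℂ) - 1) •
        ∑ j : ZMod N, χ j * (HurwitzZeta.evenKernel (ZMod.toAddCircle j) t : ℂ))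
        (fun t : ℝ => (t : ℂ) ^ ((1 / 2 / 2 : ℂ) - 1) • thetaSum 0 (fun n => χ n) (t / N ^ 2))
        (Ioi 0) := by
      intro t ht
      simp only
      rw [sum_mul_evenKernel (fun j => χ j) (fun j => χ.norm_le_one j) ht]
    refine ⟨h.1.congr_fun hc measurableSet_Ioi, ?_⟩
    rw [DirichletCharacter.completedLFunction, ZMod.completedLFunction_def_even he.to_fun]
    simp only [HurwitzZeta.completedHurwitzZetaEven, mul_div_assoc', ← Finset.sum_div]
    rw [← h.2, mellin, setIntegral_congr_fun measurableSet_Ioi hc, ← mellin, norm_div,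
      norm_mul, hNn]
    norm_num
  · have he : χ.Odd := by simpa [HasParity, DirichletCharacter.Odd] using hp
    have e : ((1 / 4 + (1 : ℕ) / 2 : ℝ) : ℂ) = (1 / 2 + 1) / 2 := by push_cast; norm_num
    rw [e]
    have h := hasMellin_oddKernel (χ := χ) ((1 / 2 + 1) / 2)
    have hc : EqOn (fun t : ℝ => (t : ℂ) ^ (((1 / 2 + 1) / 2 : ℂ) - 1) •
        ∑ j : ZMod N, χ j * (HurwitzZeta.oddKernel (ZMod.toAddCircle j) t : ℂ))
        (fun t : ℝ => (N : ℂ)⁻¹ • ((t : ℂ) ^ (((1 / 2 + 1) / 2 : ℂ) - 1) •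
          thetaSum 1 (fun n => χ n) (t / N ^ 2))) (Ioi 0) := by
      intro t ht
      simp only
      rw [sum_mul_oddKernel (fun j => χ j) (fun j => χ.norm_le_one j) ht, smul_eq_mul, smul_eq_mul,
        smul_eq_mul]
      ring
    have hNc : (N : ℂ) ≠ 0 := by exact_mod_cast NeZero.ne N
    refine ⟨?_, ?_⟩
    · have := (h.1.congr_fun hc measurableSet_Ioi).smul (N : ℂ)
      refine IntegrableOn.congr_fun this (fun t _ => ?_) measurableSet_Ioi
      simp only [Pi.smul_apply]
      rw [smul_inv_smul₀ hNc]
    rw [DirichletCharacter.completedLFunction, ZMod.completedLFunction_def_odd he.to_fun]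
    simp only [HurwitzZeta.completedHurwitzZetaOdd, mul_div_assoc', ← Finset.sum_div]
    rw [← h.2, mellin, setIntegral_congr_fun measurableSet_Ioi hc, integral_smul, ← mellin,
      norm_div, norm_mul, hNn, norm_smul, norm_inv, Complex.norm_natCast, Nat.cast_one,
      neg_add, Real.rpow_add hN0, Real.rpow_neg_one]
    norm_num
    ring

/-- The normalised theta function whose Mellin transform is the completed `L`-function. -/
noncomputable def normTheta (κ q : ℕ) (b : ℤ → ℂ) (t : ℝ) : ℝ :=
  (t / q) ^ (1 / 4 + κ / 2 : ℝ) * ‖thetaSum κ b (t / q)‖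

-- After the change of variable `t ↦ Nt` the Mellin integrand has absolute value `normTheta(t) / t`
-- up to powers of `N`, and these cancel against the prefactor of the completed function. The factor
-- `2` from folding at `t = 1` cancels the `1/2` there.
open MeasureTheory Set in
theorem norm_LFunction_half_le {κ : ℕ} (hκ : κ = 0 ∨ κ = 1) {χ : DirichletCharacter ℂ N}
    (hN : N ≠ 1) (hprim : χ.IsPrimitive) (hp : HasParity χ κ) :
    ‖DirichletCharacter.LFunction χ (1 / 2)‖ ≤ ‖Complex.Gammaℝ (1 / 2 + κ)‖⁻¹ *
      ∫ t in Ioi 1, normTheta κ N (fun n => χ n) t / t := by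
  have hN0 : (0 : ℝ) < N := by exact_mod_cast NeZero.pos N
  have hχ : χ ≠ 1 := by
    rintro rfl
    rw [DirichletCharacter.IsPrimitive, DirichletCharacter.conductor_one] at hprim
    exact hN hprim.symm
  obtain ⟨hconv, hnorm⟩ := norm_completedLFunction_half hκ hN hχ hp
  have hg : DirichletCharacter.gammaFactor χ (1 / 2) = Complex.Gammaℝ (1 / 2 + κ) := by
    rcases hκ with rfl | rfl
    · have he : χ.Even := by simpa [HasParity, DirichletCharacter.Even] using hp
      rw [he.gammaFactor_def]; simp
    · have he : χ.Odd := by simpa [HasParity, DirichletCharacter.Odd] using hp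
      rw [he.gammaFactor_def]; simp
  rw [DirichletCharacter.LFunction_eq_completed_div_gammaFactor χ _ (Or.inr hN), norm_div, hg,
    div_eq_inv_mul]
  refine mul_le_mul_of_nonneg_left ?_ (by positivity)
  set s : ℝ := 1 / 4 + κ / 2 with hs
  set H := normTheta κ N (fun n => χ n) with hH
  have hcongr : ∀ t ∈ Ioi (0 : ℝ),
      ‖(t : ℂ) ^ ((s : ℂ) - 1) • thetaSum κ (fun n => χ n) (t / N ^ 2)‖ =
        (N : ℝ) ^ (2 * s) * (N : ℝ)⁻¹ * (H ((N : ℝ)⁻¹ * t) / ((N : ℝ)⁻¹ * t)) := by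
    intro t (ht : 0 < t)
    rw [norm_smul, Complex.norm_cpow_eq_rpow_re_of_pos ht, hH, normTheta, ← hs]
    have e1 : (N : ℝ)⁻¹ * t / N = t / (N : ℝ) ^ 2 := by field_simp
    have e2 : ((s : ℂ) - 1).re = s - 1 := by simp
    rw [e1, e2, Real.div_rpow ht.le (by positivity), ← Real.rpow_natCast (N : ℝ) 2,
      ← Real.rpow_mul hN0.le, Real.rpow_sub_one ht.ne']
    push_cast
    have hNp : (N : ℝ) ^ (2 * s) ≠ 0 := by positivity
    generalize (N : ℝ) ^ (2 * s) = y at *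
    field_simp
  have hint0 : IntegrableOn (fun t => H ((N : ℝ)⁻¹ * t) / ((N : ℝ)⁻¹ * t)) (Ioi 0) := by
    have h1 := (IntegrableOn.congr_fun (Integrable.norm hconv) hcongr measurableSet_Ioi).const_mul
      ((N : ℝ) ^ (2 * s) * (N : ℝ)⁻¹)⁻¹
    refine IntegrableOn.congr_fun h1 (fun t _ => ?_) measurableSet_Ioi
    rw [inv_mul_cancel_left₀ (by positivity)]
  have hint : IntegrableOn (fun t => H t / t) (Ioi 0) := by
    rw [← mul_zero (N : ℝ)⁻¹]
    exact (integrableOn_Ioi_comp_mul_left_iff (fun t => H t / t) 0 (by positivity)).1 hint0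
  have hinv : ∀ t > 0, H (1 / t) = H t := by
    intro t ht
    have h1 := norm_thetaSum_functional_equation hκ hprim (x := t / N) (by positivity)
    have e1 : 1 / ((N : ℝ) ^ 2 * (t / N)) = 1 / t / N := by field_simp
    rw [e1] at h1
    rw [hH, normTheta, normTheta, h1]
    have h2 : (1 / t / N : ℝ) ^ s * ((N : ℝ) ^ (κ + 1 / 2 : ℝ) * (t / N) ^ (κ + 1 / 2 : ℝ)) =
        (t / N) ^ s := by
      -- The exponent in the functional equation is exactly twice the Mellin exponent because the
      -- point is central.
      have e2 : (κ + 1 / 2 : ℝ) = s + s := by rw [hs]; ring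
      rw [e2, ← Real.mul_rpow hN0.le (by positivity), mul_div_cancel₀ _ hN0.ne',
        Real.rpow_add ht, ← mul_assoc, ← Real.mul_rpow (by positivity) ht.le,
        ← Real.mul_rpow (by positivity) ht.le]
      congr 1
      field_simp
    rw [← mul_assoc, h2]
  have hle : ‖mellin (fun t => thetaSum κ (fun n => χ n) (t / N ^ 2)) s‖ ≤
      (N : ℝ) ^ (2 * s) * (2 * ∫ t in Ioi 1, H t / t) := by
    rw [mellin]
    refine (norm_integral_le_integral_norm _).trans_eq ?_
    rw [setIntegral_congr_fun measurableSet_Ioi hcongr, integral_const_mul,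
      integral_comp_mul_left_Ioi (fun t => H t / t) 0 (by positivity), mul_zero,
      integral_Ioi_eq_two_mul_of_inv_invariant hinv hint, smul_eq_mul]
    field_simp
  rw [hnorm]
  calc _ ≤ (N : ℝ) ^ (-(κ + 1 / 2) : ℝ) *
        ((N : ℝ) ^ (2 * s) * (2 * ∫ t in Ioi 1, H t / t) / 2) := by gcongr
    _ = ∫ t in Ioi 1, H t / t := by
      have : (N : ℝ) ^ (-(κ + 1 / 2) : ℝ) * (N : ℝ) ^ (2 * s) = 1 := by
        rw [← Real.rpow_add hN0, hs]
        ring_nf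
        exact Real.rpow_zero _
      linear_combination (∫ t in Ioi 1, H t / t) * this

end

/-! ### Poisson summation for Gaussians with a quadratic factor. -/

open FourierTransform in
theorem fourier_gaussian_real {b : ℝ} (hb : 0 < b) :
    𝓕 (fun y : ℝ => (Real.exp (-(Real.pi * b * y ^ 2)) : ℂ)) =
      fun ξ : ℝ => ((b ^ (-(1 / 2) : ℝ) * Real.exp (-(Real.pi / b * ξ ^ 2)) : ℝ) : ℂ) := by
  have h := fourier_gaussian_pi (b := (b : ℂ)) (by simpa using hb)
  convert h using 2 with y ξ
  · push_cast; ring_nf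
  · rw [Complex.ofReal_mul, Complex.ofReal_cpow hb.le, one_div ((b : ℂ) ^ _), ← Complex.cpow_neg]
    push_cast
    ring_nf

theorem integrable_pow_mul_gaussian (k : ℕ) {b : ℝ} (hb : 0 < b) :
    MeasureTheory.Integrable fun y : ℝ => ((y ^ k * Real.exp (-(Real.pi * b * y ^ 2)) : ℝ) : ℂ) := by
  refine MeasureTheory.Integrable.ofReal ?_
  have h := integrable_rpow_mul_exp_neg_mul_sq (b := Real.pi * b) (by positivity)
    (s := k) (by have : (0 : ℝ) ≤ k := by positivity
                 linarith)
  simp only [Real.rpow_natCast, neg_mul] at h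
  exact h

open FourierTransform MeasureTheory in
theorem fourier_linear_combination {f g : ℝ → ℂ} (hf : Integrable f) (hg : Integrable g)
    (A B : ℂ) (ξ : ℝ) : 𝓕 (fun y => A * f y + B * g y) ξ = A * 𝓕 f ξ + B * 𝓕 g ξ := by
  have hf' := (Real.fourierIntegral_convergent_iff ξ).2 hf
  have hg' := (Real.fourierIntegral_convergent_iff ξ).2 hg
  rw [Real.fourier_eq, Real.fourier_eq, Real.fourier_eq, ← integral_const_mul,
    ← integral_const_mul, ← integral_add (hf'.const_mul A) (hg'.const_mul B)]
  refine integral_congr_ae (Filter.Eventually.of_forall fun y => ?_)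
  simp only [Circle.smul_def, smul_eq_mul]
  ring

-- Multiplication by `-2πiy` becomes differentiation of the transform; apply this twice to the
-- Gaussian.
open FourierTransform in
theorem fourier_sq_mul_gaussian {b : ℝ} (hb : 0 < b) (ξ : ℝ) :
    𝓕 (fun y : ℝ => ((y ^ 2 * Real.exp (-(Real.pi * b * y ^ 2)) : ℝ) : ℂ)) ξ =
      ((b ^ (-(1 / 2) : ℝ) * (1 / (2 * Real.pi * b) - ξ ^ 2 / b ^ 2) *
        Real.exp (-(Real.pi / b * ξ ^ 2)) : ℝ) : ℂ) := by
  have hpi : (Real.pi : ℂ) ≠ 0 := by exact_mod_cast Real.pi_ne_zero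
  set f₀ : ℝ → ℂ := fun y => (Real.exp (-(Real.pi * b * y ^ 2)) : ℂ) with hf₀
  set f₁ : ℝ → ℂ := fun x => (-2 * Real.pi * Complex.I * x : ℂ) • f₀ x with hf₁
  have i0 : MeasureTheory.Integrable f₀ := by
    simpa [hf₀] using integrable_pow_mul_gaussian 0 hb
  have i0' : MeasureTheory.Integrable (fun x : ℝ => x • f₀ x) := by
    simpa [hf₀] using integrable_pow_mul_gaussian 1 hb
  have i1 : MeasureTheory.Integrable f₁ := by
    have := i0'.const_mul (-2 * Real.pi * Complex.I : ℂ)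
    refine this.congr (Filter.Eventually.of_forall fun x => ?_)
    simp only [hf₁, smul_eq_mul, Complex.real_smul]
    ring
  have i1' : MeasureTheory.Integrable (fun x : ℝ => x • f₁ x) := by
    have := (integrable_pow_mul_gaussian 2 hb).const_mul (-2 * Real.pi * Complex.I : ℂ)
    refine this.congr (Filter.Eventually.of_forall fun x => ?_)
    simp only [hf₁, hf₀, smul_eq_mul, Complex.real_smul]
    push_cast
    ring
  have h0 := Real.deriv_fourier i0 i0'
  have h1 := Real.deriv_fourier i1 i1'
  have h2 : 𝓕 f₀ = fun ξ : ℝ => ((b ^ (-(1 / 2) : ℝ) * Real.exp (-(Real.pi / b * ξ ^ 2)) : ℝ) : ℂ) :=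
    fourier_gaussian_real hb
  have d1 : ∀ x : ℝ, HasDerivAt (fun ξ : ℝ => Real.exp (-(Real.pi / b * ξ ^ 2)))
      (Real.exp (-(Real.pi / b * x ^ 2)) * (-(Real.pi / b * (2 * x)))) x := by
    intro x
    have := (((hasDerivAt_pow 2 x).const_mul (Real.pi / b)).neg).exp
    simpa using this
  have h3 : 𝓕 f₁ = fun ξ : ℝ => ((b ^ (-(1 / 2) : ℝ) * (Real.exp (-(Real.pi / b * ξ ^ 2)) *
      (-(Real.pi / b * (2 * ξ)))) : ℝ) : ℂ) := by
    rw [hf₁, ← h0, h2]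
    ext x
    exact ((d1 x).const_mul _).ofReal_comp.deriv
  have h4 : 𝓕 (fun x : ℝ => (-2 * Real.pi * Complex.I * x : ℂ) • f₁ x) ξ =
      ((b ^ (-(1 / 2) : ℝ) * (Real.exp (-(Real.pi / b * ξ ^ 2)) * (-(Real.pi / b * (2 * ξ))) *
        (-(Real.pi / b * (2 * ξ))) + Real.exp (-(Real.pi / b * ξ ^ 2)) *
        (-(Real.pi / b * (2 * 1)))) : ℝ) : ℂ) := by
    rw [← h1, h3]
    refine (HasDerivAt.ofReal_comp (((d1 ξ).mul ?_).const_mul _)).deriv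
    exact (((hasDerivAt_id ξ).const_mul 2).const_mul (Real.pi / b)).neg
  have h5 : (fun x : ℝ => (-2 * Real.pi * Complex.I * x : ℂ) • f₁ x) = (-4 * Real.pi ^ 2 : ℂ) •
      fun y : ℝ => ((y ^ 2 * Real.exp (-(Real.pi * b * y ^ 2)) : ℝ) : ℂ) := by
    ext x
    simp only [hf₁, hf₀, Pi.smul_apply, smul_eq_mul]
    push_cast
    linear_combination (4 * Real.pi ^ 2 * x ^ 2 *
      Complex.exp (-(Real.pi * b * x ^ 2)) : ℂ) * Complex.I_sq
  have h6 := fourier_linear_combination (integrable_pow_mul_gaussian 2 hb) i0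
    (-4 * Real.pi ^ 2) 0 ξ
  have h7 : (fun x : ℝ => (-2 * Real.pi * Complex.I * x : ℂ) • f₁ x) = fun y : ℝ =>
      (-4 * Real.pi ^ 2 : ℂ) * ((y ^ 2 * Real.exp (-(Real.pi * b * y ^ 2)) : ℝ) : ℂ) +
        0 * f₀ y := by
    rw [h5]; ext y; simp
  rw [h7, h6, zero_mul, add_zero] at h4
  have h8 : (-4 * Real.pi ^ 2 : ℂ) ≠ 0 := by simp [hpi]
  refine mul_left_cancel₀ h8 (h4.trans ?_)
  have hb' := hb.ne'
  have hpi' := Real.pi_ne_zero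
  rw [show (-4 * Real.pi ^ 2 : ℂ) = ((-4 * Real.pi ^ 2 : ℝ) : ℂ) by push_cast; ring,
    ← Complex.ofReal_mul]
  congr 1
  field_simp
  ring

/-- The Gaussian with a quadratic polynomial factor. -/
noncomputable def quadGaussian (A B b y : ℝ) : ℝ :=
  (A + B * y ^ 2) * Real.exp (-(Real.pi * b * y ^ 2))

-- Quadratic polynomials times Gaussians, with only even powers, are stable under the Fourier
-- transform. For `κ = 1` the product of two shifted weights is of this shape.
open FourierTransform in
theorem fourier_quadGaussian (A B : ℝ) {b : ℝ} (hb : 0 < b) (ξ : ℝ) :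
    𝓕 (fun y : ℝ => (quadGaussian A B b y : ℂ)) ξ =
      ((b ^ (-(1 / 2) : ℝ) * quadGaussian (A + B / (2 * Real.pi * b)) (-B / b ^ 2) (1 / b) ξ : ℝ) :
        ℂ) := by
  have h := fourier_linear_combination (integrable_pow_mul_gaussian 0 hb)
    (integrable_pow_mul_gaussian 2 hb) A B ξ
  have h1 : (fun y : ℝ => (quadGaussian A B b y : ℂ)) = fun y : ℝ =>
      (A : ℂ) * ((y ^ 0 * Real.exp (-(Real.pi * b * y ^ 2)) : ℝ) : ℂ) +
        B * ((y ^ 2 * Real.exp (-(Real.pi * b * y ^ 2)) : ℝ) : ℂ) := by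
    ext y
    rw [quadGaussian]
    push_cast
    ring
  rw [h1, h, fourier_sq_mul_gaussian hb]
  simp only [pow_zero, one_mul]
  rw [fourier_gaussian_real hb, quadGaussian]
  rw [← Complex.ofReal_mul, ← Complex.ofReal_mul, ← Complex.ofReal_add]
  congr 1
  have e : Real.pi / b * ξ ^ 2 = Real.pi * (1 / b) * ξ ^ 2 := by ring
  rw [e]
  field_simp
  ring

open Filter Asymptotics in
theorem quadGaussian_isBigO (A B : ℝ) {b : ℝ} (hb : 0 < b) :
    (fun y : ℝ => (quadGaussian A B b y : ℂ)) =O[cocompact ℝ] fun y : ℝ => |y| ^ (-2 : ℝ) := by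
  have hπb : 0 < Real.pi * b := by positivity
  have key : ∀ s : ℝ, (fun y : ℝ => Real.exp (-(Real.pi * b * y ^ 2)))
      =O[cocompact ℝ] fun y : ℝ => |y| ^ s := by
    intro s
    have := (isLittleO_exp_neg_mul_sq_cocompact (a := ((Real.pi * b : ℝ) : ℂ))
      (by rwa [Complex.ofReal_re]) s).isBigO.norm_left
    refine this.congr_left fun y => ?_
    rw [Complex.norm_exp]
    congr 1
    have : -((Real.pi * b : ℝ) : ℂ) * (y : ℂ) ^ 2 = ((-(Real.pi * b * y ^ 2) : ℝ) : ℂ) := by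
      push_cast; ring
    rw [this, Complex.ofReal_re]
  have h1 := (key (-2)).const_mul_left A
  have h2 : (fun y : ℝ => B * (|y| ^ (2 : ℕ) * Real.exp (-(Real.pi * b * y ^ 2))))
      =O[cocompact ℝ] fun y : ℝ => |y| ^ (-2 : ℝ) := by
    refine (((isBigO_refl (fun y : ℝ => |y| ^ (2 : ℕ)) (cocompact ℝ)).mul
      (key (-4))).congr' (EventuallyEq.refl _ _) ?_).const_mul_left B
    have : ({0} : Set ℝ)ᶜ ∈ cocompact ℝ := isCompact_singleton.compl_mem_cocompact
    filter_upwards [this] with y hy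
    have hy' : 0 < |y| := abs_pos.2 hy
    rw [← Real.rpow_natCast, ← Real.rpow_add hy']
    norm_num
  refine Complex.isBigO_ofReal_left.2 ((h1.add h2).congr_left fun y => ?_)
  rw [quadGaussian, sq_abs]
  ring

/-- Poisson summation for a periodic weight against a polynomial Gaussian. -/
theorem tsum_periodic_mul_quadGaussian {Q : ℕ} [NeZero Q] (P : ZMod Q → ℂ) (A B c : ℝ) {b : ℝ}
    (hb : 0 < b) :
    ∑ j : ZMod Q, P j * ∑' m : ℤ, (quadGaussian A B b (j.val + Q * m + c) : ℂ) =
      ∑' h : ℤ, ((b ^ (-(1 / 2) : ℝ) * (Q : ℝ)⁻¹ *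
        quadGaussian (A + B / (2 * Real.pi * b)) (-B / b ^ 2) (1 / b) (h / Q) : ℝ) : ℂ) *
        Complex.exp (2 * Real.pi * Complex.I * (h * c / Q)) *
          ∑ j : ZMod Q, P j * ZMod.stdAddChar ((h : ZMod Q) * j) := by
  have hQ : (0 : ℝ) < Q := by exact_mod_cast NeZero.pos Q
  -- Writing `j + Qm + c = Q(m + (j + c)/Q)` turns the sum over `m` into one over a shifted copy of
  -- `ℤ`, with `b` and `B` scaled by `Q²`; the shift becomes a phase in `h`.
  have hb' : 0 < b * Q ^ 2 := by positivity
  have hF := fourier_quadGaussian A (B * Q ^ 2) hb'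
  have hdec : (FourierTransform.fourier fun y : ℝ => (quadGaussian A (B * Q ^ 2) (b * Q ^ 2) y : ℂ))
      =O[Filter.cocompact ℝ] fun y : ℝ => |y| ^ (-2 : ℝ) := by
    have := (quadGaussian_isBigO (A + B * Q ^ 2 / (2 * Real.pi * (b * Q ^ 2)))
      (-(B * Q ^ 2) / (b * Q ^ 2) ^ 2) (b := 1 / (b * Q ^ 2)) (by positivity)).const_mul_left
      (((b * Q ^ 2) ^ (-(1 / 2) : ℝ) : ℝ) : ℂ)
    refine this.congr_left fun ξ => ?_
    rw [hF ξ]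
    push_cast
    ring
  have hcont : Continuous fun y : ℝ => (quadGaussian A (B * Q ^ 2) (b * Q ^ 2) y : ℂ) := by
    unfold quadGaussian
    fun_prop
  have hsum : ∀ x : ℝ, Summable fun h : ℤ =>
      (FourierTransform.fourier fun y : ℝ => (quadGaussian A (B * Q ^ 2) (b * Q ^ 2) y : ℂ)) h *
        fourier h (x : UnitAddCircle) := by
    intro x
    have h1 := summable_of_isBigO (Real.summable_abs_int_rpow (b := 2) (by norm_num))
      (hdec.comp_tendsto Int.tendsto_coe_cofinite)
    refine h1.norm.of_norm_bounded fun h => ?_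
    rw [norm_mul, fourier_apply, Circle.norm_coe, mul_one]
    rfl
  have hP : ∀ x : ℝ, _ := fun x : ℝ => Real.tsum_eq_tsum_fourier_of_rpow_decay hcont one_lt_two
    (quadGaussian_isBigO A (B * Q ^ 2) hb') hdec x
  have hterm : ∀ (j : ZMod Q) (h : ℤ), P j * (
      (FourierTransform.fourier fun y : ℝ => (quadGaussian A (B * Q ^ 2) (b * Q ^ 2) y : ℂ)) h *
        fourier h (((j.val + c) / Q : ℝ) : UnitAddCircle)) =
      ((b ^ (-(1 / 2) : ℝ) * (Q : ℝ)⁻¹ *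
        quadGaussian (A + B / (2 * Real.pi * b)) (-B / b ^ 2) (1 / b) (h / Q) : ℝ) : ℂ) *
        Complex.exp (2 * Real.pi * Complex.I * (h * c / Q)) *
          (P j * ZMod.stdAddChar ((h : ZMod Q) * j)) := by
    intro j h
    have h1 : (ZMod.stdAddChar (h * j : ZMod Q)) =
        Complex.exp (2 * Real.pi * Complex.I * ((h * j.val : ℤ) : ℂ) / Q) := by
      rw [← ZMod.stdAddChar_coe]
      simp
    have h2 : (b * (Q : ℝ) ^ 2) ^ (-(1 / 2) : ℝ) = b ^ (-(1 / 2) : ℝ) * (Q : ℝ)⁻¹ := by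
      rw [Real.mul_rpow hb.le (by positivity), ← Real.rpow_natCast, ← Real.rpow_mul hQ.le]
      norm_num
      exact Or.inl (Real.rpow_neg_one _)
    have h3 : quadGaussian (A + B * Q ^ 2 / (2 * Real.pi * (b * Q ^ 2)))
        (-(B * Q ^ 2) / (b * Q ^ 2) ^ 2) (1 / (b * Q ^ 2)) h =
        quadGaussian (A + B / (2 * Real.pi * b)) (-B / b ^ 2) (1 / b) (h / Q) := by
      rw [quadGaussian, quadGaussian]
      congr 1
      · field_simp
      · congr 1
        field_simp
    have h4 : fourier h (((j.val + c) / Q : ℝ) : UnitAddCircle) =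
        Complex.exp (2 * Real.pi * Complex.I * (h * c / Q)) *
          Complex.exp (2 * Real.pi * Complex.I * ((h * j.val : ℤ) : ℂ) / Q) := by
      rw [fourier_coe_apply, ← Complex.exp_add]
      congr 1
      push_cast
      ring
    rw [hF, h2, h3, h1, h4]
    ring
  have hleft : ∀ j : ZMod Q, P j * ∑' m : ℤ, (quadGaussian A B b (j.val + Q * m + c) : ℂ) =
      ∑' h : ℤ, P j * (
      (FourierTransform.fourier fun y : ℝ => (quadGaussian A (B * Q ^ 2) (b * Q ^ 2) y : ℂ)) h *
        fourier h (((j.val + c) / Q : ℝ) : UnitAddCircle)) := by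
    intro j
    rw [tsum_mul_left, ← hP]
    congr 1
    refine tsum_congr fun m => ?_
    congr 1
    rw [quadGaussian, quadGaussian]
    congr 1
    · field_simp
      ring
    · congr 1
      field_simp
      ring
  rw [Finset.sum_congr rfl fun j _ => hleft j,
    ← Summable.tsum_finsetSum fun j _ => (hsum _).mul_left (P j)]
  refine tsum_congr fun h => ?_
  rw [Finset.mul_sum]
  exact Finset.sum_congr rfl fun j _ => hterm j h

/-- The transform `V_κ` of the product of two shifted Gaussian weights. -/
noncomputable def crossKernel (κ : ℕ) (ρ : ℝ) : ℝ :=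
  (2 : ℝ) ^ (-(1 / 2) : ℝ) * ((if κ = 0 then 1 else 1 / (4 * Real.pi) - ρ / 4) *
    Real.exp (-(Real.pi / 2 * ρ)))

/-- The polynomial factor is at most `e^(ρ/2)`, and `π/2 - 1/2 ≥ 1` leaves `e^(-ρ)`. -/
theorem abs_crossKernel_le (κ : ℕ) {ρ : ℝ} (hρ : 0 ≤ ρ) : |crossKernel κ ρ| ≤ Real.exp (-ρ) := by
  have hpi := Real.pi_gt_three
  have h2 : (2 : ℝ) ^ (-(1 / 2) : ℝ) ≤ 1 := Real.rpow_le_one_of_one_le_of_nonpos (by norm_num)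
    (by norm_num)
  have h2' : (0 : ℝ) ≤ (2 : ℝ) ^ (-(1 / 2) : ℝ) := by positivity
  have h3 : |if κ = 0 then 1 else 1 / (4 * Real.pi) - ρ / 4| ≤ 1 + ρ / 2 := by
    split_ifs
    · rw [abs_one]; linarith
    · have h4 : 1 / (4 * Real.pi) ≤ 1 := by
        rw [div_le_one (by positivity)]; linarith
      have h5 : 0 ≤ 1 / (4 * Real.pi) := by positivity
      rw [abs_le]
      constructor <;> linarith
  have h4 : 1 + ρ / 2 ≤ Real.exp (ρ / 2) := by linarith [Real.add_one_le_exp (ρ / 2)]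
  rw [crossKernel, abs_mul, abs_mul, Real.abs_exp, abs_of_nonneg h2']
  calc _ ≤ 1 * (Real.exp (ρ / 2) * Real.exp (-(Real.pi / 2 * ρ))) := by
        gcongr
        exact h3.trans h4
    _ = Real.exp (ρ / 2 - Real.pi / 2 * ρ) := by rw [one_mul, ← Real.exp_add]; ring_nf
    _ ≤ _ := Real.exp_le_exp.2 (by nlinarith)

theorem summable_gaussTerm_mul_shift (κ : ℕ) {a : ℝ} (ha : 0 < a) (L : ℤ) :
    Summable fun n : ℤ => |gaussTerm κ a (n + L : ℤ)| * |gaussTerm κ a n| := by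
  have h := summable_gaussTerm κ ha
  refine (h.mul_left (∑' n : ℤ, |gaussTerm κ a n|)).of_nonneg_of_le (fun n => by positivity)
    fun n => ?_
  refine mul_le_mul_of_nonneg_right ?_ (abs_nonneg _)
  exact h.le_tsum (n + L) fun _ _ => abs_nonneg _

/-- Completing the square centres the product of the two weights at `n = -L/2`, while `ψ(n + L)
conj(ψ(n))` has period `Q`, so Poisson summation applies. The centre gives the phase, and the two
Gaussian exponents combine into one function of `ρ = aL² + h²/(aQ²)`. -/
theorem tsum_correlation_eq {Q : ℕ} [NeZero Q] (ψ : DirichletCharacter ℂ Q) {κ : ℕ}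
    (hκ : κ = 0 ∨ κ = 1) {a : ℝ} (ha : 0 < a) (L : ℤ) :
    ((a ^ (1 / 2 + κ : ℝ) : ℝ) : ℂ) * ∑' n : ℤ, (ψ ((n + L : ℤ) : ZMod Q) *
        (gaussTerm κ a (n + L : ℤ) : ℂ)) * conj (ψ (n : ZMod Q) * (gaussTerm κ a n : ℂ)) =
      ((Real.sqrt Q)⁻¹ : ℝ) * ∑' h : ℤ, Complex.exp (Real.pi * Complex.I * (h * L / Q)) *
        (crossKernel κ (a * L ^ 2 + h ^ 2 / (a * Q ^ 2)) : ℂ) * charSum ψ h L := by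
  have hQ : (0 : ℝ) < Q := by exact_mod_cast NeZero.pos Q
  -- For `κ = 1` the coefficients come from `(n + L)n = (n + L/2)² - L²/4`.
  set A : ℝ := if κ = 0 then 1 else -L ^ 2 / 4 with hA
  set B : ℝ := if κ = 0 then 0 else 1 with hB
  set P : ZMod Q → ℂ := fun j => ψ (L + j) * conj (ψ j) with hP
  have hprod : ∀ n : ℤ, gaussTerm κ a (n + L : ℤ) * gaussTerm κ a n =
      Real.exp (-(Real.pi * a * L ^ 2 / 2)) * quadGaussian A B (2 * a) (n + L / 2) := by
    intro n
    have he : Real.exp (-(Real.pi * a * ((n + L : ℤ) : ℝ) ^ 2)) *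
        Real.exp (-(Real.pi * a * (n : ℝ) ^ 2)) = Real.exp (-(Real.pi * a * L ^ 2 / 2)) *
          Real.exp (-(Real.pi * (2 * a) * (n + L / 2) ^ 2)) := by
      rw [← Real.exp_add, ← Real.exp_add]
      congr 1
      push_cast
      ring
    rw [gaussTerm, gaussTerm, quadGaussian, mul_mul_mul_comm, he, hA, hB]
    rcases hκ with rfl | rfl
    · simp
    · simp only [one_ne_zero, if_false, pow_one]
      push_cast
      ring
  have hterm : ∀ n : ℤ, (ψ ((n + L : ℤ) : ZMod Q) * (gaussTerm κ a (n + L : ℤ) : ℂ)) *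
      conj (ψ (n : ZMod Q) * (gaussTerm κ a n : ℂ)) =
      (Real.exp (-(Real.pi * a * L ^ 2 / 2)) : ℂ) *
        (P n * (quadGaussian A B (2 * a) (n + L / 2) : ℂ)) := by
    intro n
    have := congrArg (fun x : ℝ => (x : ℂ)) (hprod n)
    simp only [Complex.ofReal_mul] at this
    rw [map_mul, Complex.conj_ofReal, mul_mul_mul_comm, this, hP]
    push_cast
    rw [add_comm (n : ZMod Q)]
    ring
  have hs : Summable fun n : ℤ => P n * (quadGaussian A B (2 * a) (n + L / 2) : ℂ) := by
    have h1 : Summable fun n : ℤ => (Real.exp (-(Real.pi * a * L ^ 2 / 2)) : ℂ) *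
        (P n * (quadGaussian A B (2 * a) (n + L / 2) : ℂ)) := by
      refine (summable_gaussTerm_mul_shift κ ha L).of_norm_bounded fun n => ?_
      rw [← hterm, norm_mul, RCLike.norm_conj, norm_mul, norm_mul, Complex.norm_real,
        Complex.norm_real]
      exact mul_le_mul (mul_le_of_le_one_left (abs_nonneg _) (ψ.norm_le_one _))
        (mul_le_of_le_one_left (abs_nonneg _) (ψ.norm_le_one _)) (by positivity) (by positivity)
    exact (summable_mul_left_iff (by simp)).1 h1
  rw [tsum_congr hterm, tsum_mul_left, tsum_int_eq_sum_zmod hs Q]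
  have h1 := tsum_periodic_mul_quadGaussian P A B (L / 2) (b := 2 * a) (by positivity)
  have h2 : ∀ j : ZMod Q, ∑' m : ℤ, P ((j.val + Q * m : ℤ) : ZMod Q) *
      (quadGaussian A B (2 * a) ((j.val + Q * m : ℤ) + L / 2) : ℂ) =
      P j * ∑' m : ℤ, (quadGaussian A B (2 * a) (j.val + Q * m + L / 2) : ℂ) := by
    intro j
    rw [← tsum_mul_left]
    refine tsum_congr fun m => ?_
    congr 2
    · simp
    · push_cast; rfl
  rw [Finset.sum_congr rfl fun j _ => h2 j, h1, ← tsum_mul_left, ← tsum_mul_left, ← tsum_mul_left]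
  refine tsum_congr fun h => ?_
  have h3 : ∑ j : ZMod Q, P j * ZMod.stdAddChar ((h : ZMod Q) * j) =
      (Real.sqrt Q : ℂ) * charSum ψ h L := by
    have hsq : (Real.sqrt Q : ℂ) ≠ 0 := by
      exact_mod_cast (Real.sqrt_pos.2 hQ).ne'
    rw [charSum_eq_twistedCorrelation, twistedCorrelation, Complex.ofReal_inv,
      mul_inv_cancel_left₀ hsq]
  have h4 : a ^ (1 / 2 + κ : ℝ) * Real.exp (-(Real.pi * a * L ^ 2 / 2)) *
      ((2 * a) ^ (-(1 / 2) : ℝ) * (Q : ℝ)⁻¹ * quadGaussian (A + B / (2 * Real.pi * (2 * a)))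
        (-B / (2 * a) ^ 2) (1 / (2 * a)) (h / Q)) * Real.sqrt Q =
      (Real.sqrt Q)⁻¹ * crossKernel κ (a * L ^ 2 + h ^ 2 / (a * Q ^ 2)) := by
    have e1 : Real.exp (-(Real.pi * a * L ^ 2 / 2)) *
        Real.exp (-(Real.pi * (1 / (2 * a)) * (h / Q) ^ 2)) =
          Real.exp (-(Real.pi / 2 * (a * L ^ 2 + h ^ 2 / (a * Q ^ 2)))) := by
      rw [← Real.exp_add]
      congr 1
      field_simp
      ring
    have e2 : (Q : ℝ)⁻¹ * Real.sqrt Q = (Real.sqrt Q)⁻¹ := by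
      have := Real.mul_self_sqrt hQ.le
      field_simp
      nlinarith
    have e3 : a ^ (1 / 2 + κ : ℝ) * (2 * a) ^ (-(1 / 2) : ℝ) =
        (2 : ℝ) ^ (-(1 / 2) : ℝ) * a ^ κ := by
      rw [Real.mul_rpow (by norm_num) ha.le, mul_left_comm, ← Real.rpow_add ha,
        ← Real.rpow_natCast]
      ring_nf
    -- The polynomial part also depends on `L` and `h` only through `ρ`.
    have e4 : a ^ κ * ((A + B / (2 * Real.pi * (2 * a))) + -B / (2 * a) ^ 2 * (h / Q) ^ 2) =
        if κ = 0 then 1 else 1 / (4 * Real.pi) - (a * L ^ 2 + h ^ 2 / (a * Q ^ 2)) / 4 := by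
      have := Real.pi_ne_zero
      rw [hA, hB]
      rcases hκ with rfl | rfl
      · simp
      · simp only [one_ne_zero, if_false]
        field_simp
        ring
    rw [quadGaussian, crossKernel, ← e4, ← e1, ← e2]
    linear_combination (((A + B / (2 * Real.pi * (2 * a))) + -B / (2 * a) ^ 2 * (h / Q) ^ 2) *
      Real.exp (-(Real.pi * a * L ^ 2 / 2)) * (Q : ℝ)⁻¹ *
        Real.exp (-(Real.pi * (1 / (2 * a)) * (h / Q) ^ 2)) * Real.sqrt Q) * e3
  have h5 := congrArg (fun x : ℝ => (x : ℂ)) h4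
  simp only [Complex.ofReal_mul] at h5
  have h6 : Complex.exp (2 * Real.pi * Complex.I * (h * ((L / 2 : ℝ) : ℂ) / Q)) =
      Complex.exp (Real.pi * Complex.I * (h * L / Q)) := by
    congr 1
    push_cast
    ring
  rw [h3, h6]
  simp only [Complex.ofReal_mul]
  linear_combination (Complex.exp (Real.pi * Complex.I * (h * L / Q)) * charSum ψ h L) * h5

/-! ### Orthogonality over the characters modulo `q₁`. -/

/-- Orthogonality gives `φ(N)` times the sum over units; both are enlarged by positivity. -/
theorem sum_norm_sq_dirichletCharacter_le {N : ℕ} [NeZero N] (B : ZMod N → ℂ) :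
    ∑ χ : DirichletCharacter ℂ N, ‖∑ r, χ r * B r‖ ^ 2 ≤ N * ∑ r, ‖B r‖ ^ 2 := by
  classical
  have horth : ∀ r s : ZMod N, ∑ χ : DirichletCharacter ℂ N, χ r * conj (χ s) =
      if r = s ∧ IsUnit s then (N.totient : ℂ) else 0 := by
    intro r s
    by_cases hs : IsUnit s
    · have h := DirichletCharacter.sum_char_inv_mul_char_eq ℂ hs r
      have h' : ∀ χ : DirichletCharacter ℂ N, χ r * conj (χ s) = χ s⁻¹ * χ r := by
        intro χ
        have h1 := MulChar.conj_mul_self_of_isUnit χ hs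
        have h2 : χ s⁻¹ * χ s = 1 := by
          rw [← map_mul, ZMod.inv_mul_of_unit s hs, map_one]
        have h3 : χ s ≠ 0 := right_ne_zero_of_mul_eq_one h2
        have h4 : conj (χ s) = χ s⁻¹ := mul_right_cancel₀ h3 ((mul_comm _ _).trans (h1.trans h2.symm))
        rw [h4, mul_comm]
      rw [Finset.sum_congr rfl fun χ _ => h' χ, h]
      simp [hs, eq_comm]
    · have h0 : ∀ χ : DirichletCharacter ℂ N, χ s = 0 := fun χ => MulChar.map_nonunit χ hs
      simp [hs, h0]
  have key : ((∑ χ : DirichletCharacter ℂ N, ‖∑ r, χ r * B r‖ ^ 2 : ℝ) : ℂ) =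
      ((N.totient * ∑ r, if IsUnit r then ‖B r‖ ^ 2 else 0 : ℝ) : ℂ) := by
    have h1 : ∀ χ : DirichletCharacter ℂ N, ((‖∑ r, χ r * B r‖ ^ 2 : ℝ) : ℂ) =
        ∑ r, ∑ s, (B r * conj (B s)) * (χ r * conj (χ s)) := by
      intro χ
      push_cast
      rw [← Complex.mul_conj', map_sum, Finset.sum_mul_sum]
      refine Finset.sum_congr rfl fun r _ => Finset.sum_congr rfl fun s _ => ?_
      rw [map_mul]
      ring
    rw [Complex.ofReal_sum, Finset.sum_congr rfl fun χ _ => h1 χ, Finset.sum_comm]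
    rw [Finset.sum_congr rfl fun r _ => Finset.sum_comm]
    simp_rw [← Finset.mul_sum, horth]
    push_cast
    rw [Finset.mul_sum]
    refine Finset.sum_congr rfl fun r _ => ?_
    rw [Finset.sum_eq_single r]
    · by_cases hr : IsUnit r
      · simp [hr, Complex.mul_conj']
        ring
      · simp [hr]
    · intro s _ hs
      simp [Ne.symm hs]
    · simp
  rw [Complex.ofReal_inj.1 key]
  refine mul_le_mul (by exact_mod_cast N.totient_le) (Finset.sum_le_sum fun r _ => ?_)
    (Finset.sum_nonneg fun r _ => ?_) (by positivity)
  · split_ifs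
    · exact le_rfl
    · positivity
  · split_ifs <;> positivity

theorem summable_mul_shift {b : ℤ → ℂ} (hb : Summable fun n => ‖b n‖) (N : ℕ) [NeZero N] :
    Summable fun p : ℤ × ℤ => b (p.1 + N * p.2) * conj (b p.1) := by
  have h := hb.mul_of_nonneg hb (fun _ => norm_nonneg _) (fun _ => norm_nonneg _)
  have hinj : Function.Injective fun p : ℤ × ℤ => (p.1 + N * p.2, p.1) := by
    rintro ⟨x, y⟩ ⟨x', y'⟩ hxy
    have hN : (N : ℤ) ≠ 0 := by exact_mod_cast NeZero.ne N
    simp only [Prod.mk.injEq] at hxy ⊢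
    obtain ⟨h1, rfl⟩ := hxy
    exact ⟨rfl, mul_left_cancel₀ hN (by linarith)⟩
  refine (h.comp_injective hinj).of_norm_bounded fun p => ?_
  simp

/-- Opening the squares yields all pairs of integers congruent mod `N`, parametrised as `n` and `n +
Nl`. -/
theorem sum_norm_sq_tsum_residue {b : ℤ → ℂ} (hb : Summable fun n => ‖b n‖) (N : ℕ) [NeZero N] :
    ((∑ r : ZMod N, ‖∑' m : ℤ, b (r.val + N * m)‖ ^ 2 : ℝ) : ℂ) =
      ∑' l : ℤ, ∑' n : ℤ, b (n + N * l) * conj (b n) := by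
  have hs := summable_mul_shift hb N
  have hcomm := Summable.tsum_comm (f := fun n l : ℤ => b (n + N * l) * conj (b n)) hs
  rw [hcomm]
  have hper : ∀ (r : ZMod N) (m : ℤ), ∑' l : ℤ, b (r.val + N * m + N * l) =
      ∑' l : ℤ, b (r.val + N * l) := by
    intro r m
    rw [← (Equiv.addLeft m).tsum_eq fun l : ℤ => b (r.val + N * l)]
    refine tsum_congr fun l => ?_
    rw [Equiv.coe_addLeft, mul_add, add_assoc]
  have hs' : Summable fun n : ℤ => ∑' l : ℤ, b (n + N * l) * conj (b n) := hs.prod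
  rw [tsum_int_eq_sum_zmod hs' N]
  push_cast
  refine Finset.sum_congr rfl fun r _ => ?_
  simp_rw [tsum_mul_right, hper]
  rw [tsum_mul_left, ← Complex.conj_tsum, Complex.mul_conj']

theorem sum_norm_sq_tsum_char_le {b : ℤ → ℂ} (hb : Summable fun n => ‖b n‖) (N : ℕ) [NeZero N] :
    ∑ χ : DirichletCharacter ℂ N, ‖∑' n : ℤ, χ n * b n‖ ^ 2 ≤
      N * (∑' l : ℤ, ∑' n : ℤ, b (n + N * l) * conj (b n)).re := by
  have h1 : ∀ χ : DirichletCharacter ℂ N, ∑' n : ℤ, χ n * b n =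
      ∑ r, χ r * ∑' m : ℤ, b (r.val + N * m) := by
    intro χ
    have hs : Summable fun n : ℤ => χ n * b n := hb.of_norm_bounded fun n => by
      rw [norm_mul]
      exact mul_le_of_le_one_left (norm_nonneg _) (χ.norm_le_one _)
    rw [tsum_int_eq_sum_zmod hs N]
    refine Finset.sum_congr rfl fun r _ => ?_
    rw [← tsum_mul_left]
    refine tsum_congr fun m => ?_
    simp
  simp_rw [h1]
  refine (sum_norm_sq_dirichletCharacter_le _).trans_eq ?_
  rw [← sum_norm_sq_tsum_residue hb N, Complex.ofReal_re]

/-! ### The divisor bound and the mean square of `gcdFactor`. -/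

/-- If `p ≥ 2^(1/s)` then `p^s ≥ 2` and `k + 1 ≤ 2^k` suffices. The smaller primes cost a constant
each, and their number depends only on `s`. -/
theorem natCast_add_one_le_mul_rpow {s : ℝ} (hs : 0 < s) {p : ℕ} (hp : 2 ≤ p) (k : ℕ) :
    (k + 1 : ℝ) ≤ (if p < ⌈(2 : ℝ) ^ (1 / s)⌉₊ then 1 + 1 / (s * Real.log 2) else 1) *
      ((p : ℝ) ^ k) ^ s := by
  have hp' : (2 : ℝ) ≤ p := by exact_mod_cast hp
  have hlog : 0 < s * Real.log 2 := mul_pos hs (Real.log_pos one_lt_two)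
  have hsw : ((p : ℝ) ^ k) ^ s = ((p : ℝ) ^ s) ^ k := by
    rw [← Real.rpow_natCast, ← Real.rpow_natCast, ← Real.rpow_mul (by positivity),
      ← Real.rpow_mul (by positivity), mul_comm]
  split_ifs with h
  · have h1 : 1 + k * (s * Real.log 2) ≤ ((p : ℝ) ^ k) ^ s := by
      calc 1 + k * (s * Real.log 2) ≤ Real.exp (k * (s * Real.log 2)) := by
            linarith [Real.add_one_le_exp (k * (s * Real.log 2))]
        _ = ((2 : ℝ) ^ s) ^ k := by
            rw [Real.exp_nat_mul, Real.rpow_def_of_pos two_pos, mul_comm s]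
        _ ≤ ((p : ℝ) ^ s) ^ k := by gcongr
        _ = _ := hsw.symm
    calc (k + 1 : ℝ) ≤ (1 + 1 / (s * Real.log 2)) * (1 + k * (s * Real.log 2)) := by
          have e : (1 + 1 / (s * Real.log 2)) * (1 + k * (s * Real.log 2)) =
            1 + k + k * (s * Real.log 2) + 1 / (s * Real.log 2) := by
            generalize s * Real.log 2 = x at hlog
            field_simp
            ring
          rw [e]
          have : 0 ≤ k * (s * Real.log 2) := by positivity
          have : 0 ≤ 1 / (s * Real.log 2) := by positivity
          linarith
      _ ≤ _ := by gcongr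
  · have h1 : (2 : ℝ) ^ (1 / s) ≤ p := (Nat.le_ceil _).trans (by exact_mod_cast not_lt.1 h)
    have h2 : (2 : ℝ) ≤ (p : ℝ) ^ s := by
      calc (2 : ℝ) = ((2 : ℝ) ^ (1 / s)) ^ s := by
            rw [← Real.rpow_mul (by norm_num), one_div_mul_cancel hs.ne', Real.rpow_one]
        _ ≤ _ := by gcongr
    rw [one_mul, hsw]
    calc (k + 1 : ℝ) ≤ 2 ^ k := by exact_mod_cast Nat.lt_two_pow_self
      _ ≤ _ := by gcongr

/-- The divisor bound. -/
theorem exists_card_divisors_le_rpow {s : ℝ} (hs : 0 < s) :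
    ∃ C : ℝ, 1 ≤ C ∧ ∀ n : ℕ, n ≠ 0 → (n.divisors.card : ℝ) ≤ C * (n : ℝ) ^ s := by
  have hlog : 0 < s * Real.log 2 := mul_pos hs (Real.log_pos one_lt_two)
  set c : ℝ := 1 + 1 / (s * Real.log 2) with hc
  have hc1 : 1 ≤ c := by rw [hc]; have : 0 ≤ 1 / (s * Real.log 2) := by positivity
                         linarith
  set P := ⌈(2 : ℝ) ^ (1 / s)⌉₊ with hP
  refine ⟨c ^ P, one_le_pow₀ hc1, fun n hn => ?_⟩
  have h1 : (n : ℝ) ^ s = ∏ p ∈ n.primeFactors, ((p : ℝ) ^ n.factorization p) ^ s := by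
    rw [Real.finsetProd_rpow _ _ fun p _ => by positivity]
    congr 1
    exact_mod_cast (Nat.prod_factorization_pow_eq_self hn).symm
  have h2 : ∏ p ∈ n.primeFactors, (if p < P then c else 1) ≤ c ^ P := by
    rw [Finset.prod_ite, Finset.prod_const, Finset.prod_const_one, mul_one]
    refine pow_le_pow_right₀ hc1 ?_
    calc _ ≤ (Finset.range P).card := Finset.card_le_card fun p hp => by
          simpa using (Finset.mem_filter.1 hp).2
      _ = P := Finset.card_range P
  rw [Nat.card_divisors hn, h1]
  push_cast
  calc _ ≤ ∏ p ∈ n.primeFactors, ((if p < P then c else 1) *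
        ((p : ℝ) ^ n.factorization p) ^ s) := Finset.prod_le_prod (fun p _ => by positivity)
          fun p hp => natCast_add_one_le_mul_rpow hs (Nat.prime_of_mem_primeFactors hp).two_le _
    _ ≤ _ := by
      rw [Finset.prod_mul_distrib]
      exact mul_le_mul_of_nonneg_right h2 (Finset.prod_nonneg fun p _ => by positivity)

theorem card_divisorsAntidiag (m : ℤ) :
    m.divisorsAntidiag.card = 2 * m.natAbs.divisors.card := by
  have h1 : m.divisors.card = 2 * m.natAbs.divisors.card := by
    rw [Int.divisors, Finset.card_disjUnion, Finset.card_map, Finset.card_map, two_mul]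
  rw [← h1, ← Int.image_fst_divisorsAntidiag, Finset.card_image_of_injOn]
  rintro ⟨a, b⟩ h ⟨a', b'⟩ h' (hab : a = a')
  simp only [Finset.mem_coe, Int.mem_divisorsAntidiag] at h h'
  subst hab
  have : a ≠ 0 := by
    rintro rfl
    exact h.2 (by simpa using h.1.symm)
  rw [Prod.mk.injEq]
  exact ⟨rfl, mul_left_cancel₀ this (h.1.trans h'.1.symm)⟩

theorem card_punctured_le {X : ℝ} (hX : 0 ≤ X) : ((punctured X).card : ℝ) ≤ 2 * X := by
  have h0 : 0 ≤ ⌊X⌋ := Int.floor_nonneg.2 hX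
  rw [punctured, Finset.card_erase_of_mem (by simp [h0]), Int.card_Icc]
  have h1 : ((⌊X⌋ + 1 - -⌊X⌋).toNat - 1 : ℕ) = 2 * ⌊X⌋.toNat := by omega
  rw [h1]
  have h2 : ((⌊X⌋.toNat : ℕ) : ℝ) = ⌊X⌋ := by exact_mod_cast Int.toNat_of_nonneg h0
  push_cast
  rw [h2]
  linarith [Int.floor_le X]

theorem card_punctured_filter_dvd_le {X : ℝ} (hX : 0 ≤ X) {D : ℕ} (hD : 0 < D) :
    (((punctured X).filter fun m => (D : ℤ) ∣ m).card : ℝ) ≤ 2 * (X / D) := by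
  have hD' : (0 : ℝ) < D := by exact_mod_cast hD
  refine le_trans ?_ (card_punctured_le (X := X / D) (by positivity))
  have hsub : ((punctured X).filter fun m => (D : ℤ) ∣ m) ⊆
      (punctured (X / D)).image fun m => (D : ℤ) * m := by
    intro m hm
    obtain ⟨hm, k, rfl⟩ := Finset.mem_filter.1 hm
    rw [mem_punctured, abs_pos] at hm
    refine Finset.mem_image.2 ⟨k, (mem_punctured _ _).2 ⟨abs_pos.2 ?_, ?_⟩, rfl⟩
    · rintro rfl
      simp at hm
    · rw [le_div_iff₀ hD', mul_comm]
      have := hm.2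
      push_cast [abs_mul] at this ⊢
      rwa [Nat.abs_cast] at this
  exact_mod_cast (Finset.card_le_card hsub).trans Finset.card_image_le

/-- A mean-square bound for a sum over factorizations weighted by `gcdFactor`. -/
theorem exists_sum_sq_gcdFactor_le {s : ℝ} (hs : 0 < s) : ∃ C : ℝ, 1 ≤ C ∧
    ∀ (q₁ Q : ℕ) (X : ℝ), Q ≠ 0 → Nat.Coprime q₁ Q → 0 ≤ X →
      ∑ m ∈ punctured X, (∑ p ∈ m.divisorsAntidiag, |gcdFactor Q p.2 (q₁ * p.1)|) ^ 2 ≤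
        C * (X ^ s * X * (Q : ℝ) ^ s) := by
  obtain ⟨C, hC, hdiv⟩ := exists_card_divisors_le_rpow (half_pos hs)
  have hC0 : 0 ≤ C := by linarith
  obtain ⟨C', hC', hdiv'⟩ := exists_card_divisors_le_rpow hs
  refine ⟨4 * C ^ 2 * (2 * C'), by nlinarith [one_le_pow₀ (n := 2) hC], fun q₁ Q X hQ hc hX => ?_⟩
  have hbound : ∀ m ∈ punctured X,
      (∑ p ∈ m.divisorsAntidiag, |gcdFactor Q p.2 (q₁ * p.1)|) ^ 2 ≤
        (4 * C ^ 2 * X ^ s) * ∑ d ∈ Q.divisors, if ((d ^ 2 : ℕ) : ℤ) ∣ m then (d : ℝ) ^ 2 else 0 := by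
    intro m hm
    rw [mem_punctured, abs_pos] at hm
    have hcard : (m.divisorsAntidiag.card : ℝ) ≤ 2 * C * X ^ (s / 2) := by
      rw [card_divisorsAntidiag]
      push_cast
      have h1 := hdiv m.natAbs (by simpa using hm.1)
      have h2 : ((m.natAbs : ℕ) : ℝ) ≤ X := by
        rw [Nat.cast_natAbs]
        exact hm.2
      calc 2 * (m.natAbs.divisors.card : ℝ) ≤ 2 * (C * (m.natAbs : ℝ) ^ (s / 2)) := by gcongr
        _ ≤ 2 * (C * X ^ (s / 2)) := by gcongr
        _ = _ := by ring
    -- The divisor `d` attached to a factorization is prime to `q₁`, so it divides both factors of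
    -- `m`; hence `d² ∣ m`.
    have hterm : ∀ p ∈ m.divisorsAntidiag, |gcdFactor Q p.2 (q₁ * p.1)| ^ 2 ≤
        ∑ d ∈ Q.divisors, if ((d ^ 2 : ℕ) : ℤ) ∣ m then (d : ℝ) ^ 2 else 0 := by
      intro p hp
      obtain ⟨d, hdQ, hd2, hd1, hle⟩ := exists_dvd_abs_gcdFactor_le (Q := Q) p.2 (q₁ * p.1)
      have hd1' : (d : ℤ) ∣ p.1 := by
        refine IsCoprime.dvd_of_dvd_mul_left ?_ hd1
        exact Nat.isCoprime_iff_coprime.2 (hc.symm.coprime_dvd_left hdQ)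
      have hdm : ((d ^ 2 : ℕ) : ℤ) ∣ m := by
        rw [← (Int.mem_divisorsAntidiag.1 hp).1]
        push_cast
        rw [sq]
        exact mul_dvd_mul hd1' hd2
      calc |gcdFactor Q p.2 (q₁ * p.1)| ^ 2 ≤ (d : ℝ) ^ 2 := by gcongr
        _ = if ((d ^ 2 : ℕ) : ℤ) ∣ m then (d : ℝ) ^ 2 else 0 := by rw [if_pos hdm]
        _ ≤ _ := Finset.single_le_sum
          (f := fun d : ℕ => if ((d ^ 2 : ℕ) : ℤ) ∣ m then (d : ℝ) ^ 2 else 0)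
          (fun d _ => by positivity) (Nat.mem_divisors.2 ⟨hdQ, hQ⟩)
    have hnn : 0 ≤ ∑ d ∈ Q.divisors, if ((d ^ 2 : ℕ) : ℤ) ∣ m then (d : ℝ) ^ 2 else 0 :=
      Finset.sum_nonneg fun d _ => by positivity
    calc _ ≤ (m.divisorsAntidiag.card : ℝ) *
          ∑ p ∈ m.divisorsAntidiag, |gcdFactor Q p.2 (q₁ * p.1)| ^ 2 := sq_sum_le_card_mul_sum_sq
      _ ≤ (m.divisorsAntidiag.card : ℝ) * ((m.divisorsAntidiag.card : ℝ) *
          ∑ d ∈ Q.divisors, if ((d ^ 2 : ℕ) : ℤ) ∣ m then (d : ℝ) ^ 2 else 0) := by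
        gcongr
        rw [← nsmul_eq_mul]
        exact Finset.sum_le_card_nsmul _ _ _ hterm
      _ ≤ (2 * C * X ^ (s / 2)) * ((2 * C * X ^ (s / 2)) *
          ∑ d ∈ Q.divisors, if ((d ^ 2 : ℕ) : ℤ) ∣ m then (d : ℝ) ^ 2 else 0) := by
        gcongr
      _ = _ := by
        have : X ^ s = X ^ (s / 2) * X ^ (s / 2) := by
          rw [← sq, ← Real.rpow_natCast, ← Real.rpow_mul hX]
          norm_num
        rw [this]
        ring
  refine (Finset.sum_le_sum hbound).trans ?_
  rw [← Finset.mul_sum, Finset.sum_comm]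
  -- The weight `d²` is balanced by the density `1/d²` of the multiples of `d²`, so each `d` costs
  -- only `O(X)`.
  have hd : ∀ d ∈ Q.divisors, ∑ m ∈ punctured X,
      (if ((d ^ 2 : ℕ) : ℤ) ∣ m then (d : ℝ) ^ 2 else 0) ≤ 2 * X := by
    intro d hd
    have hd0 : 0 < d := Nat.pos_of_mem_divisors hd
    have hd0' : (0 : ℝ) < d := by exact_mod_cast hd0
    rw [← Finset.sum_filter, Finset.sum_const, nsmul_eq_mul]
    have := card_punctured_filter_dvd_le hX (D := d ^ 2) (by positivity)
    calc _ ≤ 2 * (X / (d ^ 2 : ℕ)) * (d : ℝ) ^ 2 := by gcongr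
      _ = 2 * X := by push_cast; field_simp
  calc _ ≤ (4 * C ^ 2 * X ^ s) * (Q.divisors.card * (2 * X)) := by
        gcongr
        rw [← nsmul_eq_mul]
        exact Finset.sum_le_card_nsmul _ _ _ hd
    _ ≤ (4 * C ^ 2 * X ^ s) * ((C' * (Q : ℝ) ^ s) * (2 * X)) := by
        gcongr
        exact hdiv' Q hQ
    _ = _ := by ring

/-! ### Cauchy–Schwarz in `t` and continuity of the theta functions. -/

theorem integral_Ioi_one_rpow {a : ℝ} (ha : a < -1) :
    ∫ t in Set.Ioi (1 : ℝ), t ^ a = -1 / (a + 1) := by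
  rw [integral_Ioi_rpow_of_lt ha one_pos, Real.one_rpow]

/-- Cauchy–Schwarz on `[1, ∞)` against the weight `t ^ (-1 - η)`. -/
theorem sq_integral_div_le {η : ℝ} (hη : 0 < η) {f : ℝ → ℝ} (hf : ∀ t, 1 < t → 0 ≤ f t)
    (hi : MeasureTheory.IntegrableOn (fun t => f t ^ 2 * t ^ (η - 1)) (Set.Ioi 1)) :
    (∫ t in Set.Ioi (1 : ℝ), f t / t) ^ 2 ≤
      η⁻¹ * ∫ t in Set.Ioi (1 : ℝ), f t ^ 2 * t ^ (η - 1) := by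
  set J := ∫ t in Set.Ioi (1 : ℝ), f t / t with hJ
  set I := ∫ t in Set.Ioi (1 : ℝ), f t ^ 2 * t ^ (η - 1) with hI
  have hI0 : 0 ≤ I := MeasureTheory.setIntegral_nonneg measurableSet_Ioi fun t ht => by
    have : 0 < t := one_pos.trans ht
    positivity
  have hJ0 : 0 ≤ J := MeasureTheory.setIntegral_nonneg measurableSet_Ioi fun t ht =>
    div_nonneg (hf t ht) (one_pos.trans ht).le
  have hlt : -1 - η < -1 := by linarith
  have hint := integrableOn_Ioi_rpow_of_lt hlt one_pos
  -- The weighted arithmetic–geometric mean inequality with a free parameter `x`; taking `x =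
  -- 1/(ηJ)` below gives the Cauchy–Schwarz bound. In this form integrability of `f t / t` need not
  -- be proved.
  have key : ∀ x : ℝ, 0 < x → J ≤ x / 2 * I + (2 * x)⁻¹ * η⁻¹ := by
    intro x hx
    have h1 : J ≤ ∫ t in Set.Ioi (1 : ℝ),
        (x / 2 * (f t ^ 2 * t ^ (η - 1)) + (2 * x)⁻¹ * t ^ (-1 - η)) := by
      refine MeasureTheory.integral_mono_of_nonneg ?_ ((hi.const_mul _).add (hint.const_mul _)) ?_
      · filter_upwards [MeasureTheory.ae_restrict_mem measurableSet_Ioi] with t ht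
        exact div_nonneg (hf t ht) (one_pos.trans ht).le
      · filter_upwards [MeasureTheory.ae_restrict_mem measurableSet_Ioi] with t ht
        have ht0 : 0 < t := one_pos.trans ht
        have e1 : t ^ (η - 1) = t ^ η / t := by rw [Real.rpow_sub ht0, Real.rpow_one]
        have e2 : t ^ (-1 - η) = t⁻¹ / t ^ η := by
          rw [Real.rpow_sub ht0, Real.rpow_neg_one]
        have hp : 0 < t ^ η := by positivity
        rw [e1, e2]
        generalize t ^ η = y at hp
        have : x / 2 * (f t ^ 2 * (y / t)) + (2 * x)⁻¹ * (t⁻¹ / y) - f t / t =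
            (x * f t * y - 1) ^ 2 / (2 * x * t * y) := by
          field_simp
          ring
        have : 0 ≤ (x * f t * y - 1) ^ 2 / (2 * x * t * y) := by positivity
        linarith
    rw [MeasureTheory.integral_add (hi.const_mul _) (hint.const_mul _),
      MeasureTheory.integral_const_mul, MeasureTheory.integral_const_mul,
      integral_Ioi_one_rpow hlt] at h1
    refine h1.trans_eq ?_
    congr 2
    rw [neg_div, one_div, ← inv_neg]
    congr 1
    ring
  rcases hJ0.eq_or_lt with h0 | h0
  · rw [← h0]
    have := inv_pos.2 hη
    simpa using mul_nonneg this.le hI0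
  · have := key (1 / (η * J)) (by positivity)
    have e : 1 / (η * J) / 2 * I + (2 * (1 / (η * J)))⁻¹ * η⁻¹ = η⁻¹ * I / (2 * J) + J / 2 := by
      field_simp
    rw [e] at this
    have h2 : J / 2 ≤ η⁻¹ * I / (2 * J) := by linarith
    rw [le_div_iff₀ (by positivity)] at h2
    nlinarith

theorem abs_gaussTerm_antitone (κ : ℕ) {a c : ℝ} (h : c ≤ a) (x : ℝ) :
    |gaussTerm κ a x| ≤ |gaussTerm κ c x| := by
  rw [gaussTerm, gaussTerm, abs_mul, abs_mul, Real.abs_exp, Real.abs_exp]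
  have := Real.pi_pos
  gcongr

theorem continuousOn_thetaSum (κ : ℕ) {b : ℤ → ℂ} (hb : ∀ n, ‖b n‖ ≤ 1) {c : ℝ} (hc : 0 < c) :
    ContinuousOn (thetaSum κ b) (Set.Ici c) := by
  refine continuousOn_tsum (u := fun n : ℤ => |gaussTerm κ c n|) (fun n => ?_)
    (summable_gaussTerm κ hc) fun n a ha => ?_
  · unfold gaussTerm
    fun_prop
  · rw [norm_mul, Complex.norm_real]
    exact (mul_le_of_le_one_left (norm_nonneg _) (hb n)).trans (abs_gaussTerm_antitone κ ha _)

/-- Supplies the measurability of the integrands in the second moment. -/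
theorem continuousOn_normTheta (κ : ℕ) {q : ℕ} (hq : 0 < q) {b : ℤ → ℂ} (hb : ∀ n, ‖b n‖ ≤ 1) :
    ContinuousOn (normTheta κ q b) (Set.Ioi 1) := by
  have hq' : (0 : ℝ) < q := by exact_mod_cast hq
  refine ContinuousOn.mul ?_ ?_
  · refine ContinuousOn.rpow_const (by fun_prop) fun t ht => Or.inl ?_
    have : (0 : ℝ) < t := one_pos.trans ht
    positivity
  · refine ((continuousOn_thetaSum κ hb (c := 1 / q) (by positivity)).comp (by fun_prop)
      fun t ht => ?_).norm
    exact div_le_div_of_nonneg_right (le_of_lt ht) hq'.le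

theorem sq_normTheta (κ q : ℕ) (b : ℤ → ℂ) {t : ℝ} (ht : 0 ≤ t) :
    normTheta κ q b t ^ 2 = (t / q) ^ (1 / 2 + κ : ℝ) * ‖thetaSum κ b (t / q)‖ ^ 2 := by
  rw [normTheta, mul_pow, ← Real.rpow_natCast, ← Real.rpow_mul (by positivity)]
  congr 2
  push_cast
  ring

/-! ### Diagonal and off-diagonal terms. -/

/-- The off-diagonal term attached to the shift `q₁ * p.1` and the frequency `p.2`. -/
noncomputable def crossTerm {Q : ℕ} [NeZero Q] (κ : ℕ) (ψ : DirichletCharacter ℂ Q) (q₁ : ℕ) (t : ℝ)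
    (p : ℤ × ℤ) : ℂ :=
  Complex.exp (Real.pi * Complex.I * (p.2 * ((q₁ * p.1 : ℤ) : ℂ) / Q)) *
    (crossKernel κ (t * q₁ * p.1 ^ 2 / Q + q₁ * p.2 ^ 2 / (t * Q)) : ℂ) *
      charSum ψ p.2 ((q₁ * p.1 : ℤ) : ZMod Q)

section
variable {Q : ℕ} [NeZero Q]

theorem norm_crossTerm_le (κ : ℕ) (ψ : DirichletCharacter ℂ Q) (q₁ : ℕ) {t : ℝ} (ht : 0 < t)
    (p : ℤ × ℤ) : ‖crossTerm κ ψ q₁ t p‖ ≤ Real.exp (-(t * q₁ * p.1 ^ 2 / Q)) *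
      Real.exp (-(q₁ * p.2 ^ 2 / (t * Q))) * ‖charSum ψ p.2 ((q₁ * p.1 : ℤ) : ZMod Q)‖ := by
  have h1 : ‖Complex.exp (Real.pi * Complex.I * (p.2 * ((q₁ * p.1 : ℤ) : ℂ) / Q))‖ = 1 := by
    have : Real.pi * Complex.I * (p.2 * ((q₁ * p.1 : ℤ) : ℂ) / Q) =
        ((Real.pi * (p.2 * (q₁ * p.1 : ℤ) / Q) : ℝ) : ℂ) * Complex.I := by
      push_cast
      ring
    rw [this, Complex.norm_exp_ofReal_mul_I]
  rw [crossTerm, norm_mul, norm_mul, h1, one_mul, Complex.norm_real]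
  refine mul_le_mul_of_nonneg_right ((abs_crossKernel_le κ (by positivity)).trans_eq ?_)
    (norm_nonneg _)
  rw [← Real.exp_add]
  congr 1
  ring

theorem summable_crossTerm (κ : ℕ) (ψ : DirichletCharacter ℂ Q) {q₁ : ℕ} (hq₁ : 0 < q₁) {t : ℝ}
    (ht : 0 < t) : Summable (crossTerm κ ψ q₁ t) := by
  have hQ : (0 : ℝ) < Q := by exact_mod_cast NeZero.pos Q
  have hq₁' : (0 : ℝ) < q₁ := by exact_mod_cast hq₁
  have hgauss : ∀ {c : ℝ}, 0 < c → Summable fun n : ℤ => Real.exp (-(c * n ^ 2)) := by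
    intro c hc
    refine (summable_gaussTerm 0 (a := c / Real.pi) (by positivity)).congr fun n => ?_
    rw [gaussTerm, pow_zero, one_mul, Real.abs_exp]
    congr 2
    field_simp
  have h := (hgauss (c := t * q₁ / Q) (by positivity)).mul_of_nonneg
    (hgauss (c := q₁ / (t * Q)) (by positivity)) (fun _ => (Real.exp_pos _).le)
    (fun _ => (Real.exp_pos _).le)
  refine (h.mul_right (Real.sqrt Q)).of_norm_bounded fun p => ?_
  refine (norm_crossTerm_le κ ψ q₁ ht p).trans ?_
  refine mul_le_mul (le_of_eq ?_) (norm_charSum_le ψ _ _) (norm_nonneg _) (by positivity)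
  congr 2 <;> ring

/-- The second moment of the theta functions over all characters modulo `q₁`, after Poisson
summation in the off-diagonal terms. -/
theorem sum_sq_normTheta_le (ψ : DirichletCharacter ℂ Q) {κ : ℕ} (hκ : κ = 0 ∨ κ = 1)
    {q₁ : ℕ} [NeZero q₁] {t : ℝ} (ht : 0 < t) :
    ∑ χ : DirichletCharacter ℂ q₁,
        normTheta κ (q₁ * Q) (fun n => prodChar χ ψ (n : ZMod (q₁ * Q))) t ^ 2 ≤
      q₁ * ((t / (q₁ * Q)) ^ (1 / 2 + κ : ℝ) *
          ∑' n : ℤ, ‖ψ n * gaussTerm κ (t / (q₁ * Q)) n‖ ^ 2 +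
        (Real.sqrt Q)⁻¹ * (∑' p : ℤ × ℤ, if p.1 = 0 then 0 else crossTerm κ ψ q₁ t p).re) := by
  have hQ : (0 : ℝ) < Q := by exact_mod_cast NeZero.pos Q
  have hq₁ : (0 : ℝ) < q₁ := by exact_mod_cast NeZero.pos q₁
  set a : ℝ := t / (q₁ * Q) with ha
  have ha0 : 0 < a := by positivity
  set b : ℤ → ℂ := fun n => ψ n * gaussTerm κ a n with hb
  have hbs : Summable fun n => ‖b n‖ := (summable_gaussTerm κ ha0).of_nonneg_of_le
    (fun _ => norm_nonneg _) fun n => by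
      rw [hb, norm_mul, Complex.norm_real]
      exact mul_le_of_le_one_left (norm_nonneg _) (ψ.norm_le_one _)
  have h1 : ∀ χ : DirichletCharacter ℂ q₁,
      normTheta κ (q₁ * Q) (fun n => prodChar χ ψ (n : ZMod (q₁ * Q))) t ^ 2 =
        a ^ (1 / 2 + κ : ℝ) * ‖∑' n : ℤ, χ n * b n‖ ^ 2 := by
    intro χ
    rw [sq_normTheta _ _ _ ht.le, thetaSum]
    push_cast
    simp_rw [prodChar_apply, mul_assoc]
    rfl
  -- Poisson summation with shift `L = q₁l` and `a = t/(q₁Q)`, for which `aL² = t q₁ l²/Q` and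
  -- `h²/(aQ²) = q₁h²/(tQ)`.
  have hoff : ∀ l : ℤ, ((a ^ (1 / 2 + κ : ℝ) : ℝ) : ℂ) *
      ∑' n : ℤ, b (n + q₁ * l) * conj (b n) =
        ((Real.sqrt Q)⁻¹ : ℝ) * ∑' h : ℤ, crossTerm κ ψ q₁ t (l, h) := by
    intro l
    have h := tsum_correlation_eq ψ hκ ha0 (q₁ * l)
    rw [hb]
    refine Eq.trans h ?_
    congr 1
    refine tsum_congr fun h => ?_
    rw [crossTerm]
    congr 3
    push_cast
    congr 1
    rw [ha]
    congr 1
    · field_simp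
    · field_simp
  set Z : ℤ × ℤ → ℂ := fun p => if p.1 = 0 then 0 else crossTerm κ ψ q₁ t p with hZ
  have hZs : Summable Z := (summable_crossTerm κ ψ (NeZero.pos q₁) ht).norm.of_norm_bounded
    fun p => by
      rw [hZ]
      dsimp only
      split_ifs
      · simp
      · exact le_rfl
  have hF : Summable fun l : ℤ => ((a ^ (1 / 2 + κ : ℝ) : ℝ) : ℂ) *
      ∑' n : ℤ, b (n + q₁ * l) * conj (b n) :=
    Summable.mul_left _ (summable_mul_shift hbs q₁).prod_symm.prod
  -- The shift `l = 0` is kept as a plain sum over `n`; only the other shifts are dualised.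
  have htotal : ((a ^ (1 / 2 + κ : ℝ) : ℝ) : ℂ) * ∑' l : ℤ, ∑' n : ℤ, b (n + q₁ * l) * conj (b n) =
      ((a ^ (1 / 2 + κ : ℝ) * ∑' n : ℤ, ‖b n‖ ^ 2 : ℝ) : ℂ) +
        ((Real.sqrt Q)⁻¹ : ℝ) * ∑' p, Z p := by
    rw [← tsum_mul_left, hF.tsum_eq_add_tsum_ite 0, hZs.tsum_prod,
      ← tsum_mul_left (a := (((Real.sqrt Q)⁻¹ : ℝ) : ℂ))]
    congr 1
    · push_cast
      congr 1
      refine tsum_congr fun n => ?_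
      rw [mul_zero, add_zero, Complex.mul_conj']
    · refine tsum_congr fun l => ?_
      rw [hoff, hZ]
      dsimp only
      split_ifs <;> simp
  have h2 := sum_norm_sq_tsum_char_le hbs q₁
  calc _ = a ^ (1 / 2 + κ : ℝ) * ∑ χ : DirichletCharacter ℂ q₁, ‖∑' n : ℤ, χ n * b n‖ ^ 2 := by
        rw [Finset.mul_sum]
        exact Finset.sum_congr rfl fun χ _ => h1 χ
    _ ≤ a ^ (1 / 2 + κ : ℝ) *
        (q₁ * (∑' l : ℤ, ∑' n : ℤ, b (n + q₁ * l) * conj (b n)).re) := by gcongr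
    _ = q₁ * (((a ^ (1 / 2 + κ : ℝ) : ℝ) : ℂ) *
        ∑' l : ℤ, ∑' n : ℤ, b (n + q₁ * l) * conj (b n)).re := by
      rw [Complex.re_ofReal_mul]
      ring
    _ = _ := by rw [htotal, Complex.add_re, Complex.ofReal_re, Complex.re_ofReal_mul]

theorem exp_neg_le_inv {x : ℝ} (hx : 0 < x) : Real.exp (-x) ≤ x⁻¹ := by
  rw [Real.exp_neg]
  gcongr
  linarith [Real.add_one_le_exp x]

/-- The weights used to majorize the off-diagonal terms that are discarded. -/
noncomputable def tailWeight (η : ℝ) (p : ℤ × ℤ) : ℝ :=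
  |(p.1 : ℝ)| ^ (-1 - 2 * η) * if p.2 = 0 then 1 else |(p.2 : ℝ)| ^ (-2 : ℝ)

theorem summable_tailWeight {η : ℝ} (hη : 0 < η) : Summable (tailWeight η) := by
  have h1 : Summable fun n : ℤ => |(n : ℝ)| ^ (-1 - 2 * η) :=
    (Real.summable_abs_int_rpow (b := 1 + 2 * η) (by linarith)).congr fun n => by ring_nf
  have h2 : Summable fun n : ℤ => if n = 0 then (1 : ℝ) else |(n : ℝ)| ^ (-2 : ℝ) := by
    refine (summable_congr_cofinite ?_).1 (Real.summable_abs_int_rpow (b := 2) one_lt_two)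
    filter_upwards [(Set.finite_singleton (0 : ℤ)).compl_mem_cofinite] with n hn
    exact (if_neg (by simpa using hn)).symm
  exact h1.mul_of_nonneg h2 (fun n => by positivity) (fun n => by
    dsimp only
    split_ifs <;> positivity)

theorem tailWeight_nonneg (η : ℝ) (p : ℤ × ℤ) : 0 ≤ tailWeight η p := by
  unfold tailWeight
  split_ifs <;> positivity

/-- The zero-frequency terms. -/
theorem norm_crossTerm_zero_le (hQ : Squarefree Q) {ψ : DirichletCharacter ℂ Q}
    (hψ : ψ.IsPrimitive) (κ : ℕ) {q₁ : ℕ} (hc : Nat.Coprime q₁ Q) (hq₁ : 0 < q₁) {η : ℝ}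
    (hη : 0 < η) {t : ℝ} (ht : 1 ≤ t) {l : ℤ} (hl : l ≠ 0) :
    ‖crossTerm κ ψ q₁ t (l, 0)‖ ≤
      (1 + η) ^ (1 + η) * (Real.sqrt Q * (Q : ℝ) ^ η * t⁻¹ * tailWeight η (l, 0)) := by
  have hQ0 : (0 : ℝ) < Q := by exact_mod_cast NeZero.pos Q
  have hq₁' : (1 : ℝ) ≤ q₁ := by exact_mod_cast hq₁
  have ht0 : 0 < t := by linarith
  have hl' : 0 < |(l : ℝ)| := by simpa using hl
  have h1 := norm_charSum_zero_le hQ hψ hl (Nat.isCoprime_iff_coprime.2 hc)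
  -- The decay exponent `1 + η` yields `|l|^(-2-2η)`. One factor `|l|` pays for the bound on the
  -- complete sum, and what remains is summable.
  have h2 : Real.exp (-(t * q₁ * l ^ 2 / Q)) ≤
      (1 + η) ^ (1 + η) * ((Q : ℝ) ^ (1 + η) * t⁻¹ * (|(l : ℝ)| ^ (-1 - 2 * η) * |(l : ℝ)|⁻¹)) := by
    calc _ ≤ Real.exp (-(t * l ^ 2 / Q)) := by
          gcongr
          exact le_mul_of_one_le_right ht0.le hq₁'
      _ ≤ (1 + η) ^ (1 + η) * (t * l ^ 2 / Q) ^ (-(1 + η)) :=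
        exp_neg_le_rpow (by linarith) (by positivity)
      _ = (1 + η) ^ (1 + η) * ((Q : ℝ) ^ (1 + η) * t ^ (-(1 + η)) *
          (|(l : ℝ)| ^ (-1 - 2 * η) * |(l : ℝ)|⁻¹)) := by
        rw [← sq_abs (l : ℝ), Real.div_rpow (by positivity) hQ0.le,
          Real.mul_rpow ht0.le (by positivity), ← Real.rpow_natCast, ← Real.rpow_mul hl'.le,
          ← Real.rpow_neg_one |(l : ℝ)|, ← Real.rpow_add hl', Real.rpow_neg hQ0.le (1 + η), div_inv_eq_mul]
        have : ((2 : ℕ) : ℝ) * -(1 + η) = -1 - 2 * η + -1 := by push_cast; ring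
        rw [this]
        ring
      _ ≤ _ := by
        have : t ^ (-(1 + η)) ≤ t⁻¹ := by
          rw [← Real.rpow_neg_one]
          exact Real.rpow_le_rpow_of_exponent_le ht (by linarith)
        gcongr
  refine (norm_crossTerm_le κ ψ q₁ ht0 _).trans ?_
  have h3 : Real.exp (-(q₁ * ((0 : ℤ) : ℝ) ^ 2 / (t * Q))) = 1 := by simp
  dsimp only
  rw [h3, mul_one]
  have h4 : ‖charSum ψ ((0 : ℤ) : ZMod Q) ((q₁ * l : ℤ) : ZMod Q)‖ ≤ |(l : ℝ)| * (Real.sqrt Q)⁻¹ := by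
    simpa using h1
  refine (mul_le_mul h2 h4 (norm_nonneg _) (by positivity)).trans_eq ?_
  rw [tailWeight]
  simp only [if_true, mul_one]
  rw [Real.rpow_add hQ0, Real.rpow_one]
  have : (Q : ℝ) * (Real.sqrt Q)⁻¹ = Real.sqrt Q := by
    rw [← div_eq_mul_inv, Real.div_sqrt]
  calc _ = (1 + η) ^ (1 + η) * ((Q : ℝ) * (Real.sqrt Q)⁻¹ * (Q : ℝ) ^ η * t⁻¹ * (|(l : ℝ)| ^ (-1 - 2 * η) * (|(l : ℝ)|⁻¹ * |(l : ℝ)|))) := by ring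
    _ = _ := by rw [this, inv_mul_cancel₀ hl'.ne', mul_one]

/-- The terms of large frequency. -/
theorem norm_crossTerm_large_le (ψ : DirichletCharacter ℂ Q) (κ : ℕ) {q₁ : ℕ} (hq₁ : 0 < q₁)
    {η : ℝ} (hη : 0 < η) (hη1 : η ≤ 1) {t : ℝ} (ht : 1 ≤ t) {p : ℤ × ℤ} (hp1 : p.1 ≠ 0)
    (hp2 : p.2 ≠ 0)
    (hp : ((q₁ * Q : ℕ) : ℝ) ^ (1 + η) / (q₁ : ℝ) ^ 2 < |((p.1 * p.2 : ℤ) : ℝ)|) :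
    ‖crossTerm κ ψ q₁ t p‖ ≤
      (32 * (3 / η) ^ (3 / η)) * (Real.sqrt Q * t⁻¹ * tailWeight η p) := by
  have hQ0 : (1 : ℝ) ≤ Q := by exact_mod_cast NeZero.pos Q
  have hq₁' : (1 : ℝ) ≤ q₁ := by exact_mod_cast hq₁
  have ht0 : 0 < t := by linarith
  obtain ⟨l, h⟩ := p
  dsimp only at *
  have hl' : 1 ≤ |(l : ℝ)| := by exact_mod_cast Int.one_le_abs hp1
  have hh' : 1 ≤ |(h : ℝ)| := by exact_mod_cast Int.one_le_abs hp2
  set U : ℝ := t * q₁ * l ^ 2 / Q with hU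
  set W : ℝ := q₁ * h ^ 2 / (t * Q) with hW
  have hl2 : 0 < (l : ℝ) ^ 2 := by positivity
  have hh2 : 0 < (h : ℝ) ^ 2 := by positivity
  have hU0 : 0 < U := by positivity
  have hW0 : 0 < W := by positivity
  set qr : ℝ := ((q₁ * Q : ℕ) : ℝ) with hqr
  have hqr' : qr = q₁ * Q := by rw [hqr]; push_cast; ring
  have hqr1 : 1 ≤ qr := by rw [hqr']; nlinarith
  -- Since `UW = (q₁|lh|/Q)²` is independent of `t`, the mean inequality gives `U + W ≥ 2q₁|lh|/Q`,
  -- and the length of the dual sum is chosen so that this exceeds `2q^η`.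
  have hUW : 2 * qr ^ η ≤ U + W := by
    have h1 : U * W = (q₁ * |((l * h : ℤ) : ℝ)| / Q) ^ 2 := by
      rw [hU, hW, div_pow, mul_pow, sq_abs]
      push_cast
      field_simp
    have h2 : qr ^ η ≤ q₁ * |((l * h : ℤ) : ℝ)| / Q := by
      rw [le_div_iff₀ (by linarith)]
      have e : qr ^ (1 + η) / (q₁ : ℝ) ^ 2 = Q * qr ^ η / q₁ := by
        rw [Real.rpow_add (by linarith), Real.rpow_one]
        nth_rewrite 1 [hqr']
        field_simp
      rw [e, div_lt_iff₀ (by linarith)] at hp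
      linarith
    have h3 : (2 * qr ^ η) ^ 2 ≤ (U + W) ^ 2 := by
      have h4 : (qr ^ η) ^ 2 ≤ U * W := by rw [h1]; gcongr
      nlinarith [sq_nonneg (U - W)]
    exact le_of_sq_le_sq h3 (by positivity)
  -- Half of the exponent gives the saving `e^(-q^η)`. The other half gives `U⁻² W⁻¹`: here `U` is
  -- used twice so that the total power of `t` is `t⁻¹`.
  have hexp : Real.exp (-U) * Real.exp (-W) ≤
      Real.exp (-qr ^ η) * ((U / 4)⁻¹ * (U / 4)⁻¹) * (W / 2)⁻¹ := by
    calc _ ≤ Real.exp (-qr ^ η) * (Real.exp (-(U / 4)) * Real.exp (-(U / 4))) *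
          Real.exp (-(W / 2)) := by
          rw [← Real.exp_add, ← Real.exp_add, ← Real.exp_add, ← Real.exp_add]
          apply Real.exp_le_exp.2
          linarith
      _ ≤ _ := by
        gcongr
        · exact exp_neg_le_inv (by positivity)
        · exact exp_neg_le_inv (by positivity)
        · exact exp_neg_le_inv (by positivity)
  -- The exponent `3/η` saves `q³`, enough to cancel the factor `(Q/q₁)³` from `U⁻² W⁻¹`.
  have hexp' : Real.exp (-qr ^ η) ≤ (3 / η) ^ (3 / η) * (qr ^ 3)⁻¹ := by
    refine (exp_neg_le_rpow (s := 3 / η) (by positivity) (by positivity)).trans_eq ?_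
    rw [← Real.rpow_mul (by linarith), mul_neg, mul_div_cancel₀ _ hη.ne',
      Real.rpow_neg (by linarith)]
    congr 2
    exact_mod_cast Real.rpow_natCast qr 3
  have hwt : (|(l : ℝ)| ^ 4)⁻¹ * (|(h : ℝ)| ^ 2)⁻¹ ≤ tailWeight η (l, h) := by
    rw [tailWeight, if_neg hp2]
    have e1 : (|(l : ℝ)| ^ 4)⁻¹ ≤ |(l : ℝ)| ^ (-1 - 2 * η) := by
      rw [← Real.rpow_natCast, ← Real.rpow_neg (by positivity)]
      exact Real.rpow_le_rpow_of_exponent_le hl' (by push_cast; linarith)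
    have e2 : (|(h : ℝ)| ^ 2)⁻¹ = |(h : ℝ)| ^ (-2 : ℝ) := by
      rw [← Real.rpow_natCast, ← Real.rpow_neg (by positivity)]
      norm_num
    rw [e2]
    gcongr
  have hUW' : (U / 4)⁻¹ * (U / 4)⁻¹ * (W / 2)⁻¹ ≤
      32 * qr ^ 3 * t⁻¹ * ((|(l : ℝ)| ^ 4)⁻¹ * (|(h : ℝ)| ^ 2)⁻¹) := by
    have e : (U / 4)⁻¹ * (U / 4)⁻¹ * (W / 2)⁻¹ =
        32 * ((Q : ℝ) ^ 3 / q₁ ^ 3) * t⁻¹ * ((|(l : ℝ)| ^ 4)⁻¹ * (|(h : ℝ)| ^ 2)⁻¹) := by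
      have e1 : |(l : ℝ)| ^ 4 = (l : ℝ) ^ 4 := by rw [← abs_pow, abs_of_nonneg (by positivity)]
      rw [e1, sq_abs, hU, hW]
      have hl0 : (l : ℝ) ≠ 0 := by exact_mod_cast hp1
      have hh0 : (h : ℝ) ≠ 0 := by exact_mod_cast hp2
      field_simp
      norm_num
    rw [e]
    have : (Q : ℝ) ^ 3 / q₁ ^ 3 ≤ qr ^ 3 := by
      rw [hqr', mul_pow]
      exact (div_le_self (by positivity) (one_le_pow₀ hq₁')).trans
        (le_mul_of_one_le_left (by positivity) (one_le_pow₀ hq₁'))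
    gcongr
  refine (norm_crossTerm_le κ ψ q₁ ht0 _).trans ?_
  calc _ ≤ (Real.exp (-qr ^ η) * ((U / 4)⁻¹ * (U / 4)⁻¹) * (W / 2)⁻¹) * Real.sqrt Q :=
        mul_le_mul hexp (norm_charSum_le ψ _ _) (norm_nonneg _) (by positivity)
    _ = Real.exp (-qr ^ η) * ((U / 4)⁻¹ * (U / 4)⁻¹ * (W / 2)⁻¹) * Real.sqrt Q := by ring
    _ ≤ ((3 / η) ^ (3 / η) * (qr ^ 3)⁻¹) *
        (32 * qr ^ 3 * t⁻¹ * ((|(l : ℝ)| ^ 4)⁻¹ * (|(h : ℝ)| ^ 2)⁻¹)) * Real.sqrt Q := by gcongr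
    _ = (32 * (3 / η) ^ (3 / η)) * (Real.sqrt Q * t⁻¹ *
        ((|(l : ℝ)| ^ 4)⁻¹ * (|(h : ℝ)| ^ 2)⁻¹)) := by field_simp
    _ ≤ _ := by gcongr

end

/-- The exponent `s = 1/4 + κ/2 + η` turns the squared terms into `|n|^(-1-4η)` and leaves
`a^(-2η)`. The condition `Q ≠ 1` makes `ψ(0) = 0`, which removes the term `n = 0`. -/
theorem exists_diagonal_le (κ : ℕ) {η : ℝ} (hη : 0 < η) : ∃ K : ℝ, 0 ≤ K ∧
    ∀ (Q : ℕ) [NeZero Q] (ψ : DirichletCharacter ℂ Q), Q ≠ 1 → ∀ a : ℝ, 0 < a →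
      a ^ (1 / 2 + κ : ℝ) * ∑' n : ℤ, ‖ψ n * gaussTerm κ a n‖ ^ 2 ≤ K * a ^ (-(2 * η)) := by
  set s : ℝ := 1 / 4 + κ / 2 + η with hs
  have hs0 : 0 < s := by positivity
  have hsum : Summable fun n : ℤ => |(n : ℝ)| ^ (-(1 + 4 * η)) :=
    Real.summable_abs_int_rpow (by linarith)
  refine ⟨(s ^ s) ^ 2 * ∑' n : ℤ, |(n : ℝ)| ^ (-(1 + 4 * η)),
    mul_nonneg (by positivity) (tsum_nonneg fun n => by positivity), fun Q _ ψ hQ a ha => ?_⟩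
  have hterm : ∀ n : ℤ, ‖ψ n * gaussTerm κ a n‖ ^ 2 ≤
      ((s ^ s) ^ 2 * a ^ (-(1 / 2 + κ : ℝ)) * a ^ (-(2 * η))) * |(n : ℝ)| ^ (-(1 + 4 * η)) := by
    intro n
    by_cases hn : n = 0
    · have : Nontrivial (ZMod Q) := ZMod.nontrivial_iff.2 hQ
      have h0 : ψ ((0 : ℤ) : ZMod Q) = 0 := by
        rw [Int.cast_zero]
        exact MulChar.map_zero ψ
      rw [hn, h0, zero_mul, norm_zero, zero_pow two_ne_zero]
      positivity
    · have hn' : (n : ℝ) ≠ 0 := by exact_mod_cast hn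
      have hn0 : 0 < |(n : ℝ)| := abs_pos.2 hn'
      have h1 : ‖ψ n * gaussTerm κ a n‖ ≤ s ^ s * a ^ (-s) * |(n : ℝ)| ^ (κ - 2 * s) := by
        rw [norm_mul, Complex.norm_real]
        exact (mul_le_of_le_one_left (norm_nonneg _) (ψ.norm_le_one _)).trans
          (abs_gaussTerm_le κ ha hs0 hn')
      calc _ ≤ (s ^ s * a ^ (-s) * |(n : ℝ)| ^ (κ - 2 * s)) ^ 2 := by gcongr
        _ = (s ^ s) ^ 2 * (a ^ (-s)) ^ 2 * (|(n : ℝ)| ^ (κ - 2 * s)) ^ 2 := by ring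
        _ = _ := by
          rw [← Real.rpow_mul_natCast ha.le, ← Real.rpow_mul_natCast hn0.le, mul_assoc ((s ^ s) ^ 2) (a ^ (-(1 / 2 + κ : ℝ))),
            ← Real.rpow_add ha, hs]
          congr 3
          · push_cast; ring
          · push_cast; ring
  have hsum' := hsum.mul_left ((s ^ s) ^ 2 * a ^ (-(1 / 2 + κ : ℝ)) * a ^ (-(2 * η)))
  have h := (hsum'.of_nonneg_of_le (fun n => by positivity) hterm).tsum_le_tsum hterm hsum'
  rw [tsum_mul_left] at h
  calc _ ≤ a ^ (1 / 2 + κ : ℝ) * (((s ^ s) ^ 2 * a ^ (-(1 / 2 + κ : ℝ)) * a ^ (-(2 * η))) *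
        ∑' n : ℤ, |(n : ℝ)| ^ (-(1 + 4 * η))) := by gcongr
    _ = (a ^ (1 / 2 + κ : ℝ) * a ^ (-(1 / 2 + κ : ℝ))) * ((s ^ s) ^ 2 * (∑' n : ℤ,
        |(n : ℝ)| ^ (-(1 + 4 * η))) * a ^ (-(2 * η))) := by ring
    _ = _ := by rw [← Real.rpow_add ha, add_neg_cancel, Real.rpow_zero, one_mul]

/-- The length `q ^ (1 + η) / q₁ ^ 2` of the dual sum, for `q = q₁ * Q`. -/
noncomputable def dualLength (η : ℝ) (q₁ Q : ℕ) : ℝ :=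
  ((q₁ * Q : ℕ) : ℝ) ^ (1 + η) / (q₁ : ℝ) ^ 2

theorem dualLength_nonneg (η : ℝ) (q₁ Q : ℕ) : 0 ≤ dualLength η q₁ Q := by
  unfold dualLength
  positivity

section
variable {Q : ℕ} [NeZero Q]

/-- The dual sum: the off-diagonal terms of small nonzero frequency. -/
noncomputable def dualSum (κ : ℕ) (η : ℝ) (ψ : DirichletCharacter ℂ Q) (q₁ : ℕ) (t : ℝ) : ℂ :=
  ∑ m ∈ punctured (dualLength η q₁ Q), ∑ p ∈ m.divisorsAntidiag, crossTerm κ ψ q₁ t p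

/-- The pairs with `0 < |lh|` up to `dualLength` make up the dual sum exactly; each other pair with
`l ≠ 0` has `h = 0` or large `|lh|`, and both kinds are majorised by `tailWeight`. -/
theorem norm_tsum_crossTerm_sub_dualSum_le (hQ : Squarefree Q) {ψ : DirichletCharacter ℂ Q}
    (hψ : ψ.IsPrimitive) (κ : ℕ) {q₁ : ℕ} (hc : Nat.Coprime q₁ Q) (hq₁ : 0 < q₁) {η : ℝ}
    (hη : 0 < η) (hη1 : η ≤ 1) {t : ℝ} (ht : 1 ≤ t) :
    ‖(∑' p : ℤ × ℤ, if p.1 = 0 then 0 else crossTerm κ ψ q₁ t p) - dualSum κ η ψ q₁ t‖ ≤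
      (((1 + η) ^ (1 + η) + 32 * (3 / η) ^ (3 / η)) * ∑' p, tailWeight η p) *
        (Real.sqrt Q * (Q : ℝ) ^ η * t⁻¹) := by
  have hQ1 : (1 : ℝ) ≤ Q := by exact_mod_cast NeZero.pos Q
  have ht0 : 0 < t := by linarith
  set Z : ℤ × ℤ → ℂ := fun p => if p.1 = 0 then 0 else crossTerm κ ψ q₁ t p with hZ
  have hZs : Summable Z := (summable_crossTerm κ ψ hq₁ ht0).norm.of_norm_bounded
    fun p => by
      rw [hZ]
      dsimp only
      split_ifs
      · simp
      · exact le_rfl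
  set S : Finset (ℤ × ℤ) := (punctured (dualLength η q₁ Q)).biUnion Int.divisorsAntidiag with hS
  have hmem : ∀ p, p ∈ S ↔ p.1 * p.2 ∈ punctured (dualLength η q₁ Q) := by
    intro p
    rw [hS, Finset.mem_biUnion]
    constructor
    · rintro ⟨m, hm, hp⟩
      rwa [(Int.mem_divisorsAntidiag.1 hp).1]
    · intro h
      refine ⟨_, h, Int.mem_divisorsAntidiag.2 ⟨rfl, ?_⟩⟩
      exact abs_pos.1 ((mem_punctured _ _).1 h).1
  have hdual : dualSum κ η ψ q₁ t = ∑ p ∈ S, Z p := by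
    rw [dualSum, hS, Finset.sum_biUnion]
    · refine Finset.sum_congr rfl fun m _ => Finset.sum_congr rfl fun p hp => ?_
      have h := Int.mem_divisorsAntidiag.1 hp
      rw [hZ]
      dsimp only
      rw [if_neg]
      intro h0
      exact h.2 (by rw [← h.1, h0, zero_mul])
    · intro m _ m' _ hmm
      refine Finset.disjoint_left.2 fun p hp hp' => hmm ?_
      rw [← (Int.mem_divisorsAntidiag.1 hp).1, (Int.mem_divisorsAntidiag.1 hp').1]
  have hg : HasSum (fun p => if p ∈ S then Z p else 0) (∑ p ∈ S, Z p) := by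
    have : HasSum (fun p => if p ∈ S then Z p else 0) (∑ p ∈ S, if p ∈ S then Z p else 0) :=
      hasSum_sum_of_ne_finset_zero fun p hp => if_neg hp
    rwa [Finset.sum_congr rfl fun p hp => if_pos hp] at this
  rw [hdual, ← (hZs.hasSum.sub hg).tsum_eq]
  set B := Real.sqrt Q * (Q : ℝ) ^ η * t⁻¹ with hB
  have hB0 : 0 ≤ B := by positivity
  set c₁ : ℝ := (1 + η) ^ (1 + η) with hc₁
  set c₂ : ℝ := 32 * (3 / η) ^ (3 / η) with hc₂
  have hc₁0 : 0 ≤ c₁ := by positivity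
  have hc₂0 : 0 ≤ c₂ := by positivity
  have hbound : ∀ p, ‖Z p - (if p ∈ S then Z p else 0)‖ ≤ ((c₁ + c₂) * B) * tailWeight η p := by
    intro p
    have hw := tailWeight_nonneg η p
    have hrhs : 0 ≤ ((c₁ + c₂) * B) * tailWeight η p := by positivity
    by_cases hp : p ∈ S
    · rwa [if_pos hp, sub_self, norm_zero]
    rw [if_neg hp, sub_zero, hZ]
    dsimp only
    split_ifs with h1
    · rwa [norm_zero]
    obtain ⟨l, h⟩ := p
    by_cases h2 : h = 0
    · subst h2
      refine (norm_crossTerm_zero_le hQ hψ κ hc hq₁ hη ht h1).trans ?_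
      rw [← hB, ← hc₁]
      nlinarith [mul_nonneg hc₂0 (mul_nonneg hB0 hw)]
    · have h3 : ((q₁ * Q : ℕ) : ℝ) ^ (1 + η) / (q₁ : ℝ) ^ 2 < |((l * h : ℤ) : ℝ)| := by
        rw [hmem, mem_punctured, not_and, not_le] at hp
        have := hp (abs_pos.2 (mul_ne_zero h1 h2))
        rwa [Int.cast_abs] at this
      refine (norm_crossTerm_large_le ψ κ hq₁ hη hη1 ht h1 h2 h3).trans ?_
      rw [← hc₂, mul_assoc (c₁ + c₂)]
      have h4 : Real.sqrt Q * t⁻¹ ≤ B := by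
        rw [hB]
        gcongr
        exact le_mul_of_one_le_right (by positivity) (Real.one_le_rpow hQ1 hη.le)
      gcongr
      linarith
  refine (tsum_of_norm_bounded ((summable_tailWeight hη).hasSum.mul_left _) hbound).trans_eq ?_
  ring

end

theorem exists_sum_sq_normTheta_le {κ : ℕ} (hκ : κ = 0 ∨ κ = 1) {η : ℝ} (hη : 0 < η)
    (hη1 : η ≤ 1 / 2) : ∃ K : ℝ, 0 ≤ K ∧
    ∀ (q₁ Q : ℕ) [NeZero q₁] [NeZero Q], Squarefree Q → Nat.Coprime q₁ Q → Q ≠ 1 →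
      ∀ ψ : DirichletCharacter ℂ Q, ψ.IsPrimitive → ∀ t : ℝ, 1 ≤ t →
        ∑ χ : DirichletCharacter ℂ q₁,
            normTheta κ (q₁ * Q) (fun n => prodChar χ ψ (n : ZMod (q₁ * Q))) t ^ 2 ≤
          q₁ * (K * ((q₁ * Q : ℕ) : ℝ) ^ (2 * η) * t ^ (-(2 * η)) +
            (Real.sqrt Q)⁻¹ * (dualSum κ η ψ q₁ t).re) := by
  obtain ⟨K, hK0, hK⟩ := exists_diagonal_le κ hη
  set K' : ℝ := ((1 + η) ^ (1 + η) + 32 * (3 / η) ^ (3 / η)) * ∑' p, tailWeight η p with hK'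
  have hK'0 : 0 ≤ K' := mul_nonneg (by positivity) (tsum_nonneg (tailWeight_nonneg η))
  refine ⟨K + K', by positivity, fun q₁ Q _ _ hQ hc hQ1 ψ hψ t ht => ?_⟩
  have hQ0 : (1 : ℝ) ≤ Q := by exact_mod_cast NeZero.pos Q
  have hq₁ : (1 : ℝ) ≤ q₁ := by exact_mod_cast NeZero.pos q₁
  have ht0 : 0 < t := by linarith
  set qr : ℝ := ((q₁ * Q : ℕ) : ℝ) with hqr
  have hqr' : qr = q₁ * Q := by rw [hqr]; push_cast; ring
  have hqr0 : 0 < qr := by rw [hqr']; positivity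
  have hQqr : (Q : ℝ) ≤ qr := by rw [hqr']; exact le_mul_of_one_le_left (by linarith) hq₁
  refine (sum_sq_normTheta_le ψ hκ ht0).trans ?_
  have h1 := hK Q ψ hQ1 (t / (q₁ * Q)) (by positivity)
  have h1' : (t / (q₁ * Q)) ^ (-(2 * η)) = qr ^ (2 * η) * t ^ (-(2 * η)) := by
    rw [← hqr', Real.div_rpow ht0.le hqr0.le, Real.rpow_neg hqr0.le, div_inv_eq_mul, mul_comm]
  rw [h1'] at h1
  have h2 := norm_tsum_crossTerm_sub_dualSum_le hQ hψ κ hc (NeZero.pos q₁) hη (by linarith) ht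
  rw [← hK'] at h2
  have h3 := (Complex.re_le_norm _).trans h2
  rw [Complex.sub_re] at h3
  -- The factor `√Q` in the tail cancels the `Q^(-1/2)` in front, so the tail is no larger than the
  -- diagonal; `t⁻¹ ≤ t^(-2η)` uses `η ≤ 1/2`.
  have h4 : (Real.sqrt Q)⁻¹ * (K' * (Real.sqrt Q * (Q : ℝ) ^ η * t⁻¹)) ≤
      K' * (qr ^ (2 * η) * t ^ (-(2 * η))) := by
    have hs : 0 < Real.sqrt Q := Real.sqrt_pos.2 (by linarith)
    have e : (Real.sqrt Q)⁻¹ * (K' * (Real.sqrt Q * (Q : ℝ) ^ η * t⁻¹)) =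
        K' * ((Q : ℝ) ^ η * t⁻¹) := by field_simp
    rw [e]
    have e1 : (Q : ℝ) ^ η ≤ qr ^ (2 * η) :=
      (Real.rpow_le_rpow (by linarith) hQqr hη.le).trans
        (Real.rpow_le_rpow_of_exponent_le (hQ0.trans hQqr) (by linarith))
    have e2 : t⁻¹ ≤ t ^ (-(2 * η)) := by
      rw [← Real.rpow_neg_one]
      exact Real.rpow_le_rpow_of_exponent_le ht (by linarith)
    gcongr
  have h5 : (Real.sqrt Q)⁻¹ * (∑' p : ℤ × ℤ, if p.1 = 0 then 0 else crossTerm κ ψ q₁ t p).re ≤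
      (Real.sqrt Q)⁻¹ * (dualSum κ η ψ q₁ t).re + K' * (qr ^ (2 * η) * t ^ (-(2 * η))) := by
    refine le_trans ?_ (add_le_add_right h4 _)
    rw [← mul_add]
    gcongr
    linarith
  refine mul_le_mul_of_nonneg_left ?_ (by positivity)
  linarith

/-! ### Integration over `t` and the coefficients of the dual sum. -/

theorem continuous_crossKernel (κ : ℕ) : Continuous (crossKernel κ) := by
  unfold crossKernel
  split_ifs <;> fun_prop

/-- The Mellin-type integral of the cross kernel weighting a given shift and frequency. -/
noncomputable def kernelIntegral (κ : ℕ) (η : ℝ) (q₁ Q : ℕ) (p : ℤ × ℤ) : ℝ :=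
  ∫ t in Set.Ioi (1 : ℝ),
    crossKernel κ (t * q₁ * p.1 ^ 2 / Q + q₁ * p.2 ^ 2 / (t * Q)) * t ^ (η - 1)

/-- As `|l| ≥ 1`, the argument of the kernel is at least `t/Q`. Decay of order `2η` then beats the
weight `t^(η-1)` at the cost of `Q^(2η)`, uniformly in the pair. -/
theorem abs_crossKernel_mul_rpow_le (κ : ℕ) {η : ℝ} (hη : 0 < η) {q₁ Q : ℕ} (hq₁ : 0 < q₁)
    (hQ : 0 < Q) {p : ℤ × ℤ} (hp : p.1 ≠ 0) {t : ℝ} (ht : 0 < t) :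
    |crossKernel κ (t * q₁ * p.1 ^ 2 / Q + q₁ * p.2 ^ 2 / (t * Q)) * t ^ (η - 1)| ≤
      ((2 * η) ^ (2 * η) * (Q : ℝ) ^ (2 * η)) * t ^ (-1 - η) := by
  have hQ0 : (0 : ℝ) < Q := by exact_mod_cast hQ
  have hq₁' : (1 : ℝ) ≤ q₁ := by exact_mod_cast hq₁
  have hp1 : (1 : ℝ) ≤ (p.1 : ℝ) ^ 2 := by
    rw [← sq_abs]
    exact one_le_pow₀ (by exact_mod_cast Int.one_le_abs hp)
  have hle : t / Q ≤ t * q₁ * p.1 ^ 2 / Q + q₁ * p.2 ^ 2 / (t * Q) := by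
    have h1 : t ≤ t * q₁ * p.1 ^ 2 := by
      rw [mul_assoc]
      exact le_mul_of_one_le_right ht.le (by nlinarith)
    have h2 : t / Q ≤ t * q₁ * p.1 ^ 2 / Q := by gcongr
    have h3 : 0 ≤ q₁ * (p.2 : ℝ) ^ 2 / (t * Q) := by positivity
    linarith
  rw [abs_mul, abs_of_nonneg (a := t ^ (η - 1)) (by positivity)]
  calc _ ≤ Real.exp (-(t / Q)) * t ^ (η - 1) := by
        gcongr
        exact (abs_crossKernel_le κ (by positivity)).trans (Real.exp_le_exp.2 (by linarith))
    _ ≤ ((2 * η) ^ (2 * η) * (t / Q) ^ (-(2 * η))) * t ^ (η - 1) := by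
        gcongr
        exact exp_neg_le_rpow (by positivity) (by positivity)
    _ = ((2 * η) ^ (2 * η) * (Q : ℝ) ^ (2 * η)) * (t ^ (-(2 * η)) * t ^ (η - 1)) := by
        rw [Real.div_rpow ht.le hQ0.le, Real.rpow_neg hQ0.le, div_inv_eq_mul]
        ring
    _ = _ := by
        rw [← Real.rpow_add ht]
        ring_nf

theorem integrableOn_crossKernel (κ : ℕ) {η : ℝ} (hη : 0 < η) {q₁ Q : ℕ} (hq₁ : 0 < q₁)
    (hQ : 0 < Q) {p : ℤ × ℤ} (hp : p.1 ≠ 0) :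
    MeasureTheory.IntegrableOn (fun t : ℝ =>
      crossKernel κ (t * q₁ * p.1 ^ 2 / Q + q₁ * p.2 ^ 2 / (t * Q)) * t ^ (η - 1)) (Set.Ioi 1) := by
  have hlt : -1 - η < -1 := by linarith
  have hQ0 : (0 : ℝ) < Q := by exact_mod_cast hQ
  refine MeasureTheory.Integrable.mono' ((integrableOn_Ioi_rpow_of_lt hlt one_pos).const_mul
    ((2 * η) ^ (2 * η) * (Q : ℝ) ^ (2 * η))) ?_ ?_
  · refine ContinuousOn.aestronglyMeasurable (ContinuousOn.mul ?_ ?_) measurableSet_Ioi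
    · refine (continuous_crossKernel κ).comp_continuousOn (ContinuousOn.add (by fun_prop) ?_)
      refine ContinuousOn.div (by fun_prop) (by fun_prop) fun t ht => ?_
      have : (0 : ℝ) < t := one_pos.trans ht
      positivity
    · exact ContinuousOn.rpow_const (by fun_prop) fun t ht => Or.inl (one_pos.trans ht).ne'
  · filter_upwards [MeasureTheory.ae_restrict_mem measurableSet_Ioi] with t ht
    exact abs_crossKernel_mul_rpow_le κ hη hq₁ hQ hp (one_pos.trans ht)

theorem abs_kernelIntegral_le (κ : ℕ) {η : ℝ} (hη : 0 < η) {q₁ Q : ℕ} (hq₁ : 0 < q₁)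
    (hQ : 0 < Q) {p : ℤ × ℤ} (hp : p.1 ≠ 0) :
    |kernelIntegral κ η q₁ Q p| ≤ ((2 * η) ^ (2 * η) * η⁻¹) * (Q : ℝ) ^ (2 * η) := by
  have hlt : -1 - η < -1 := by linarith
  have h := MeasureTheory.norm_integral_le_of_norm_le
    (μ := MeasureTheory.volume.restrict (Set.Ioi (1 : ℝ)))
    (f := fun t : ℝ => crossKernel κ (t * q₁ * p.1 ^ 2 / Q + q₁ * p.2 ^ 2 / (t * Q)) * t ^ (η - 1))
    (((integrableOn_Ioi_rpow_of_lt hlt one_pos).const_mul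
      ((2 * η) ^ (2 * η) * (Q : ℝ) ^ (2 * η)))) (by
    filter_upwards [MeasureTheory.ae_restrict_mem measurableSet_Ioi] with t ht
    exact abs_crossKernel_mul_rpow_le κ hη hq₁ hQ hp (one_pos.trans ht))
  refine h.trans_eq ?_
  rw [MeasureTheory.integral_const_mul, integral_Ioi_one_rpow hlt]
  have : -1 / (-1 - η + 1) = η⁻¹ := by
    rw [neg_div, one_div, ← inv_neg]
    congr 1
    ring
  rw [this]
  ring

/-- The coefficients `α_m` of the dual sum. -/
noncomputable def dualCoeff (κ : ℕ) (η : ℝ) (q₁ Q : ℕ) (m : ℤ) : ℂ :=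
  if m ∈ punctured (dualLength η q₁ Q) then
    ∑ p ∈ m.divisorsAntidiag, (gcdFactor Q p.2 (q₁ * p.1) : ℂ) *
      Complex.exp (Real.pi * Complex.I * (p.2 * ((q₁ * p.1 : ℤ) : ℂ) / Q)) *
        (kernelIntegral κ η q₁ Q p : ℂ)
  else 0

theorem fst_ne_zero_of_mem_divisorsAntidiag {m : ℤ} {p : ℤ × ℤ} (hp : p ∈ m.divisorsAntidiag) :
    p.1 ≠ 0 := by
  intro h
  have h' := Int.mem_divisorsAntidiag.1 hp
  exact h'.2 (by rw [← h'.1, h, zero_mul])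

theorem norm_dualCoeff_le (κ : ℕ) {η : ℝ} (hη : 0 < η) {q₁ Q : ℕ} (hq₁ : 0 < q₁) (hQ : 0 < Q)
    (m : ℤ) : ‖dualCoeff κ η q₁ Q m‖ ≤ ((2 * η) ^ (2 * η) * η⁻¹ * (Q : ℝ) ^ (2 * η)) *
      ∑ p ∈ m.divisorsAntidiag, |gcdFactor Q p.2 (q₁ * p.1)| := by
  have hnn : 0 ≤ ∑ p ∈ m.divisorsAntidiag, |gcdFactor Q p.2 (q₁ * p.1)| :=
    Finset.sum_nonneg fun _ _ => abs_nonneg _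
  rw [dualCoeff]
  split_ifs
  · rw [Finset.mul_sum]
    refine norm_sum_le_of_le _ fun p hp => ?_
    have h1 : ‖Complex.exp (Real.pi * Complex.I * (p.2 * ((q₁ * p.1 : ℤ) : ℂ) / Q))‖ = 1 := by
      have : Real.pi * Complex.I * (p.2 * ((q₁ * p.1 : ℤ) : ℂ) / Q) =
          ((Real.pi * (p.2 * (q₁ * p.1 : ℤ) / Q) : ℝ) : ℂ) * Complex.I := by
        push_cast
        ring
      rw [this, Complex.norm_exp_ofReal_mul_I]
    rw [norm_mul, norm_mul, h1, mul_one, Complex.norm_real, Complex.norm_real, mul_comm]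
    exact mul_le_mul_of_nonneg_right
      (abs_kernelIntegral_le κ hη hq₁ hQ (fst_ne_zero_of_mem_divisorsAntidiag hp)) (norm_nonneg _)
  · rw [norm_zero]
    positivity

/-- The loss `8η` is `4η` from the squared kernel integral, `2η` from the divisor bound (`X ≤ q²`),
`η` from the length `X` and `η` from the divisors of `Q`. Any finite range is allowed because the
coefficients vanish beyond `X`. -/
theorem exists_sum_sq_dualCoeff_le (κ : ℕ) {η : ℝ} (hη : 0 < η) (hη1 : η ≤ 1) : ∃ C : ℝ, 0 ≤ C ∧
    ∀ q₁ Q : ℕ, 0 < q₁ → 0 < Q → Nat.Coprime q₁ Q → ∀ s : Finset ℤ,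
      ∑ m ∈ s, ‖dualCoeff κ η q₁ Q m‖ ^ 2 ≤
        C * (((q₁ * Q : ℕ) : ℝ) ^ (1 + 8 * η) / (q₁ : ℝ) ^ 2) := by
  obtain ⟨C, hC, h⟩ := exists_sum_sq_gcdFactor_le hη
  set K : ℝ := (2 * η) ^ (2 * η) * η⁻¹ with hK
  refine ⟨K ^ 2 * C, by positivity, fun q₁ Q hq₁ hQ hc s => ?_⟩
  have hQ0 : (1 : ℝ) ≤ Q := by exact_mod_cast hQ
  have hq₁' : (1 : ℝ) ≤ q₁ := by exact_mod_cast hq₁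
  set qr : ℝ := ((q₁ * Q : ℕ) : ℝ) with hqr
  have hqr' : qr = q₁ * Q := by rw [hqr]; push_cast; ring
  have hQqr : (Q : ℝ) ≤ qr := by rw [hqr']; exact le_mul_of_one_le_left (by linarith) hq₁'
  have hqr1 : 1 ≤ qr := hQ0.trans hQqr
  have hqr0 : 0 < qr := by linarith
  set X := dualLength η q₁ Q with hX
  have hX0 : 0 ≤ X := dualLength_nonneg _ _ _
  have hXle : X ≤ qr ^ (2 : ℝ) := by
    rw [hX, dualLength, ← hqr]
    exact (div_le_self (by positivity) (one_le_pow₀ hq₁')).trans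
      (Real.rpow_le_rpow_of_exponent_le hqr1 (by linarith))
  have h1 : ∑ m ∈ s, ‖dualCoeff κ η q₁ Q m‖ ^ 2 ≤
      ∑ m ∈ punctured X, ‖dualCoeff κ η q₁ Q m‖ ^ 2 := by
    rw [← Finset.sum_filter_add_sum_filter_not s (· ∈ punctured X),
      Finset.sum_eq_zero (s := s.filter (· ∉ punctured X)), add_zero]
    · exact Finset.sum_le_sum_of_subset_of_nonneg (fun m hm => (Finset.mem_filter.1 hm).2)
        fun _ _ _ => by positivity
    · intro m hm
      rw [dualCoeff, if_neg (Finset.mem_filter.1 hm).2]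
      simp
  calc _ ≤ ∑ m ∈ punctured X, (K * (Q : ℝ) ^ (2 * η)) ^ 2 *
        (∑ p ∈ m.divisorsAntidiag, |gcdFactor Q p.2 (q₁ * p.1)|) ^ 2 := by
        refine h1.trans (Finset.sum_le_sum fun m _ => ?_)
        rw [← mul_pow]
        gcongr
        exact norm_dualCoeff_le κ hη hq₁ hQ m
    _ ≤ (K * (Q : ℝ) ^ (2 * η)) ^ 2 * (C * (X ^ η * X * (Q : ℝ) ^ η)) := by
        rw [← Finset.mul_sum]
        gcongr
        exact h q₁ Q X hQ.ne' hc hX0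
    _ ≤ (K * qr ^ (2 * η)) ^ 2 * (C * ((qr ^ (2 : ℝ)) ^ η * X * qr ^ η)) := by gcongr
    _ = K ^ 2 * C * ((qr ^ (2 * η) * qr ^ (2 * η) * (qr ^ (2 * η) * (qr ^ (1 + η) * qr ^ η))) /
          (q₁ : ℝ) ^ 2) := by
        rw [hX, dualLength, ← hqr, ← Real.rpow_mul hqr0.le]
        ring
    _ = _ := by
        rw [← Real.rpow_add hqr0, ← Real.rpow_add hqr0, ← Real.rpow_add hqr0,
          ← Real.rpow_add hqr0]
        congr 3
        ring

section
variable {Q : ℕ} [NeZero Q]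

theorem crossTerm_mul_rpow_eq (hQ : Squarefree Q) {ψ : DirichletCharacter ℂ Q}
    (hψ : ψ.IsPrimitive) (κ : ℕ) (η : ℝ) (q₁ : ℕ) {m : ℤ} {p : ℤ × ℤ}
    (hp : p ∈ m.divisorsAntidiag) (t : ℝ) :
    crossTerm κ ψ q₁ t p * ((t ^ (η - 1) : ℝ) : ℂ) =
      ((gcdFactor Q p.2 (q₁ * p.1) : ℂ) *
        Complex.exp (Real.pi * Complex.I * (p.2 * ((q₁ * p.1 : ℤ) : ℂ) / Q)) *
          charSumOne ψ ((m * q₁ : ℤ) : ZMod Q)) *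
      ((crossKernel κ (t * q₁ * p.1 ^ 2 / Q + q₁ * p.2 ^ 2 / (t * Q)) * t ^ (η - 1) : ℝ) : ℂ) := by
  have h : p.2 * (q₁ * p.1) = m * q₁ := by
    rw [← (Int.mem_divisorsAntidiag.1 hp).1]
    ring
  rw [crossTerm, charSum_eq_gcdFactor_mul hQ hψ, h, Complex.ofReal_mul]
  ring

/-- Since `h · q₁l = q₁m`, all dependence on `ψ` sits in `K_ψ(mq₁)`, while the dependence on `t` is
in the kernel and integrates into the coefficient. -/
theorem integral_dualSum (hQ : Squarefree Q) {ψ : DirichletCharacter ℂ Q} (hψ : ψ.IsPrimitive)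
    (κ : ℕ) {η : ℝ} (hη : 0 < η) {q₁ : ℕ} (hq₁ : 0 < q₁) :
    MeasureTheory.IntegrableOn (fun t : ℝ => dualSum κ η ψ q₁ t * ((t ^ (η - 1) : ℝ) : ℂ))
      (Set.Ioi 1) ∧
    ∫ t in Set.Ioi (1 : ℝ), dualSum κ η ψ q₁ t * ((t ^ (η - 1) : ℝ) : ℂ) =
      ∑ m ∈ punctured (dualLength η q₁ Q), dualCoeff κ η q₁ Q m *
        charSumOne ψ ((m * q₁ : ℤ) : ZMod Q) := by
  have hint : ∀ m : ℤ, ∀ p ∈ m.divisorsAntidiag, MeasureTheory.IntegrableOn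
      (fun t : ℝ => crossTerm κ ψ q₁ t p * ((t ^ (η - 1) : ℝ) : ℂ)) (Set.Ioi 1) := by
    intro m p hp
    simp_rw [crossTerm_mul_rpow_eq hQ hψ κ η q₁ hp]
    exact (integrableOn_crossKernel κ hη hq₁ (NeZero.pos Q)
      (fst_ne_zero_of_mem_divisorsAntidiag hp)).ofReal.const_mul _
  simp_rw [dualSum, Finset.sum_mul]
  refine ⟨MeasureTheory.integrable_finsetSum _ fun m _ =>
    MeasureTheory.integrable_finsetSum _ fun p hp => hint m p hp, ?_⟩
  rw [MeasureTheory.integral_finsetSum _ fun m _ =>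
    MeasureTheory.integrable_finsetSum _ fun p hp => hint m p hp]
  refine Finset.sum_congr rfl fun m hm => ?_
  rw [MeasureTheory.integral_finsetSum _ fun p hp => hint m p hp, dualCoeff, if_pos hm,
    Finset.sum_mul]
  refine Finset.sum_congr rfl fun p hp => ?_
  simp_rw [crossTerm_mul_rpow_eq hQ hψ κ η q₁ hp]
  rw [MeasureTheory.integral_const_mul, integral_complex_ofReal, kernelIntegral]
  ring

end

/-! ### Assembly of the second moment bound. -/

/-- The short second moment is bounded by the dual sum when `Q ≠ 1`. -/
theorem exists_sum_sq_LFunction_le {κ : ℕ} (hκ : κ = 0 ∨ κ = 1) {η : ℝ} (hη : 0 < η)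
    (hη1 : η ≤ 1 / 2) : ∃ K : ℝ, 0 ≤ K ∧
    ∀ (q₁ Q : ℕ) [NeZero q₁] [NeZero Q], Squarefree Q → Nat.Coprime q₁ Q → Q ≠ 1 →
      ∀ ψ : DirichletCharacter ℂ Q, ψ.IsPrimitive → ∀ S : Finset (DirichletCharacter ℂ q₁),
        (∀ χ ∈ S, χ.IsPrimitive ∧ prodChar χ ψ (-1) = (-1) ^ κ) →
        ∑ χ ∈ S, ‖DirichletCharacter.LFunction (prodChar χ ψ) (1 / 2)‖ ^ 2 ≤
          K * ((q₁ * Q : ℕ) : ℝ) ^ (2 * η) * q₁ * (1 + 1 / Real.sqrt Q *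
            ‖∑ m ∈ punctured (dualLength η q₁ Q), dualCoeff κ η q₁ Q m *
              charSumOne ψ ((m * q₁ : ℤ) : ZMod Q)‖) := by
  obtain ⟨K, hK0, hK⟩ := exists_sum_sq_normTheta_le hκ hη hη1
  set c₀ : ℝ := ‖Complex.Gammaℝ (1 / 2 + κ)‖⁻¹ with hc₀
  refine ⟨c₀ ^ 2 * η⁻¹ * (K * η⁻¹ + 1), by positivity, fun q₁ Q _ _ hQ hc hQ1 ψ hψ S hS => ?_⟩
  have hQ0 : (1 : ℝ) ≤ Q := by exact_mod_cast NeZero.pos Q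
  have hq₁ : (1 : ℝ) ≤ q₁ := by exact_mod_cast NeZero.pos q₁
  set qr : ℝ := ((q₁ * Q : ℕ) : ℝ) with hqr
  have hqr1 : 1 ≤ qr := by
    rw [hqr]
    push_cast
    nlinarith
  obtain ⟨hDint, hDeq⟩ := integral_dualSum hQ hψ κ hη (NeZero.pos q₁)
  set D := ∑ m ∈ punctured (dualLength η q₁ Q), dualCoeff κ η q₁ Q m *
              charSumOne ψ ((m * q₁ : ℤ) : ZMod Q) with hD
  set θ : DirichletCharacter ℂ q₁ → ℝ → ℝ := fun χ =>
    normTheta κ (q₁ * Q) (fun n => prodChar χ ψ (n : ZMod (q₁ * Q))) with hθ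
  have hθ0 : ∀ χ t, 1 < t → 0 ≤ θ χ t := by
    intro χ t ht
    rw [hθ]
    unfold normTheta
    have : 0 < t := by linarith
    positivity
  -- An integrable majorant of the weighted sum of squares. By positivity it dominates each summand,
  -- which also gives the integrability needed for Cauchy–Schwarz.
  set G : ℝ → ℝ := fun t => q₁ * (K * qr ^ (2 * η) * t ^ (-1 - η) +
    (Real.sqrt Q)⁻¹ * (dualSum κ η ψ q₁ t * ((t ^ (η - 1) : ℝ) : ℂ)).re) with hG
  have hlt : -1 - η < -1 := by linarith
  have hI1 := integrableOn_Ioi_rpow_of_lt hlt one_pos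
  have hI2 : MeasureTheory.IntegrableOn
      (fun t : ℝ => (dualSum κ η ψ q₁ t * ((t ^ (η - 1) : ℝ) : ℂ)).re) (Set.Ioi 1) := hDint.re
  have hGint : MeasureTheory.IntegrableOn G (Set.Ioi 1) :=
    ((hI1.const_mul _).add (hI2.const_mul _)).const_mul _
  have hGval : ∫ t in Set.Ioi (1 : ℝ), G t =
      q₁ * (K * qr ^ (2 * η) * η⁻¹ + (Real.sqrt Q)⁻¹ * D.re) := by
    have h1 : ∫ t in Set.Ioi (1 : ℝ), t ^ (-1 - η) = η⁻¹ := by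
      rw [integral_Ioi_one_rpow hlt, neg_div, one_div, ← inv_neg]
      congr 1
      ring
    have h2 : ∫ t in Set.Ioi (1 : ℝ), (dualSum κ η ψ q₁ t * ((t ^ (η - 1) : ℝ) : ℂ)).re = D.re := by
      rw [← hDeq]
      exact integral_re hDint
    rw [hG, MeasureTheory.integral_const_mul, MeasureTheory.integral_add (hI1.const_mul _)
      (hI2.const_mul _), MeasureTheory.integral_const_mul, MeasureTheory.integral_const_mul, h1, h2]
  have hsum : ∀ t, 1 < t → ∑ χ, θ χ t ^ 2 * t ^ (η - 1) ≤ G t := by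
    intro t ht
    have ht0 : 0 < t := by linarith
    rw [← Finset.sum_mul]
    refine (mul_le_mul_of_nonneg_right (hK q₁ Q hQ hc hQ1 ψ hψ t ht.le)
      (by positivity)).trans_eq ?_
    rw [hG]
    dsimp only
    rw [Complex.re_mul_ofReal]
    have : t ^ (-1 - η) = t ^ (-(2 * η)) * t ^ (η - 1) := by
      rw [← Real.rpow_add ht0]
      ring_nf
    rw [this]
    ring
  have hθint : ∀ χ, MeasureTheory.IntegrableOn (fun t => θ χ t ^ 2 * t ^ (η - 1))
      (Set.Ioi 1) := by
    intro χ
    refine MeasureTheory.Integrable.mono' hGint ?_ ?_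
    · refine ContinuousOn.aestronglyMeasurable (ContinuousOn.mul (ContinuousOn.pow ?_ 2) ?_)
        measurableSet_Ioi
      · exact continuousOn_normTheta κ (NeZero.pos _) fun n =>
          DirichletCharacter.norm_le_one (prodChar χ ψ) _
      · exact ContinuousOn.rpow_const (by fun_prop) fun t ht => Or.inl (one_pos.trans ht).ne'
    · filter_upwards [MeasureTheory.ae_restrict_mem measurableSet_Ioi] with t ht
      have ht0 : (0 : ℝ) < t := one_pos.trans ht
      rw [Real.norm_of_nonneg (by positivity)]
      refine le_trans ?_ (hsum t ht)
      exact Finset.single_le_sum (f := fun χ => θ χ t ^ 2 * t ^ (η - 1))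
        (fun χ _ => by positivity) (Finset.mem_univ χ)
  have hL : ∀ χ ∈ S, ‖DirichletCharacter.LFunction (prodChar χ ψ) (1 / 2)‖ ^ 2 ≤
      c₀ ^ 2 * (η⁻¹ * ∫ t in Set.Ioi (1 : ℝ), θ χ t ^ 2 * t ^ (η - 1)) := by
    intro χ hχ
    have hN : q₁ * Q ≠ 1 := fun h => hQ1 (Nat.eq_one_of_mul_eq_one_left h)
    have h1 := norm_LFunction_half_le hκ hN (isPrimitive_prodChar hc (hS χ hχ).1 hψ) (hS χ hχ).2
    calc _ ≤ (c₀ * ∫ t in Set.Ioi (1 : ℝ), θ χ t / t) ^ 2 := by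
          gcongr
      _ ≤ _ := by
          rw [mul_pow]
          gcongr
          exact sq_integral_div_le hη (hθ0 χ) (hθint χ)
  have hθnn : ∀ χ, 0 ≤ ∫ t in Set.Ioi (1 : ℝ), θ χ t ^ 2 * t ^ (η - 1) := fun χ =>
    MeasureTheory.setIntegral_nonneg measurableSet_Ioi fun t ht => by
      have : (0 : ℝ) < t := one_pos.trans ht
      positivity
  calc _ ≤ ∑ χ ∈ S, c₀ ^ 2 * (η⁻¹ * ∫ t in Set.Ioi (1 : ℝ), θ χ t ^ 2 * t ^ (η - 1)) :=
        Finset.sum_le_sum hL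
    -- Primitivity and parity were needed only for the bound of the central value; by positivity the
    -- sum is now completed to all characters mod `q₁`.
    _ ≤ ∑ χ, c₀ ^ 2 * (η⁻¹ * ∫ t in Set.Ioi (1 : ℝ), θ χ t ^ 2 * t ^ (η - 1)) :=
        Finset.sum_le_sum_of_subset_of_nonneg (Finset.subset_univ S) fun χ _ _ => by
          have := hθnn χ
          positivity
    _ = c₀ ^ 2 * η⁻¹ * ∫ t in Set.Ioi (1 : ℝ), ∑ χ, θ χ t ^ 2 * t ^ (η - 1) := by
        rw [MeasureTheory.integral_finsetSum _ fun χ _ => hθint χ, Finset.mul_sum]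
        exact Finset.sum_congr rfl fun χ _ => (mul_assoc _ _ _).symm
    _ ≤ c₀ ^ 2 * η⁻¹ * ∫ t in Set.Ioi (1 : ℝ), G t := by
        refine mul_le_mul_of_nonneg_left ?_ (by positivity)
        exact MeasureTheory.setIntegral_mono_on
          (MeasureTheory.integrable_finsetSum _ fun χ _ => hθint χ) hGint measurableSet_Ioi
          fun t ht => hsum t ht
    _ = c₀ ^ 2 * η⁻¹ * q₁ * (K * η⁻¹ * qr ^ (2 * η) + 1 / Real.sqrt Q * D.re) := by
        rw [hGval]
        ring
    _ ≤ c₀ ^ 2 * η⁻¹ * q₁ * ((K * η⁻¹ + 1) * qr ^ (2 * η) * (1 + 1 / Real.sqrt Q * ‖D‖)) := by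
        have h1 : 1 ≤ qr ^ (2 * η) := Real.one_le_rpow hqr1 (by positivity)
        have h2 := Complex.re_le_norm D
        have h3 : 0 ≤ 1 / Real.sqrt Q := by positivity
        have h4 : 0 ≤ K * η⁻¹ := by positivity
        have h5 : 1 / Real.sqrt Q * D.re ≤ 1 / Real.sqrt Q * ‖D‖ := by gcongr
        have h6 : 0 ≤ 1 / Real.sqrt Q * ‖D‖ := by positivity
        have h7 : 1 ≤ (K * η⁻¹ + 1) * qr ^ (2 * η) := by nlinarith
        gcongr
        nlinarith
    _ = _ := by ring

theorem exists_shortSecondMoment_le_of_ne_one (sign : ℤˣ) {η : ℝ} (hη : 0 < η)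
    (hη1 : η ≤ 1 / 2) : ∃ C : ℝ, 0 ≤ C ∧
    ∀ (q₁ Q : ℕ) [NeZero q₁] [NeZero Q], Squarefree Q → Nat.Coprime q₁ Q → Q ≠ 1 →
      ∃ α : ℤ → ℂ, (∀ m ∉ punctured (dualLength η q₁ Q), α m = 0) ∧
        (∀ s : Finset ℤ, ∑ m ∈ s, ‖α m‖ ^ 2 ≤
          C * (((q₁ * Q : ℕ) : ℝ) ^ (1 + 8 * η) / (q₁ : ℝ) ^ 2)) ∧
        ∀ ψ : DirichletCharacter ℂ Q, ψ.IsPrimitive →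
          shortSecondMoment q₁ sign ψ ≤
            C * ((q₁ * Q : ℕ) : ℝ) ^ (2 * η) * q₁ * (1 + 1 / Real.sqrt Q *
              ‖∑ m ∈ punctured (dualLength η q₁ Q), α m *
                charSumOne ψ ((m * q₁ : ℤ) : ZMod Q)‖) := by
  obtain ⟨κ, hκ, hsign⟩ : ∃ κ : ℕ, (κ = 0 ∨ κ = 1) ∧ (((sign : ℤ) : ℂ) = (-1) ^ κ) := by
    rcases Int.units_eq_one_or sign with rfl | rfl
    · exact ⟨0, Or.inl rfl, by simp⟩
    · exact ⟨1, Or.inr rfl, by simp⟩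
  obtain ⟨K, hK0, hK⟩ := exists_sum_sq_LFunction_le hκ hη hη1
  obtain ⟨K', hK'0, hK'⟩ := exists_sum_sq_dualCoeff_le κ hη (by linarith)
  refine ⟨K + K', by positivity, fun q₁ Q _ _ hQ hc hQ1 => ⟨dualCoeff κ η q₁ Q,
    fun m hm => if_neg hm, fun s => ?_, fun ψ hψ => ?_⟩⟩
  · refine (hK' q₁ Q (NeZero.pos _) (NeZero.pos _) hc s).trans ?_
    gcongr
    linarith
  · classical
    rw [shortSecondMoment]
    refine (hK q₁ Q hQ hc hQ1 ψ hψ _ fun χ hχ => ?_).trans ?_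
    · rw [Finset.mem_filter] at hχ
      rw [← hsign]
      exact hχ.2
    · gcongr
      linarith

theorem shortSecondMoment_nonneg (q₁ : ℕ) {Q : ℕ} [NeZero q₁] [NeZero Q] (sign : ℤˣ)
    (ψ : DirichletCharacter ℂ Q) : 0 ≤ shortSecondMoment q₁ sign ψ :=
  Finset.sum_nonneg fun _ _ => by positivity

/-- For bounded `q₁` and trivial `Q` the short second moment is bounded. -/
theorem exists_shortSecondMoment_one_le (sign : ℤˣ) (N : ℕ) : ∃ B : ℝ, 0 ≤ B ∧
    ∀ (q₁ : ℕ) [NeZero q₁], q₁ ≤ N → ∀ ψ : DirichletCharacter ℂ 1,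
      shortSecondMoment q₁ sign ψ ≤ B := by
  -- There are finitely many moduli and only one character modulo `1`, so the sum of all the moments
  -- is a bound.
  refine ⟨∑ n ∈ Finset.range N, shortSecondMoment (n + 1) sign (1 : DirichletCharacter ℂ 1),
    Finset.sum_nonneg fun n _ => shortSecondMoment_nonneg _ _ _, fun q₁ _ hN ψ => ?_⟩
  obtain ⟨n, rfl⟩ := Nat.exists_eq_succ_of_ne_zero (NeZero.ne q₁)
  rw [Subsingleton.elim ψ 1]
  exact Finset.single_le_sum
    (f := fun n => shortSecondMoment (n + 1) sign (1 : DirichletCharacter ℂ 1))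
    (fun n _ => shortSecondMoment_nonneg _ _ _) (Finset.mem_range.2 hN)

/-- For `Q₁ = 1` one has `q = q₁`, and the size condition then confines `q₁` to a bounded range. -/
theorem le_of_le_mul_rpow_half_sub {A δ x : ℝ} (hA : 0 < A) (hδ : 0 < δ) (hx : 1 ≤ x)
    (h : x ≤ A * x ^ (1 / 2 - δ)) : x ≤ A ^ 2 := by
  have hx0 : 0 < x := by linarith
  have h1 : x ^ (1 / 2 - δ) ≤ x ^ (1 / 2 : ℝ) :=
    Real.rpow_le_rpow_of_exponent_le hx (by linarith)
  rw [← Real.sqrt_eq_rpow] at h1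
  have h2 : x ≤ A * Real.sqrt x := h.trans (by gcongr)
  have h3 := Real.mul_self_sqrt hx0.le
  have h4 : 0 < Real.sqrt x := Real.sqrt_pos.2 hx0
  have h5 : Real.sqrt x ≤ A := by
    rw [← mul_le_mul_iff_left₀ h4, h3]
    exact h2
  nlinarith

theorem proposition3p1 (ε δ A : ℝ) (hε : 0 < ε) (hδ : 0 < δ) (hA : 0 < A) :
    ∃ C : ℝ, 0 < C ∧
      ∀ (q q₁ Q₁ : ℕ) [NeZero q₁] [NeZero Q₁], q = q₁ * Q₁ → Squarefree q →
        (q₁ : ℝ) ≤ A * (q : ℝ) ^ (1 / 2 - δ) →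
        ∀ sign : ℤˣ, ∃ α : ℤ → ℂ,
          ∑ m ∈ punctured (C * ((q : ℝ) ^ (1 + ε) / (q₁ : ℝ) ^ 2)), ‖α m‖ ^ 2
              ≤ C * ((q : ℝ) ^ (1 + ε) / (q₁ : ℝ) ^ 2) ∧
          ∀ ψ₁ : DirichletCharacter ℂ Q₁, ψ₁.IsPrimitive →
            shortSecondMoment q₁ sign ψ₁ ≤
              C * (q : ℝ) ^ ε * q₁ *
                (1 + 1 / Real.sqrt Q₁ *
                  ‖∑ m ∈ punctured (C * ((q : ℝ) ^ (1 + ε) / (q₁ : ℝ) ^ 2)),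
                      α m * charSumOne ψ₁ ((m * (q₁ : ℤ) : ℤ) : ZMod Q₁)‖) := by
  -- The largest loss is `8η`, in the mean square of the coefficients; the minimum with `1` secures
  -- `η ≤ 1/2`.
  set η : ℝ := min ε 1 / 8 with hη
  have hηε : 8 * η ≤ ε := by linarith [min_le_left ε 1]
  have hη1 : η ≤ 1 / 2 := by linarith [min_le_right ε 1]
  have hη0 : 0 < η := by
    have : 0 < min ε 1 := lt_min hε one_pos
    positivity
  choose K hK0 hK using fun sign => exists_shortSecondMoment_le_of_ne_one sign hη0 hη1
  choose B hB0 hB using fun sign => exists_shortSecondMoment_one_le sign ⌊A ^ 2⌋₊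
  -- Summing over both signs makes `C` independent of the sign; the `1` ensures that the range of
  -- `m` contains the dual sum.
  set C : ℝ := 1 + ∑ sign, (K sign + B sign) with hC
  have hsum0 : ∀ sign ∈ Finset.univ, 0 ≤ K sign + B sign := fun sign _ =>
    add_nonneg (hK0 sign) (hB0 sign)
  have hC1 : 1 ≤ C := by linarith [Finset.sum_nonneg hsum0]
  have hCle : ∀ sign, K sign + B sign ≤ C := fun sign => by
    linarith [Finset.single_le_sum hsum0 (Finset.mem_univ sign)]
  refine ⟨C, by linarith, ?_⟩
  rintro _ q₁ Q _ _ rfl hsq hle sign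
  have hKC : K sign ≤ C := by linarith [hCle sign, hB0 sign]
  have hBC : B sign ≤ C := by linarith [hCle sign, hK0 sign]
  have hq₁ : (1 : ℝ) ≤ q₁ := by exact_mod_cast NeZero.pos q₁
  set q : ℝ := ((q₁ * Q : ℕ) : ℝ) with hq
  have hq1 : 1 ≤ q := by
    rw [hq]
    exact_mod_cast NeZero.pos (q₁ * Q)
  by_cases hQ1 : Q = 1
  · subst hQ1
    refine ⟨0, by simp; positivity, fun ψ _ => ?_⟩
    have hqq : q = q₁ := by rw [hq, mul_one]
    have hN : q₁ ≤ ⌊A ^ 2⌋₊ := by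
      refine Nat.le_floor (le_of_le_mul_rpow_half_sub hA hδ hq₁ ?_)
      rwa [hqq] at hle
    refine (hB sign q₁ hN ψ).trans (hBC.trans ?_)
    have h1 : 1 ≤ q ^ ε := Real.one_le_rpow hq1 hε.le
    calc C = C * 1 * 1 * (1 + 0) := by ring
      _ ≤ _ := by
        gcongr
        positivity
  · obtain ⟨α, hα0, hα, hS⟩ := hK sign q₁ Q (hsq.squarefree_of_dvd (Nat.dvd_mul_left Q q₁))
      (Nat.coprime_of_squarefree_mul hsq) hQ1
    refine ⟨α, (hα _).trans ?_, fun ψ hψ => ?_⟩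
    · rw [← hq]
      gcongr
    · have hsub : punctured (dualLength η q₁ Q) ⊆
          punctured (C * (q ^ (1 + ε) / (q₁ : ℝ) ^ 2)) := by
        intro m hm
        rw [mem_punctured] at hm ⊢
        refine ⟨hm.1, hm.2.trans ?_⟩
        rw [dualLength, ← hq]
        calc q ^ (1 + η) / (q₁ : ℝ) ^ 2 ≤ q ^ (1 + ε) / (q₁ : ℝ) ^ 2 := by
              gcongr
              linarith
          _ ≤ _ := le_mul_of_one_le_left (by positivity) hC1
      -- The coefficients vanish outside the shorter range, so lengthening the sum changes nothing.
      rw [← Finset.sum_subset hsub fun m _ hm => by rw [hα0 m hm, zero_mul]]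
      refine (hS ψ hψ).trans ?_
      rw [← hq]
      gcongr
      linarith
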